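/- Let $\mathcal{G}$ be a finite set of quantum gates that contains the Hadamard, $T=\mathrm{diag}(1,e^{i\pi/4})$ and CNOT gates, and such that the inverse of each gate of $\mathcal{G}$ is exactly implemented by a circuit over $\mathcal{G}$ acting on the same qubits (for example $\mathcal{G}=\{H,T,\mathrm{CNOT}\}$). All circuits below are unitary circuits over $\mathcal{G}$ with one designated output qubit. A function $f:\mathbb{Z}_{\ge 0}\to\mathbb{Z}_{\ge 1}$ is called polynomially bounded if some polynomial-time deterministic Turing machine outputs $1^{f(n)}$ on input $1^n$. A family $\{Q_x\}_{x\in\{0,1\}^*}$ of circuits is called polynomial-time uniformly generated if some polynomial-time deterministic Turing machine outputs a description of $Q_x$ on every input $x$. For a circuit $Q$ on $w$ qubits and $1\le k\le w$, let $p_{\mathrm{acc}}(Q,k)$ be the probability that measuring the output qubit in the computational basis gives $0$ after $Q$ is applied to the initial state $(|0\rangle\langle 0|)^{\otimes k}\otimes(I/2)^{\otimes(w-k)}$. Define the following classes of promise problems $A=(A_{\mathrm{yes}},A_{\mathrm{no}})$ over $\{0,1\}$, where in each case $\{Q_x\}$ ranges over polynomial-time uniformly generated families such that $Q_x$ acts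 on $w(|x|)$ qubits for some polynomially bounded function $w$: - $A\in\mathrm{NQP}$ iff for some $\{Q_x\}$, $p_{\mathrm{acc}}(Q_x,w(|x|))>0$ for all $x\in A_{\mathrm{yes}}$ and $p_{\mathrm{acc}}(Q_x,w(|x|))=0$ for all $x\in A_{\mathrm{no}}$ (all qubits are clean); - $A\in\mathrm{SBQP}$ iff for some $\{Q_x\}$ and some polynomially bounded $p$, $p_{\mathrm{acc}}(Q_x,w(|x|))\ge 2^{-p(|x|)}$ for all $x\in A_{\mathrm{yes}}$ and $p_{\mathrm{acc}}(Q_x,w(|x|))\le 2^{-p(|x|)-1}$ for all $x\in A_{\mathrm{no}}$; - $A\in\mathrm{NQ}_{[1]}\mathrm{P}$ iff for some $\{Q_x\}$ and some function $c:\mathbb{Z}_{\ge 0}\to(0,1]$, $p_{\mathrm{acc}}(Q_x,1)\ge c(|x|)$ for all $x\in A_{\mathrm{yes}}$ and $p_{\mathrm{acc}}(Q_x,1)\le 0$ for all $x\in A_{\mathrm{no}}$ (one clean qubit); - $A\in\mathrm{SBQ}_{[1]}\mathrm{P}$ iff for some $\{Q_x\}$ and some polynomially bounded $p$, $p_{\mathrm{acc}}(Q_x,1)\ge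 2^{-p(|x|)}$ for all $x\in A_{\mathrm{yes}}$ and $p_{\mathrm{acc}}(Q_x,1)\le 2^{-p(|x|)-1}$ for all $x\in A_{\mathrm{no}}$. Then $\mathrm{NQP}=\mathrm{NQ}_{[1]}\mathrm{P}$ and $\mathrm{SBQP}=\mathrm{SBQ}_{[1]}\mathrm{P}$. -/

import Mathlib

open Matrix Turing

/-! ### Gates and gate sets

The computational basis of `w` qubits is indexed by `Fin w → Bool`, with `false` for `0`
and `true` for `1`. -/

/-- A quantum gate: a unitary operator on `arity` qubits. -/
structure Gate where
  arity : ℕ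
  mat : Matrix (Fin arity → Bool) (Fin arity → Bool) ℂ
  unitary : mat ∈ Matrix.unitaryGroup (Fin arity → Bool) ℂ

namespace Gate

/-- Matrix of the Hadamard gate. -/
noncomputable def hadamardMat : Matrix (Fin 1 → Bool) (Fin 1 → Bool) ℂ :=
  Matrix.of fun x y => if x 0 = true ∧ y 0 = true then -(1 / (√2 : ℝ) : ℂ) else (1 / (√2 : ℝ) : ℂ)

/-- Matrix of the `T` gate, `diag(1, exp(iπ/4))`. -/
noncomputable def tMat : Matrix (Fin 1 → Bool) (Fin 1 → Bool) ℂ :=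
  Matrix.diagonal fun x => if x 0 = true then Complex.exp (Complex.I * (Real.pi / 4 : ℝ)) else 1

/-- Matrix of the controlled-NOT gate; qubit `0` is the control and qubit `1` the target. -/
def cnotMat : Matrix (Fin 2 → Bool) (Fin 2 → Bool) ℂ :=
  Matrix.of fun x y => if x 0 = y 0 ∧ x 1 = xor (y 0) (y 1) then 1 else 0

theorem hadamardMat_unitary : hadamardMat ∈ Matrix.unitaryGroup (Fin 1 → Bool) ℂ := by
  have h2 : ((√2 : ℝ) : ℂ) * ((√2 : ℝ) : ℂ) = 2 := by
    rw [← Complex.ofReal_mul, Real.mul_self_sqrt (by norm_num)]; norm_num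
  have h0 : ((√2 : ℝ) : ℂ) ≠ 0 := by
    intro h; rw [h] at h2; norm_num at h2
  have h3 : ((√2 : ℝ) : ℂ)⁻¹ * ((√2 : ℝ) : ℂ)⁻¹ = 1 / 2 := by
    rw [← mul_inv, h2]; norm_num
  rw [Matrix.mem_unitaryGroup_iff]
  ext x y
  rw [Matrix.mul_apply, ← (Equiv.funUnique (Fin 1) Bool).symm.sum_comp]
  have hxy : x = y ↔ x 0 = y 0 := by
    constructor
    · rintro rfl; rfl
    · intro h; ext i; rw [Fin.fin_one_eq_zero i, h]
  rw [Matrix.one_apply]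
  simp only [hxy]
  rcases hx : x 0 <;> rcases hy : y 0 <;>
    simp [hadamardMat, Matrix.star_apply, hx, hy, h3]
  norm_num

theorem tMat_unitary : tMat ∈ Matrix.unitaryGroup (Fin 1 → Bool) ℂ := by
  rw [Matrix.mem_unitaryGroup_iff, tMat, Matrix.star_eq_conjTranspose,
    Matrix.diagonal_conjTranspose, Matrix.diagonal_mul_diagonal, ← Matrix.diagonal_one]
  congr 1
  ext x
  by_cases h : x 0 = true
  · simp only [h, if_true, Pi.star_apply, RCLike.star_def, Complex.mul_conj,
      Complex.normSq_eq_norm_sq]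
    rw [mul_comm Complex.I, Complex.norm_exp_ofReal_mul_I]
    norm_num
  · simp [h]

theorem cnotMat_unitary : cnotMat ∈ Matrix.unitaryGroup (Fin 2 → Bool) ℂ := by
  rw [Matrix.mem_unitaryGroup_iff]
  ext x y
  rw [Matrix.mul_apply, ← (finTwoArrowEquiv Bool).symm.sum_comp, Fintype.sum_prod_type]
  have hxy : x = y ↔ x 0 = y 0 ∧ x 1 = y 1 := by
    constructor
    · rintro rfl; exact ⟨rfl, rfl⟩
    · rintro ⟨h, h'⟩; ext i; fin_cases i <;> simp [h, h']
  rw [Matrix.one_apply]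
  simp only [hxy]
  rcases hx : x 0 <;> rcases hy : y 0 <;> rcases hx' : x 1 <;> rcases hy' : y 1 <;>
    simp [cnotMat, Matrix.star_apply, hx, hy, hx', hy', finTwoArrowEquiv]

/-- The Hadamard gate. -/
noncomputable def hadamard : Gate := ⟨1, hadamardMat, hadamardMat_unitary⟩

/-- The `T` gate. -/
noncomputable def t : Gate := ⟨1, tMat, tMat_unitary⟩

/-- The controlled-NOT gate. -/
def cnot : Gate := ⟨2, cnotMat, cnotMat_unitary⟩

end Gate

/-- A finite set of quantum gates, listed as `gate 0, …, gate (size - 1)`. -/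
structure GateSet where
  size : ℕ
  gate : Fin size → Gate

/-! ### Quantum circuits -/

/-- Placement of a gate of `G` in a circuit over `w` qubits: a gate, with an ordered choice of
distinct qubits to which it is applied. -/
structure Instr (G : GateSet) (w : ℕ) where
  gate : Fin G.size
  wires : Fin (G.gate gate).arity ↪ Fin w

/-- The operator on `w` qubits that applies `M` to the qubits `e 0, …, e (k - 1)` and the
identity to all others. -/
def applyOn {k w : ℕ} (M : Matrix (Fin k → Bool) (Fin k → Bool) ℂ) (e : Fin k ↪ Fin w) :
    Matrix (Fin w → Bool) (Fin w → Bool) ℂ :=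
  Matrix.of fun x y =>
    if ∀ i, (∀ j, e j ≠ i) → x i = y i then M (fun j => x (e j)) (fun j => y (e j)) else 0

/-- The unitary operator induced by a sequence of gate placements; the head of the list is
applied first. -/
def gatesUnitary {G : GateSet} {w : ℕ} :
    List (Instr G w) → Matrix (Fin w → Bool) (Fin w → Bool) ℂ
  | [] => 1
  | I :: C => gatesUnitary C * applyOn (G.gate I.gate).mat I.wires

namespace GateSet

/-- The gate set contains the Hadamard, `T` and controlled-NOT gates. -/
def ContainsHTCNOT (G : GateSet) : Prop :=
  (∃ g, G.gate g = Gate.hadamard) ∧ (∃ g, G.gate g = Gate.t) ∧ (∃ g, G.gate g = Gate.cnot)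

/-- The inverse of each gate is exactly implemented by some circuit over the gate set, acting
on the same qubits (for instance `T⁻¹ = T⁷`). -/
def InverseClosed (G : GateSet) : Prop :=
  ∀ g : Fin G.size, ∃ C : List (Instr G (G.gate g).arity), gatesUnitary C = (G.gate g).matᴴ

end GateSet

/-- A quantum circuit over `G`: the number of qubits, the sequence of gates, and the designated
output qubit. -/
structure Circuit (G : GateSet) where
  width : ℕ
  output : Fin width
  gates : List (Instr G width)

/-- Self-delimiting unary code `1ⁿ0` of a natural number. -/
def unaryCode (n : ℕ) : List Bool := List.replicate n true ++ [false]

/-- Code of a gate placement: the index of the gate, then the qubits it acts on. -/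
def Instr.encode {G : GateSet} {w : ℕ} (I : Instr G w) : List Bool :=
  unaryCode I.gate ++ (List.ofFn fun j => unaryCode (I.wires j)).flatten

namespace Circuit

variable {G : GateSet}

/-- The description of a circuit, a string over `{0, 1}`: number of qubits, output qubit, and
the gates in order of application. -/
def encode (Q : Circuit G) : List Bool :=
  unaryCode Q.width ++ unaryCode Q.output ++ Q.gates.flatMap Instr.encode

/-- The unitary operator induced by the circuit. -/
def unitary (Q : Circuit G) : Matrix (Fin Q.width → Bool) (Fin Q.width → Bool) ℂ :=
  gatesUnitary Q.gates

end Circuit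

/-- The initial state `|0⟩⟨0|^{⊗k} ⊗ (I/2)^{⊗(w-k)}` with `k ≤ w` clean qubits. -/
noncomputable def initState (w k : ℕ) : Matrix (Fin w → Bool) (Fin w → Bool) ℂ :=
  Matrix.diagonal fun x => if ∀ i : Fin w, (i : ℕ) < k → x i = false then (1 / 2) ^ (w - k) else 0

/-- The projection onto the states in which the given qubit is `|0⟩`. -/
def accProj {w : ℕ} (o : Fin w) : Matrix (Fin w → Bool) (Fin w → Bool) ℂ :=
  Matrix.diagonal fun x => if x o = false then 1 else 0

/-- Acceptance probability `tr (Π_acc Q ρ Q†)` of the `k`-clean-qubit computation induced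
by `Q`: the output qubit is measured at the end, and the outcome `0` means acceptance. -/
noncomputable def accProb {G : GateSet} (Q : Circuit G) (k : ℕ) : ℝ :=
  (Matrix.trace (accProj Q.output * (Q.unitary * initState Q.width k * Q.unitaryᴴ))).re

/-! ### Polynomial-time uniformity -/

/-- A function `f` to the positive integers such that some polynomial-time deterministic Turing
machine outputs `1^{f(n)}` on input `1ⁿ`. -/
def PolyBounded (f : ℕ → ℕ) : Prop :=
  (∀ n, 0 < f n) ∧
    Nonempty (TM2ComputableInPolyTime (fun n : ℕ => List.replicate n true)
      (fun n : ℕ => List.replicate n true) f)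

/-- Some polynomial-time deterministic Turing machine outputs, on every input string `x`, the
description of the circuit `Q x`. -/
def PolyTimeUniform {G : GateSet} (Q : List Bool → Circuit G) : Prop :=
  Nonempty (TM2ComputableInPolyTime (fun x : List Bool => x) Circuit.encode Q)

/-! ### Complexity classes -/

/-- A promise problem over the alphabet `{0, 1}`. -/
structure PromiseProblem where
  yes : Set (List Bool)
  no : Set (List Bool)
  disjoint : Disjoint yes no

/-- Problems solvable with completeness `c` and soundness `s` by a polynomial-time uniformly
generated family of quantum circuits with `k(|x|)` clean qubits. -/
def QkP (G : GateSet) (k : ℕ → ℕ) (c s : ℕ → ℝ) : Set PromiseProblem :=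
  {A | ∃ (Q : List Bool → Circuit G) (w : ℕ → ℕ), PolyTimeUniform Q ∧ PolyBounded w ∧
    (∀ n, k n ≤ w n) ∧ (∀ x, (Q x).width = w x.length) ∧
    (∀ x ∈ A.yes, c x.length ≤ accProb (Q x) (k x.length)) ∧
    (∀ x ∈ A.no, accProb (Q x) (k x.length) ≤ s x.length)}

/-- `NQ[1]P`: the one-clean-qubit version of `NQP`. -/
def NQ1P (G : GateSet) : Set PromiseProblem :=
  {A | ∃ c : ℕ → ℝ, (∀ n, 0 < c n ∧ c n ≤ 1) ∧ A ∈ QkP G (fun _ => 1) c (fun _ => 0)}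

/-- `SBQ[1]P`: the one-clean-qubit version of `SBQP`. -/
def SBQ1P (G : GateSet) : Set PromiseProblem :=
  {A | ∃ p : ℕ → ℕ, PolyBounded p ∧
    A ∈ QkP G (fun _ => 1) (fun n => (1 / 2) ^ p n) (fun n => (1 / 2) ^ (p n + 1))}

/-- `NQP`: with all qubits initially in state `|0⟩`, the acceptance probability is nonzero on
yes-instances and zero on no-instances. -/
def NQP (G : GateSet) : Set PromiseProblem :=
  {A | ∃ (Q : List Bool → Circuit G) (w : ℕ → ℕ), PolyTimeUniform Q ∧ PolyBounded w ∧
    (∀ x, (Q x).width = w x.length) ∧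
    (∀ x ∈ A.yes, 0 < accProb (Q x) (w x.length)) ∧
    (∀ x ∈ A.no, accProb (Q x) (w x.length) = 0)}

/-- `SBQP`: with all qubits initially in state `|0⟩`, the acceptance probability is at least
`2^{-p(|x|)}` on yes-instances and at most `2^{-p(|x|)-1}` on no-instances. -/
def SBQP (G : GateSet) : Set PromiseProblem :=
  {A | ∃ (p : ℕ → ℕ) (Q : List Bool → Circuit G) (w : ℕ → ℕ), PolyBounded p ∧
    PolyTimeUniform Q ∧ PolyBounded w ∧ (∀ x, (Q x).width = w x.length) ∧
    (∀ x ∈ A.yes, (1 / 2) ^ p x.length ≤ accProb (Q x) (w x.length)) ∧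
    (∀ x ∈ A.no, accProb (Q x) (w x.length) ≤ (1 / 2) ^ (p x.length + 1))}

/-! ### Operators acting on some of the qubits -/

/-! One clean qubit is simulated by clean qubits through purification. A maximally mixed qubit is
half of a Bell pair, so a circuit with twice as many qubits has exactly the same acceptance
probability (`accProb_purify`), and all thresholds carry over unchanged.

For the converse, let `a` be the acceptance probability of a circuit `Q` on `w` clean qubits. The
simulating circuit `oneClean` has `4w + 2` qubits, of which only qubit `0` is clean. Call a basis
state ready if the `2w` qubits that carry two copies of `Q` are `0` and the flag qubit is `1`. The
circuit is `V`, then `W`, then `V`, then a flip of qubit `0`. Here `W` (`coreGates`) runs both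
copies, flips the flag if both accept, and runs the copies backwards. For a ready `u`, the branch in
which the flag is flipped is orthogonal to `u`, so `⟨u|W|u⟩ = i(1 - a²)` (`coreGates_diag`); the
phase `i` is a by-product of a cheap doubly controlled gate and has no influence. The operator `V`
(`checkGates`) adds readiness to qubit `0`. Hence acceptance means that exactly one of the states
before and after `W` is ready. Since rows and columns of `W` have norm one, this event has
probability `4^{-w} a² (2 - a²)` (`sum_check`, `accProb_oneClean`).

The test has `2w + 1` controls and no clean ancilla. It uses dirty ancillas, by nested toggling:
toggling before and after an inner operation adds exactly the change caused by that operation. The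
other ancillas are not restored, which is harmless: up to phases `V` is an involutive permutation of
basis states, and a change of variables removes it (`isMonomial_checkGates`).

Two copies are needed for the gap. The factor `2 - a²` lies between `1` and `2` and may cost a
factor `2`; squaring turns the ratio `2` between yes- and no-instances into `4`, so the ratio `2`
survives. For `NQP` only positivity matters, and `c(n)` is a lower bound over the finitely many
strings of length `n`.

The remaining work is uniformity: the description of `Q` must be turned into that of the new circuit
in polynomial time. Explicit multi-stack machines give closure under composition, concatenation and
reversal (`PolyTime.comp`, `PolyTime.append`, `PolyTime.reverse`), and two templates cover both
constructions: rewriting gate by gate (`polyTime_gates`, `polyTime_gates_reverse`) and loops over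
the width (`polyTime_layout`). -/

theorem eq_extend_iff {k w : ℕ} (e : Fin k ↪ Fin w) (x y : Fin w → Bool) :
    (∀ i, (∀ j, e j ≠ i) → x i = y i) ↔ x = Function.extend e (x ∘ e) y := by
  constructor
  · intro h
    funext i
    by_cases hi : ∃ j, e j = i
    · obtain ⟨j, rfl⟩ := hi
      rw [e.injective.extend_apply, Function.comp]
    · rw [Function.extend_apply' _ _ _ hi]
      exact h i fun j hj => hi ⟨j, hj⟩
  · intro h i hi
    rw [h, Function.extend_apply' _ _ _ (by rintro ⟨j, hj⟩; exact hi j hj)]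

theorem extend_agree {k w : ℕ} (e : Fin k ↪ Fin w) (s : Fin k → Bool) (y : Fin w → Bool) :
    ∀ i, (∀ j, e j ≠ i) → Function.extend e s y i = y i := fun i hi =>
  Function.extend_apply' _ _ _ (by rintro ⟨j, hj⟩; exact hi j hj)

theorem extend_comp_self {k w : ℕ} (e : Fin k ↪ Fin w) (s : Fin k → Bool) (y : Fin w → Bool) :
    Function.extend e s y ∘ e = s := by
  funext j
  simp [e.injective.extend_apply]

/-- A state that agrees with `u` off the chosen qubits is determined by its values on them. This
turns matrix products of local operators into sums over the local basis, and later counts the ready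
states. -/
theorem sum_agree {k w : ℕ} {R : Type*} [AddCommMonoid R] (e : Fin k ↪ Fin w) (u : Fin w → Bool)
    (F : (Fin w → Bool) → R) :
    (∑ v, if ∀ i, (∀ j, e j ≠ i) → v i = u i then F v else 0) =
      ∑ s, F (Function.extend e s u) := by
  symm
  refine Fintype.sum_of_injective (fun s => Function.extend e s u) ?_ _ _ ?_ ?_
  · intro s s' h
    have := congrArg (· ∘ e) h
    simpa only [extend_comp_self] using this
  · intro v hv
    rw [if_neg]
    intro h
    exact hv ⟨_, ((eq_extend_iff e v u).1 h).symm⟩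
  · intro s
    rw [if_pos (extend_agree e s u)]

theorem sum_applyOn_right {k w : ℕ} (M : Matrix (Fin k → Bool) (Fin k → Bool) ℂ)
    (e : Fin k ↪ Fin w) (u : Fin w → Bool) (F : (Fin w → Bool) → ℂ) :
    ∑ v, applyOn M e u v * F v = ∑ s, M (u ∘ e) s * F (Function.extend e s u) := by
  have h := sum_agree e u fun v => M (u ∘ e) (v ∘ e) * F v
  simp only [extend_comp_self] at h
  rw [← h]
  refine Finset.sum_congr rfl fun v _ => ?_
  simp only [applyOn, Matrix.of_apply, ite_mul, zero_mul]
  refine if_congr ?_ rfl rfl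
  exact forall₂_congr fun i _ => eq_comm

theorem applyOn_extend_left {k w : ℕ} (M : Matrix (Fin k → Bool) (Fin k → Bool) ℂ)
    (e : Fin k ↪ Fin w) (s : Fin k → Bool) (x z : Fin w → Bool) :
    applyOn M e (Function.extend e s x) z =
      if ∀ i, (∀ j, e j ≠ i) → x i = z i then M s (z ∘ e) else 0 := by
  have h1 : ∀ j, Function.extend e s x (e j) = s j := fun j => e.injective.extend_apply _ _ _
  simp only [applyOn, Matrix.of_apply, h1]
  refine if_congr ?_ rfl rfl
  exact forall₂_congr fun i hi => by rw [extend_agree e s x i hi]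

theorem applyOn_mul {k w : ℕ} (M N : Matrix (Fin k → Bool) (Fin k → Bool) ℂ)
    (e : Fin k ↪ Fin w) : applyOn (M * N) e = applyOn M e * applyOn N e := by
  ext x z
  rw [Matrix.mul_apply, sum_applyOn_right]
  simp only [applyOn_extend_left]
  simp only [applyOn, Matrix.of_apply, Matrix.mul_apply]
  split_ifs
  · rfl
  · simp

theorem applyOn_one {k w : ℕ} (e : Fin k ↪ Fin w) :
    applyOn (1 : Matrix (Fin k → Bool) (Fin k → Bool) ℂ) e = 1 := by
  ext x y
  simp only [applyOn, Matrix.of_apply, Matrix.one_apply]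
  by_cases h : x = y
  · subst h; simp
  · rw [if_neg h]
    split_ifs with h1 h2
    · exfalso
      apply h
      rw [(eq_extend_iff e x y).1 h1]
      funext i
      by_cases hi : ∃ j, e j = i
      · obtain ⟨j, rfl⟩ := hi
        rw [e.injective.extend_apply]
        exact congrFun h2 j
      · rw [Function.extend_apply' _ _ _ hi]
    · rfl
    · rfl

theorem applyOn_conjTranspose {k w : ℕ} (M : Matrix (Fin k → Bool) (Fin k → Bool) ℂ)
    (e : Fin k ↪ Fin w) : applyOn Mᴴ e = (applyOn M e)ᴴ := by
  ext x y
  simp only [applyOn, Matrix.of_apply, Matrix.conjTranspose_apply]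
  have : (∀ i, (∀ j, e j ≠ i) → x i = y i) ↔ (∀ i, (∀ j, e j ≠ i) → y i = x i) :=
    forall₂_congr fun i _ => eq_comm
  by_cases h : ∀ i, (∀ j, e j ≠ i) → x i = y i
  · rw [if_pos h, if_pos (this.1 h)]
  · rw [if_neg h, if_neg (fun h' => h (this.2 h')), star_zero]

theorem applyOn_applyOn {k l w : ℕ} (M : Matrix (Fin k → Bool) (Fin k → Bool) ℂ)
    (e : Fin k ↪ Fin l) (f : Fin l ↪ Fin w) :
    applyOn (applyOn M e) f = applyOn M (e.trans f) := by
  ext x y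
  simp only [applyOn, Matrix.of_apply, Function.Embedding.trans_apply]
  have : (∀ i, (∀ j, f (e j) ≠ i) → x i = y i) ↔
      (∀ i, (∀ j, f j ≠ i) → x i = y i) ∧ (∀ i, (∀ j, e j ≠ i) → x (f i) = y (f i)) := by
    constructor
    · intro h
      refine ⟨fun i hi => h i fun j => hi _, fun i hi => h _ fun j hj => hi j (f.injective hj)⟩
    · rintro ⟨h1, h2⟩ i hi
      by_cases h : ∃ j, f j = i
      · obtain ⟨j, rfl⟩ := h
        exact h2 j fun j' hj' => hi j' (by rw [hj'])
      · exact h1 i fun j hj => h ⟨j, hj⟩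
  by_cases h1 : ∀ i, (∀ j, f j ≠ i) → x i = y i
  · by_cases h2 : ∀ i, (∀ j, e j ≠ i) → x (f i) = y (f i)
    · rw [if_pos h1, if_pos h2, if_pos (this.2 ⟨h1, h2⟩)]
    · rw [if_pos h1, if_neg h2, if_neg (fun h => h2 (this.1 h).2)]
  · rw [if_neg h1, if_neg (fun h => h1 (this.1 h).1)]

theorem applyOn_unitary {k w : ℕ} {M : Matrix (Fin k → Bool) (Fin k → Bool) ℂ}
    (hM : M ∈ Matrix.unitaryGroup (Fin k → Bool) ℂ) (e : Fin k ↪ Fin w) :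
    applyOn M e ∈ Matrix.unitaryGroup (Fin w → Bool) ℂ := by
  rw [Matrix.mem_unitaryGroup_iff, Matrix.star_eq_conjTranspose] at hM ⊢
  rw [← applyOn_conjTranspose, ← applyOn_mul, hM, applyOn_one]

/-- On disjoint sets of qubits the only intermediate state is the one that has the final values on
the qubits of `e` and the initial ones elsewhere, so the product is a tensor product. -/
theorem applyOn_mul_apply_of_disjoint {k l w : ℕ} (M : Matrix (Fin k → Bool) (Fin k → Bool) ℂ)
    (N : Matrix (Fin l → Bool) (Fin l → Bool) ℂ) (e : Fin k ↪ Fin w) (f : Fin l ↪ Fin w)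
    (hef : ∀ i j, e i ≠ f j) (x z : Fin w → Bool) :
    (applyOn M e * applyOn N f) x z =
      if ∀ i, (∀ j, e j ≠ i) → (∀ j, f j ≠ i) → x i = z i then
        M (x ∘ e) (z ∘ e) * N (x ∘ f) (z ∘ f) else 0 := by
  rw [Matrix.mul_apply, sum_applyOn_right]
  have h1 : ∀ s, applyOn N f (Function.extend e s x) z =
      if s = z ∘ e ∧ ∀ i, (∀ j, e j ≠ i) → (∀ j, f j ≠ i) → x i = z i then
        N (x ∘ f) (z ∘ f) else 0 := by
    intro s
    simp only [applyOn, Matrix.of_apply]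
    have hf : ∀ j, Function.extend e s x (f j) = x (f j) := fun j =>
      extend_agree e s x _ fun i => hef i j
    simp only [hf]
    refine if_congr ?_ rfl rfl
    constructor
    · intro h
      refine ⟨?_, ?_⟩
      · funext j
        have := h (e j) fun i => (hef j i).symm
        rwa [e.injective.extend_apply] at this
      · intro i hi hi'
        rw [← h i hi', extend_agree e s x i hi]
    · rintro ⟨rfl, h⟩ i hi
      by_cases hi' : ∃ j, e j = i
      · obtain ⟨j, rfl⟩ := hi'
        rw [e.injective.extend_apply]; rfl
      · rw [Function.extend_apply' _ _ _ hi']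
        exact h i (fun j hj => hi' ⟨j, hj⟩) hi
  simp only [h1]
  split_ifs with h
  · rw [Finset.sum_eq_single (z ∘ e)]
    · rw [if_pos ⟨rfl, h⟩]
    · intro s _ hs
      rw [if_neg (fun h' => hs h'.1), mul_zero]
    · simp
  · refine Finset.sum_eq_zero fun s _ => ?_
    rw [if_neg (fun h' => h h'.2), mul_zero]

theorem applyOn_commute {k l w : ℕ} (M : Matrix (Fin k → Bool) (Fin k → Bool) ℂ)
    (N : Matrix (Fin l → Bool) (Fin l → Bool) ℂ) (e : Fin k ↪ Fin w) (f : Fin l ↪ Fin w)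
    (hef : ∀ i j, e i ≠ f j) : applyOn M e * applyOn N f = applyOn N f * applyOn M e := by
  ext x z
  rw [applyOn_mul_apply_of_disjoint M N e f hef,
    applyOn_mul_apply_of_disjoint N M f e fun i j => (hef j i).symm]
  refine if_congr ?_ (mul_comm _ _) rfl
  exact forall_congr' fun i => ⟨fun h a b => h b a, fun h a b => h b a⟩

/-! ### Unitaries of circuits -/

theorem gatesUnitary_append {G : GateSet} {w : ℕ} (C D : List (Instr G w)) :
    gatesUnitary (C ++ D) = gatesUnitary D * gatesUnitary C := by
  induction C with
  | nil => simp [gatesUnitary]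
  | cons I C ih => simp [gatesUnitary, ih, Matrix.mul_assoc]

theorem gatesUnitary_mem {G : GateSet} {w : ℕ} (C : List (Instr G w)) :
    gatesUnitary C ∈ Matrix.unitaryGroup (Fin w → Bool) ℂ := by
  induction C with
  | nil => exact one_mem _
  | cons I C ih => exact mul_mem ih (applyOn_unitary (G.gate I.gate).unitary _)

theorem gatesUnitary_singleton {G : GateSet} {w : ℕ} (I : Instr G w) :
    gatesUnitary [I] = applyOn (G.gate I.gate).mat I.wires := by
  simp [gatesUnitary]

/-- Relabelling of the qubits of a gate placement. -/
def Instr.map {G : GateSet} {k w : ℕ} (f : Fin k ↪ Fin w) (I : Instr G k) : Instr G w :=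
  ⟨I.gate, I.wires.trans f⟩

theorem gatesUnitary_map {G : GateSet} {k w : ℕ} (f : Fin k ↪ Fin w) (C : List (Instr G k)) :
    gatesUnitary (C.map (Instr.map f)) = applyOn (gatesUnitary C) f := by
  induction C with
  | nil => simp [gatesUnitary, applyOn_one]
  | cons I C ih => simp [gatesUnitary, ih, applyOn_mul, applyOn_applyOn, Instr.map]

/-- The inverse circuit, given circuits for the inverses of the gates. -/
def invGates {G : GateSet} (inv : ∀ g : Fin G.size, List (Instr G (G.gate g).arity)) {w : ℕ}
    (C : List (Instr G w)) : List (Instr G w) :=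
  C.reverse.flatMap fun I => (inv I.gate).map (Instr.map I.wires)

theorem gatesUnitary_invGates {G : GateSet}
    {inv : ∀ g : Fin G.size, List (Instr G (G.gate g).arity)}
    (hinv : ∀ g, gatesUnitary (inv g) = (G.gate g).matᴴ) {w : ℕ} (C : List (Instr G w)) :
    gatesUnitary (invGates inv C) = (gatesUnitary C)ᴴ := by
  induction C with
  | nil => simp [gatesUnitary, invGates]
  | cons I C ih =>
    have : invGates inv (I :: C) = invGates inv C ++ (inv I.gate).map (Instr.map I.wires) := by
      simp [invGates]
    rw [this, gatesUnitary_append, ih, gatesUnitary_map, hinv, applyOn_conjTranspose,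
      gatesUnitary, Matrix.conjTranspose_mul]

/-- Two copies of a circuit, run in parallel on different qubits. -/
def twoCopies {G : GateSet} {k w : ℕ} (e f : Fin k ↪ Fin w) (C : List (Instr G k)) :
    List (Instr G w) :=
  C.flatMap fun I => [I.map e, I.map f]

/-- The gates of the copies are interleaved, so that a machine can write both in one pass;
disjointness allows them to be sorted. -/
theorem gatesUnitary_twoCopies {G : GateSet} {k w : ℕ} (e f : Fin k ↪ Fin w)
    (hef : ∀ i j, e i ≠ f j) (C : List (Instr G k)) :
    gatesUnitary (twoCopies e f C) = applyOn (gatesUnitary C) e * applyOn (gatesUnitary C) f := by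
  induction C with
  | nil => simp [gatesUnitary, twoCopies, applyOn_one]
  | cons I C ih =>
    have : twoCopies e f (I :: C) = [I].map (Instr.map e) ++ ([I].map (Instr.map f) ++
        twoCopies e f C) := by
      simp [twoCopies]
    rw [this, gatesUnitary_append, gatesUnitary_append, ih, gatesUnitary_map, gatesUnitary_map,
      gatesUnitary_singleton, gatesUnitary, applyOn_mul, applyOn_mul]
    simp only [Matrix.mul_assoc]
    rw [← Matrix.mul_assoc (applyOn (applyOn (G.gate I.gate).mat I.wires) e),
      applyOn_commute _ (gatesUnitary C) e f hef, Matrix.mul_assoc,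
      ← applyOn_commute _ _ e f hef]

/-! ### Acceptance probability -/

/-- The initial state and the projection are diagonal, so only squared moduli of entries enter. This
is why gates that are correct only up to phases suffice for the test. -/
theorem accProb_eq {G : GateSet} (Q : Circuit G) (k : ℕ) :
    accProb Q k = ∑ v : Fin Q.width → Bool, if v Q.output = false then
      ∑ u : Fin Q.width → Bool, if ∀ i : Fin Q.width, (i : ℕ) < k → u i = false then
        (1 / 2) ^ (Q.width - k) * Complex.normSq (Q.unitary v u) else 0 else 0 := by
  rw [accProb, Matrix.trace, Complex.re_sum]
  refine Finset.sum_congr rfl fun v _ => ?_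
  rw [Matrix.diag_apply, accProj, Matrix.diagonal_mul]
  split_ifs with h
  · rw [one_mul, Matrix.mul_apply, Complex.re_sum]
    refine Finset.sum_congr rfl fun u _ => ?_
    rw [initState, Matrix.mul_diagonal, Matrix.conjTranspose_apply]
    split_ifs with h'
    · rw [mul_right_comm, RCLike.star_def, Complex.mul_conj, ← Complex.ofReal_one,
        ← Complex.ofReal_ofNat, ← Complex.ofReal_div, ← Complex.ofReal_pow, ← Complex.ofReal_mul,
        Complex.ofReal_re, mul_comm]
    · simp
  · simp

theorem accProb_nonneg {G : GateSet} (Q : Circuit G) (k : ℕ) : 0 ≤ accProb Q k := by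
  rw [accProb_eq]
  refine Finset.sum_nonneg fun v _ => ?_
  split_ifs
  · refine Finset.sum_nonneg fun u _ => ?_
    split_ifs
    · exact mul_nonneg (by positivity) (Complex.normSq_nonneg _)
    · exact le_rfl
  · exact le_rfl

theorem accProb_width {G : GateSet} (Q : Circuit G) :
    accProb Q Q.width = ∑ v : Fin Q.width → Bool, if v Q.output = false then
      Complex.normSq (Q.unitary v fun _ => false) else 0 := by
  rw [accProb_eq]
  refine Finset.sum_congr rfl fun v _ => ?_
  refine if_congr Iff.rfl ?_ rfl
  rw [Finset.sum_eq_single fun _ => false]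
  · simp
  · intro u _ hu
    rw [if_neg]
    intro h
    exact hu (funext fun i => h i i.2)
  · simp

theorem sum_normSq_col {n : Type*} [Fintype n] [DecidableEq n] {U : Matrix n n ℂ}
    (hU : U ∈ Matrix.unitaryGroup n ℂ) (u : n) : ∑ v, Complex.normSq (U v u) = 1 := by
  have h := congrFun₂ (Matrix.mem_unitaryGroup_iff'.1 hU) u u
  rw [Matrix.star_eq_conjTranspose, Matrix.mul_apply, Matrix.one_apply_eq] at h
  have h' : ((∑ v, Complex.normSq (U v u) : ℝ) : ℂ) = 1 := by
    rw [← h]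
    push_cast
    refine Finset.sum_congr rfl fun v _ => ?_
    rw [Matrix.conjTranspose_apply, RCLike.star_def, mul_comm, Complex.mul_conj]
  exact_mod_cast h'

theorem sum_normSq_row {n : Type*} [Fintype n] [DecidableEq n] {U : Matrix n n ℂ}
    (hU : U ∈ Matrix.unitaryGroup n ℂ) (u : n) : ∑ v, Complex.normSq (U u v) = 1 := by
  have h := congrFun₂ (Matrix.mem_unitaryGroup_iff.1 hU) u u
  rw [Matrix.star_eq_conjTranspose, Matrix.mul_apply, Matrix.one_apply_eq] at h
  have h' : ((∑ v, Complex.normSq (U u v) : ℝ) : ℂ) = 1 := by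
    rw [← h]
    push_cast
    refine Finset.sum_congr rfl fun v _ => ?_
    rw [Matrix.conjTranspose_apply, RCLike.star_def, Complex.mul_conj]
  exact_mod_cast h'

theorem accProb_width_le_one {G : GateSet} (Q : Circuit G) : accProb Q Q.width ≤ 1 := by
  rw [accProb_width, ← sum_normSq_col (gatesUnitary_mem Q.gates) fun _ => false]
  refine Finset.sum_le_sum fun v _ => ?_
  split_ifs
  · exact le_rfl
  · exact Complex.normSq_nonneg _

/-! ### Operators on a target qubit, controlled by other qubits -/

/-- The operator acting on qubit `t` by a matrix that depends on the basis state. -/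
def ctrl {w : ℕ} (t : Fin w) (M : (Fin w → Bool) → Matrix Bool Bool ℂ) :
    Matrix (Fin w → Bool) (Fin w → Bool) ℂ :=
  Matrix.of fun x y => if ∀ i, i ≠ t → x i = y i then M y (x t) (y t) else 0

theorem eq_update_iff {w : ℕ} (t : Fin w) (x y : Fin w → Bool) :
    (∀ i, i ≠ t → x i = y i) ↔ x = Function.update y t (x t) := by
  constructor
  · intro h
    funext i
    by_cases hi : i = t
    · subst hi; simp
    · rw [Function.update_of_ne hi, h i hi]
  · intro h i hi
    rw [h, Function.update_of_ne hi]

/-- The left factor must not read the target qubit, since the right factor changes it. -/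
theorem ctrl_mul {w : ℕ} (t : Fin w) (M N : (Fin w → Bool) → Matrix Bool Bool ℂ)
    (hM : ∀ y b, M (Function.update y t b) = M y) :
    ctrl t M * ctrl t N = ctrl t fun y => M y * N y := by
  ext x z
  rw [Matrix.mul_apply]
  have h1 : ∑ v, ctrl t M x v * ctrl t N v z =
      ∑ b : Bool, ctrl t M x (Function.update z t b) * ctrl t N (Function.update z t b) z := by
    symm
    refine Fintype.sum_of_injective (fun b => Function.update z t b) ?_ _ _ ?_ fun _ => rfl
    · intro b b' h
      simpa using congrFun h t
    · intro v hv
      have : ctrl t N v z = 0 := by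
        simp only [ctrl, Matrix.of_apply]
        rw [if_neg]
        intro h
        exact hv ⟨_, ((eq_update_iff t v z).1 h).symm⟩
      rw [this, mul_zero]
  rw [h1]
  have h2 : ∀ b, ctrl t N (Function.update z t b) z = N z b (z t) := by
    intro b
    simp only [ctrl, Matrix.of_apply, Function.update_self]
    rw [if_pos fun i hi => Function.update_of_ne hi _ _]
  have h3 : ∀ b, ctrl t M x (Function.update z t b) =
      if ∀ i, i ≠ t → x i = z i then M z (x t) b else 0 := by
    intro b
    simp only [ctrl, Matrix.of_apply, Function.update_self, hM]
    refine if_congr ?_ rfl rfl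
    exact forall₂_congr fun i hi => by rw [Function.update_of_ne hi]
  simp only [h2, h3]
  simp only [ctrl, Matrix.of_apply, Matrix.mul_apply]
  split_ifs
  · rfl
  · simp

/-- The bit flip. -/
def flipMat : Matrix Bool Bool ℂ := Matrix.of fun a b => if a = !b then 1 else 0

/-- The Hadamard matrix on one bit. -/
noncomputable def hMat : Matrix Bool Bool ℂ :=
  Matrix.of fun a b => Gate.hadamardMat (fun _ => a) fun _ => b

/-- The `T` matrix on one bit. -/
noncomputable def phaseMat : Matrix Bool Bool ℂ :=
  Matrix.of fun a b => Gate.tMat (fun _ => a) fun _ => b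

theorem applyOn_one_qubit {w : ℕ} (m : Matrix (Fin 1 → Bool) (Fin 1 → Bool) ℂ)
    (e : Fin 1 ↪ Fin w) :
    applyOn m e = ctrl (e 0) fun _ => Matrix.of fun a b => m (fun _ => a) fun _ => b := by
  ext x y
  simp only [applyOn, ctrl, Matrix.of_apply]
  have h : ∀ z : Fin w → Bool, (fun j => z (e j)) = fun _ => z (e 0) := fun z => by
    funext j; rw [Fin.fin_one_eq_zero j]
  rw [h x, h y]
  refine if_congr ?_ rfl rfl
  refine forall_congr' fun i => imp_congr_left ?_
  constructor
  · intro hi hi'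
    exact hi 0 hi'.symm
  · intro hi j hj
    rw [Fin.fin_one_eq_zero j] at hj
    exact hi hj.symm

theorem applyOn_cnot {w : ℕ} (e : Fin 2 ↪ Fin w) :
    applyOn Gate.cnotMat e = ctrl (e 1) fun y => if y (e 0) then flipMat else 1 := by
  ext x y
  have hne : e 0 ≠ e 1 := fun h => by simpa using e.injective h
  simp only [applyOn, ctrl, Matrix.of_apply, Gate.cnotMat]
  by_cases h : ∀ i, i ≠ e 1 → x i = y i
  · rw [if_pos h, if_pos fun i hi => h i (hi 1).symm]
    have h0 := h _ hne
    have hc : ∀ a b c : Bool, (if c = xor a b then (1 : ℂ) else 0) =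
        (if a then flipMat else 1 : Matrix Bool Bool ℂ) c b := by
      intro a b c
      rcases a <;> rcases b <;> rcases c <;> simp [flipMat]
    rw [← hc]
    exact if_congr (and_iff_right h0) rfl rfl
  · rw [if_neg h]
    split_ifs with h1 h2
    · exfalso
      apply h
      intro i hi
      by_cases hi0 : i = e 0
      · rw [hi0, h2.1]
      · refine h1 i fun j => ?_
        fin_cases j
        · exact fun h => hi0 h.symm
        · exact fun h => hi h.symm
    · rfl
    · rfl

/-- `exp(iπ/4)` -/
noncomputable def omega8 : ℂ := Complex.exp (Complex.I * (Real.pi / 4 : ℝ))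

theorem omega8_sq : omega8 * omega8 = Complex.I := by
  rw [omega8, ← Complex.exp_add]
  have : Complex.I * (Real.pi / 4 : ℝ) + Complex.I * (Real.pi / 4 : ℝ) =
      (Real.pi : ℂ) / 2 * Complex.I := by
    push_cast; ring
  rw [this, Complex.exp_pi_div_two_mul_I]

theorem phaseMat_eq : phaseMat = Matrix.diagonal fun b => if b then omega8 else 1 := by
  ext a b
  rcases a <;> rcases b <;> simp [phaseMat, Gate.tMat, omega8, Matrix.diagonal, funext_iff]

theorem hMat_eq : hMat = Matrix.of fun a b =>
    if a = true ∧ b = true then -(1 / (√2 : ℝ) : ℂ) else (1 / (√2 : ℝ) : ℂ) := by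
  ext a b
  simp [hMat, Gate.hadamardMat]

theorem inv_sqrt_two_mul_self : (1 / (√2 : ℝ) : ℂ) * (1 / (√2 : ℝ) : ℂ) = 1 / 2 := by
  have h2 : ((√2 : ℝ) : ℂ) * ((√2 : ℝ) : ℂ) = 2 := by
    rw [← Complex.ofReal_mul, Real.mul_self_sqrt (by norm_num)]; norm_num
  rw [div_mul_div_comm, h2, one_mul]

theorem hMat_mul_diagonal_mul_hMat (d : Bool → ℂ) :
    hMat * Matrix.diagonal d * hMat = Matrix.of fun a b =>
      if a = b then (d false + d true) / 2 else (d false - d true) / 2 := by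
  obtain ⟨s, hs, h⟩ : ∃ s : ℂ, (1 / (√2 : ℝ) : ℂ) = s ∧ s * s = 1 / 2 :=
    ⟨_, rfl, inv_sqrt_two_mul_self⟩
  ext a b
  rw [hMat_eq, hs]
  simp only [Matrix.mul_apply, Fintype.sum_bool, Matrix.of_apply, Matrix.diagonal_apply]
  rcases a <;> rcases b <;> simp
  · linear_combination (d false + d true) * h
  · linear_combination (d false - d true) * h
  · linear_combination (d false - d true) * h
  · linear_combination (d false + d true) * h

theorem flipMat_mul_diagonal_mul_flipMat (d : Bool → ℂ) :
    flipMat * Matrix.diagonal d * flipMat = Matrix.diagonal fun b => d (!b) := by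
  ext a b
  simp only [Matrix.mul_apply, Fintype.sum_bool, flipMat, Matrix.of_apply, Matrix.diagonal_apply]
  rcases a <;> rcases b <;> simp

/-- The bit flip controlled by two negative controls, up to phases. -/
noncomputable def norMat (a b : Bool) : Matrix Bool Bool ℂ :=
  if a || b then Complex.I • (1 : Matrix Bool Bool ℂ) else flipMat

/-- If both controls are `0`, the middle part is `T⁴ = Z`, which the Hadamard gates turn into a bit
flip. Otherwise two of the four `T` are conjugated by the flip; as `T · XTX` is the scalar
`exp(iπ/4)`, the middle part is its square `i`. -/
theorem norMat_eq (a b : Bool) :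
    hMat * ((if a then flipMat else 1) * (phaseMat * ((if b then flipMat else 1) * (phaseMat *
      ((if a then flipMat else 1) * (phaseMat * ((if b then flipMat else 1) *
      (phaseMat * hMat)))))))) = norMat a b := by
  have hd : ∀ d : Bool → ℂ, hMat * (Matrix.diagonal d * hMat) = Matrix.of fun a b =>
      if a = b then (d false + d true) / 2 else (d false - d true) / 2 := fun d => by
    rw [← Matrix.mul_assoc, hMat_mul_diagonal_mul_hMat]
  have hI : Matrix.of (fun a b : Bool => if a = b then Complex.I else 0) =
      Complex.I • (1 : Matrix Bool Bool ℂ) := by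
    ext a b
    simp [Matrix.one_apply]
  have hf : ∀ (d : Bool → ℂ) (A : Matrix Bool Bool ℂ),
      flipMat * (Matrix.diagonal d * (flipMat * A)) = (Matrix.diagonal fun b => d (!b)) * A :=
    fun d A => by rw [← flipMat_mul_diagonal_mul_flipMat]; simp only [Matrix.mul_assoc]
  have hdd : ∀ (d d' : Bool → ℂ) (A : Matrix Bool Bool ℂ),
      Matrix.diagonal d * (Matrix.diagonal d' * A) = (Matrix.diagonal fun b => d b * d' b) * A :=
    fun d d' A => by rw [← Matrix.mul_assoc, Matrix.diagonal_mul_diagonal]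
  have ho := omega8_sq
  have ho4 : Complex.I * Complex.I = -1 := Complex.I_mul_I
  have ho' : ∀ z, omega8 * (omega8 * z) = Complex.I * z := fun z => by rw [← mul_assoc, ho]
  rw [phaseMat_eq, norMat]
  rcases a <;> rcases b <;>
    simp only [Bool.false_eq_true, if_true, if_false, Matrix.one_mul, hf, hdd, hd, Bool.or_self,
      Bool.or_true, Bool.or_false, ← hI] <;>
    ext a b <;> rcases a <;> rcases b <;>
    simp [ho, ho', ho4, flipMat]

theorem xMat_eq : hMat * (phaseMat * (phaseMat * (phaseMat * (phaseMat * hMat)))) = flipMat := by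
  simpa [norMat] using norMat_eq false false

/-! ### Circuits of Hadamard, `T` and controlled-NOT gates -/

/-- Placement of a gate that occurs in the gate set under the index `g`. -/
def Instr.ofGate {G : GateSet} {w k : ℕ} {m : Matrix (Fin k → Bool) (Fin k → Bool) ℂ}
    {u : m ∈ Matrix.unitaryGroup (Fin k → Bool) ℂ} (g : Fin G.size) (h : G.gate g = ⟨k, m, u⟩)
    (e : Fin k ↪ Fin w) : Instr G w :=
  ⟨g, (finCongr (congrArg Gate.arity h)).toEmbedding.trans e⟩

/-- Stated for a variable gate `γ`, so that substitution removes the transport of the wires along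
the equality of arities. -/
theorem ofGate_aux {G : GateSet} {w : ℕ} (g : Fin G.size) {γ : Gate} (h : G.gate g = γ)
    (e : Fin γ.arity ↪ Fin w) :
    gatesUnitary [(Instr.mk g ((finCongr (congrArg Gate.arity h)).toEmbedding.trans e) :
      Instr G w)] = applyOn γ.mat e ∧
    (Instr.mk g ((finCongr (congrArg Gate.arity h)).toEmbedding.trans e) : Instr G w).encode =
      unaryCode g ++ (List.ofFn fun j => unaryCode (e j)).flatten := by
  subst h
  exact ⟨gatesUnitary_singleton _, rfl⟩

theorem gatesUnitary_ofGate {G : GateSet} {w k : ℕ} {m : Matrix (Fin k → Bool) (Fin k → Bool) ℂ}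
    {u : m ∈ Matrix.unitaryGroup (Fin k → Bool) ℂ} (g : Fin G.size) (h : G.gate g = ⟨k, m, u⟩)
    (e : Fin k ↪ Fin w) : gatesUnitary [Instr.ofGate g h e] = applyOn m e :=
  (ofGate_aux g h e).1

theorem encode_ofGate {G : GateSet} {w k : ℕ} {m : Matrix (Fin k → Bool) (Fin k → Bool) ℂ}
    {u : m ∈ Matrix.unitaryGroup (Fin k → Bool) ℂ} (g : Fin G.size) (h : G.gate g = ⟨k, m, u⟩)
    (e : Fin k ↪ Fin w) : (Instr.ofGate g h e).encode =
      unaryCode g ++ (List.ofFn fun j => unaryCode (e j)).flatten :=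
  (ofGate_aux g h e).2

/-- Indices of the Hadamard, `T` and controlled-NOT gates in a gate set. -/
structure StdGates (G : GateSet) where
  gH : Fin G.size
  gT : Fin G.size
  gC : Fin G.size
  hH : G.gate gH = ⟨1, Gate.hadamardMat, Gate.hadamardMat_unitary⟩
  hT : G.gate gT = ⟨1, Gate.tMat, Gate.tMat_unitary⟩
  hC : G.gate gC = ⟨2, Gate.cnotMat, Gate.cnotMat_unitary⟩

theorem GateSet.ContainsHTCNOT.nonempty_stdGates {G : GateSet} (hG : G.ContainsHTCNOT) :
    Nonempty (StdGates G) := by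
  obtain ⟨⟨a, ha⟩, ⟨b, hb⟩, c, hc⟩ := hG
  exact ⟨⟨a, b, c, ha, hb, hc⟩⟩

/-- The choice of a single qubit. -/
def oneWire {w : ℕ} (t : Fin w) : Fin 1 ↪ Fin w := ⟨fun _ => t, fun i j _ => Subsingleton.elim i j⟩

/-- The choice of two different qubits. -/
def twoWires {w : ℕ} (c t : Fin w) (h : c ≠ t) : Fin 2 ↪ Fin w :=
  ⟨![c, t], by
    intro i j hij
    fin_cases i <;> fin_cases j <;> simp_all⟩

namespace StdGates

variable {G : GateSet} (S : StdGates G) {w : ℕ}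

/-- Hadamard gate on qubit `t`. -/
noncomputable def h (t : Fin w) : Instr G w := Instr.ofGate S.gH S.hH (oneWire t)

/-- `T` gate on qubit `t`. -/
noncomputable def t (t : Fin w) : Instr G w := Instr.ofGate S.gT S.hT (oneWire t)

/-- Controlled-NOT gate with control `c` and target `t`. -/
noncomputable def cn (c t : Fin w) (hct : c ≠ t) : Instr G w := Instr.ofGate S.gC S.hC (twoWires c t hct)

theorem encode_h (t : Fin w) : (S.h t).encode = unaryCode S.gH ++ unaryCode t := by
  rw [h, encode_ofGate]
  simp [List.ofFn_succ]
  rfl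

theorem encode_t (t : Fin w) : (S.t t).encode = unaryCode S.gT ++ unaryCode t := by
  rw [StdGates.t, encode_ofGate]
  simp [List.ofFn_succ]
  rfl

theorem encode_cn (c t : Fin w) (hct : c ≠ t) :
    (S.cn c t hct).encode = unaryCode S.gC ++ (unaryCode c ++ unaryCode t) := by
  rw [StdGates.cn, encode_ofGate]
  simp [List.ofFn_succ]
  rfl

theorem gatesUnitary_h (t : Fin w) : gatesUnitary [S.h t] = ctrl t fun _ => hMat := by
  rw [h, gatesUnitary_ofGate]
  exact applyOn_one_qubit _ _

theorem gatesUnitary_t (t : Fin w) : gatesUnitary [S.t t] = ctrl t fun _ => phaseMat := by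
  rw [StdGates.t, gatesUnitary_ofGate]
  exact applyOn_one_qubit _ _

theorem gatesUnitary_cn (c t : Fin w) (hct : c ≠ t) :
    gatesUnitary [S.cn c t hct] = ctrl t fun y => if y c then flipMat else 1 := by
  rw [StdGates.cn, gatesUnitary_ofGate]
  exact applyOn_cnot _

/-- The bit flip on qubit `t`. -/
noncomputable def flip (t : Fin w) : List (Instr G w) := [S.h t, S.t t, S.t t, S.t t, S.t t, S.h t]

/-- The bit flip on qubit `t`, controlled by `a` and `b` being `0`, up to phases. -/
noncomputable def nor (a b t : Fin w) (hat : a ≠ t) (hbt : b ≠ t) : List (Instr G w) :=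
  [S.h t, S.t t, S.cn b t hbt, S.t t, S.cn a t hat, S.t t, S.cn b t hbt, S.t t, S.cn a t hat,
    S.h t]

theorem gatesUnitary_cons (I : Instr G w) (C : List (Instr G w)) :
    gatesUnitary (I :: C) = gatesUnitary C * gatesUnitary [I] := by
  rw [← gatesUnitary_append]; rfl

theorem gatesUnitary_flip (t : Fin w) : gatesUnitary (S.flip t) = ctrl t fun _ => flipMat := by
  rw [flip]
  repeat rw [gatesUnitary_cons _ (_ :: _)]
  simp only [gatesUnitary_h, gatesUnitary_t, Matrix.mul_assoc]
  repeat rw [ctrl_mul _ _ _ (fun _ _ => rfl)]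
  simp only [xMat_eq]

theorem gatesUnitary_nor (a b t : Fin w) (hat : a ≠ t) (hbt : b ≠ t) :
    gatesUnitary (S.nor a b t hat hbt) = ctrl t fun y => norMat (y a) (y b) := by
  rw [nor]
  repeat rw [gatesUnitary_cons _ (_ :: _)]
  simp only [gatesUnitary_h, gatesUnitary_t, gatesUnitary_cn, Matrix.mul_assoc]
  have h0 : ∀ (A : Matrix Bool Bool ℂ) (y : Fin w → Bool) (c : Bool),
      (fun _ : Fin w → Bool => A) (Function.update y t c) = (fun _ : Fin w → Bool => A) y :=
    fun _ _ _ => rfl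
  have h1 : ∀ c : Fin w, c ≠ t → ∀ (y : Fin w → Bool) (d : Bool),
      (fun y : Fin w → Bool => if y c then flipMat else 1) (Function.update y t d) =
      (fun y : Fin w → Bool => if y c then flipMat else 1) y := by
    intro c hc y d
    simp only [Function.update_of_ne hc]
  rw [ctrl_mul t _ _ (h0 phaseMat), ctrl_mul t _ _ (h1 b hbt), ctrl_mul t _ _ (h0 phaseMat),
    ctrl_mul t _ _ (h1 a hat), ctrl_mul t _ _ (h0 phaseMat), ctrl_mul t _ _ (h1 b hbt),
    ctrl_mul t _ _ (h0 phaseMat), ctrl_mul t _ _ (h1 a hat), ctrl_mul t _ _ (h0 hMat)]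
  simp only [norMat_eq]

end StdGates

/-! ### Monomial operators -/

/-- `U` maps every basis state to a basis state, up to a phase; the map is `τ`. -/
def IsMonomial {X : Type*} [DecidableEq X] (U : Matrix X X ℂ) (τ : X → X) : Prop :=
  ∃ φ : X → ℂ, (∀ y, Complex.normSq (φ y) = 1) ∧ ∀ x y, U x y = if x = τ y then φ y else 0

theorem IsMonomial.mul {X : Type*} [DecidableEq X] [Fintype X] {U V : Matrix X X ℂ} {τ σ : X → X}
    (hU : IsMonomial U τ) (hV : IsMonomial V σ) : IsMonomial (U * V) (τ ∘ σ) := by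
  obtain ⟨φ, hφ, hU⟩ := hU
  obtain ⟨ψ, hψ, hV⟩ := hV
  refine ⟨fun y => φ (σ y) * ψ y, fun y => by rw [map_mul, hφ, hψ, one_mul], fun x y => ?_⟩
  rw [Matrix.mul_apply, Finset.sum_eq_single (σ y)]
  · rw [hU, hV, if_pos rfl, ite_mul, zero_mul]; rfl
  · intro z _ hz
    rw [hV, if_neg hz, mul_zero]
  · simp

/-- Each row of a monomial operator has one nonzero entry, of modulus one; because `τ` is involutive
its column is `τ x`. -/
theorem IsMonomial.normSq_mul_left {X : Type*} [DecidableEq X] [Fintype X] {V : Matrix X X ℂ}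
    {τ : X → X} (hV : IsMonomial V τ) (hτ : Function.Involutive τ) (U : Matrix X X ℂ) (x z : X) :
    Complex.normSq ((V * U) x z) = Complex.normSq (U (τ x) z) := by
  obtain ⟨φ, hφ, hV⟩ := hV
  rw [Matrix.mul_apply, Finset.sum_eq_single (τ x)]
  · rw [hV, hτ x, if_pos rfl, map_mul, hφ, one_mul]
  · intro y _ hy
    rw [hV, if_neg, zero_mul]
    rintro rfl
    exact hy (hτ y).symm
  · simp

theorem IsMonomial.normSq_mul_right {X : Type*} [DecidableEq X] [Fintype X] {V : Matrix X X ℂ}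
    {τ : X → X} (hV : IsMonomial V τ) (U : Matrix X X ℂ) (x z : X) :
    Complex.normSq ((U * V) x z) = Complex.normSq (U x (τ z)) := by
  obtain ⟨φ, hφ, hV⟩ := hV
  rw [Matrix.mul_apply, Finset.sum_eq_single (τ z)]
  · rw [hV, if_pos rfl, map_mul, hφ, mul_one]
  · intro y _ hy
    rw [hV, if_neg hy, mul_zero]
  · simp

/-- The map that flips bit `t` of those `y` that satisfy `p`. -/
def flipIf {w : ℕ} (t : Fin w) (p : (Fin w → Bool) → Bool) (y : Fin w → Bool) : Fin w → Bool :=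
  Function.update y t (xor (y t) (p y))

theorem flipIf_involutive {w : ℕ} (t : Fin w) (p : (Fin w → Bool) → Bool)
    (hp : ∀ y b, p (Function.update y t b) = p y) : Function.Involutive (flipIf t p) := by
  intro y
  simp [flipIf, hp]

theorem flipIf_of_ne {w : ℕ} {t i : Fin w} (h : i ≠ t) (p : (Fin w → Bool) → Bool)
    (y : Fin w → Bool) : flipIf t p y i = y i := Function.update_of_ne h _ _

theorem flipIf_self {w : ℕ} (t : Fin w) (p : (Fin w → Bool) → Bool)
    (y : Fin w → Bool) : flipIf t p y t = xor (y t) (p y) := Function.update_self _ _ _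

theorem isMonomial_ctrl {w : ℕ} (t : Fin w) (M : (Fin w → Bool) → Matrix Bool Bool ℂ)
    (p : (Fin w → Bool) → Bool)
    (hM : ∀ y, ∃ c : ℂ, Complex.normSq c = 1 ∧ M y = c • (if p y then flipMat else 1)) :
    IsMonomial (ctrl t M) (flipIf t p) := by
  choose c hc hM using hM
  refine ⟨c, hc, fun x y => ?_⟩
  simp only [ctrl, Matrix.of_apply]
  by_cases h : ∀ i, i ≠ t → x i = y i
  · rw [if_pos h, hM]
    have hx : x = flipIf t p y ↔ x t = xor (y t) (p y) := by
      constructor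
      · intro h; rw [h, flipIf_self]
      · intro h'
        rw [(eq_update_iff t x y).1 h, h', flipIf]
    have : ∀ a b d : Bool, (if d then flipMat else 1 : Matrix Bool Bool ℂ) a b =
        if a = xor b d then 1 else 0 := by
      intro a b d
      rcases a <;> rcases b <;> rcases d <;> simp [flipMat]
    rw [Matrix.smul_apply, this, smul_eq_mul, mul_ite, mul_one, mul_zero]
    exact if_congr hx.symm rfl rfl
  · rw [if_neg h, if_neg]
    rintro rfl
    exact h fun i hi => flipIf_of_ne hi _ _

namespace StdGates

variable {G : GateSet} (S : StdGates G) {w : ℕ}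

theorem isMonomial_flip (t : Fin w) :
    IsMonomial (gatesUnitary (S.flip t)) (flipIf t fun _ => true) := by
  rw [gatesUnitary_flip]
  exact isMonomial_ctrl _ _ _ fun y => ⟨1, by simp, by simp⟩

theorem isMonomial_cn (c t : Fin w) (hct : c ≠ t) :
    IsMonomial (gatesUnitary [S.cn c t hct]) (flipIf t fun y => y c) := by
  rw [gatesUnitary_cn]
  exact isMonomial_ctrl _ _ _ fun y => ⟨1, by simp, by simp⟩

theorem isMonomial_nor (a b t : Fin w) (hat : a ≠ t) (hbt : b ≠ t) :
    IsMonomial (gatesUnitary (S.nor a b t hat hbt)) (flipIf t fun y => !(y a || y b)) := by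
  rw [gatesUnitary_nor]
  refine isMonomial_ctrl _ _ _ fun y => ?_
  by_cases h : (y a || y b) = true
  · exact ⟨Complex.I, by simp, by simp [norMat, h]⟩
  · exact ⟨1, by simp, by simp [norMat, h]⟩

end StdGates

/-! ### Operators that preserve a bit -/

/-- `U` does not change qubit `i` of a basis state. -/
def PreservesBit {w : ℕ} (U : Matrix (Fin w → Bool) (Fin w → Bool) ℂ) (i : Fin w) : Prop :=
  ∀ v u, v i ≠ u i → U v u = 0

theorem PreservesBit.mul {w : ℕ} {U V : Matrix (Fin w → Bool) (Fin w → Bool) ℂ} {i : Fin w}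
    (hU : PreservesBit U i) (hV : PreservesBit V i) : PreservesBit (U * V) i := by
  intro v u h
  rw [Matrix.mul_apply]
  refine Finset.sum_eq_zero fun x _ => ?_
  by_cases hx : v i = x i
  · rw [hV x u (hx ▸ h), mul_zero]
  · rw [hU v x hx, zero_mul]

theorem preservesBit_applyOn {k w : ℕ} (M : Matrix (Fin k → Bool) (Fin k → Bool) ℂ)
    (e : Fin k ↪ Fin w) (i : Fin w) (h : ∀ j, e j ≠ i) : PreservesBit (applyOn M e) i := by
  intro v u hvu
  simp only [applyOn, Matrix.of_apply]
  rw [if_neg fun h' => hvu (h' i h)]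

theorem preservesBit_ctrl {w : ℕ} (t : Fin w) (M : (Fin w → Bool) → Matrix Bool Bool ℂ)
    (i : Fin w) (h : i ≠ t) : PreservesBit (ctrl t M) i := by
  intro v u hvu
  simp only [ctrl, Matrix.of_apply]
  rw [if_neg fun h' => hvu (h' i h)]

/-! ### Testing the initial state with dirty ancillas

The one-clean-qubit circuit that simulates two copies of a circuit on `w` qubits has `4w + 2`
qubits. The qubits of the copies are `4j + 1` and `4j + 3`; the qubit `4w + 1` is flipped when
both copies accept. The qubits with even numbers are the clean qubit `0` and the ancillas. -/

/-- The qubit `4j + r`. -/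
def wireAt {w : ℕ} (r : ℕ) (hr : r < 6) (j : Fin w) : Fin (4 * w + 2) := ⟨4 * j + r, by omega⟩

/-- The qubits of one of the two copies. -/
def copyWires (w r : ℕ) (hr : r < 4) : Fin w ↪ Fin (4 * w + 2) :=
  ⟨wireAt r (by omega), fun i j h => by
    have := congrArg Fin.val h
    simp only [wireAt] at this
    exact Fin.ext (by omega)⟩

/-- The last but one qubit. -/
def topWire (w : ℕ) : Fin (4 * w + 2) := ⟨4 * w, by omega⟩

/-- The qubit that is flipped when both copies accept. -/
def flagWire (w : ℕ) : Fin (4 * w + 2) := ⟨4 * w + 1, by omega⟩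

theorem involutive_conj {X : Type*} {σ τ : X → X} (hσ : Function.Involutive σ)
    (hτ : Function.Involutive τ) : Function.Involutive (σ ∘ τ ∘ σ) := by
  intro x
  simp only [Function.comp, hσ _, hτ _]

namespace StdGates

variable {G : GateSet} (S : StdGates G) {w : ℕ}

/-- Toggles ancilla `4j`, controlled by ancilla `4j + 2` and the qubit `4j + 1` of the first copy.
-/
noncomputable def checkLow (j : Fin w) : List (Instr G (4 * w + 2)) :=
  S.nor (wireAt 2 (by omega) j) (wireAt 1 (by omega) j) (wireAt 0 (by omega) j)
    (by simp [wireAt]) (by simp [wireAt])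

/-- Toggles ancilla `4j + 2`, controlled by the next level's ancilla `4j + 4` and the qubit `4j + 3`
of the second copy. -/
noncomputable def checkHigh (j : Fin w) : List (Instr G (4 * w + 2)) :=
  S.nor (wireAt 4 (by omega) j) (wireAt 3 (by omega) j) (wireAt 2 (by omega) j)
    (by simp [wireAt]) (by simp [wireAt])

/-- The innermost step of the nesting: the last ancilla is toggled if the flag is set. -/
noncomputable def checkFlag (w : ℕ) : Instr G (4 * w + 2) :=
  S.cn (flagWire w) (topWire w) (by simp [flagWire, topWire])

/-- Circuit that tests the qubits of the levels in `L`. -/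
noncomputable def checkGates (L : List (Fin w)) : List (Instr G (4 * w + 2)) :=
  (L.flatMap fun j => S.checkLow j ++ S.checkHigh j) ++ [S.checkFlag w] ++
    (L.reverse.flatMap fun j => S.checkHigh j ++ S.checkLow j)

/-- The basis states in which the flag is `1` and the qubits of the two copies from level `j` on
are `0`. -/
def ReadyFrom (j : ℕ) (z : Fin (4 * w + 2) → Bool) : Prop :=
  z (flagWire w) = true ∧ ∀ i : Fin w, j ≤ i →
    z (wireAt 1 (by omega) i) = false ∧ z (wireAt 3 (by omega) i) = false

instance (j : ℕ) (z : Fin (4 * w + 2) → Bool) : Decidable (ReadyFrom j z) := by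
  unfold ReadyFrom; infer_instance

theorem checkGates_cons (j : Fin w) (L : List (Fin w)) :
    S.checkGates (j :: L) = S.checkLow j ++ S.checkHigh j ++ S.checkGates L ++
      S.checkHigh j ++ S.checkLow j := by
  simp [checkGates]

/-- By induction from the innermost level outwards. The inner test changes ancilla `4j + 4` by the
readiness from level `j + 1` on. Toggling ancilla `4j + 2` before and after it adds that change if
qubit `4j + 3` is `0`, and toggling ancilla `4j` before and after adds the result if qubit `4j + 1`
is `0`. The unknown initial values of the ancillas cancel. -/
theorem isMonomial_checkGates_drop (k : ℕ) : ∀ j, j + k = w →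
    ∃ τ : (Fin (4 * w + 2) → Bool) → (Fin (4 * w + 2) → Bool),
      IsMonomial (gatesUnitary (S.checkGates ((List.finRange w).drop j))) τ ∧
      Function.Involutive τ ∧
      (∀ z (i : Fin (4 * w + 2)), (i : ℕ) % 2 = 1 ∨ (i : ℕ) < 4 * j → τ z i = z i) ∧
      (∀ z (i : Fin (4 * w + 2)), (i : ℕ) = 4 * j →
        τ z i = xor (z i) (decide (ReadyFrom j z))) := by
  induction k with
  | zero =>
    intro j hj
    obtain rfl : j = w := by omega
    have : (List.finRange j).drop j = [] := by simp
    rw [this]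
    refine ⟨_, by simpa [checkGates, checkFlag] using S.isMonomial_cn _ _ _, ?_, ?_, ?_⟩
    · refine flipIf_involutive _ _ fun y b => ?_
      rw [Function.update_of_ne]
      simp [flagWire, topWire]
    · intro z i hi
      refine flipIf_of_ne ?_ _ _
      rintro rfl
      simp only [topWire] at hi
      omega
    · intro z i hi
      obtain rfl : i = topWire j := Fin.ext hi
      rw [flipIf_self]
      congr 1
      have : ReadyFrom j z ↔ z (flagWire j) = true := by
        constructor
        · exact fun h => h.1
        · exact fun h => ⟨h, fun i hi => absurd i.2 (by omega)⟩
      simp [this]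
  | succ k ih =>
    intro j hj
    have hjw : j < w := by omega
    obtain ⟨τ, hτ, hinv, hodd, hact⟩ := ih (j + 1) (by omega)
    have hdrop : (List.finRange w).drop j = ⟨j, hjw⟩ :: (List.finRange w).drop (j + 1) := by
      rw [List.drop_eq_getElem_cons (by simpa using hjw)]
      simp
    set J : Fin w := ⟨j, hjw⟩ with hJ
    have hlow : IsMonomial (gatesUnitary (S.checkLow J)) _ := S.isMonomial_nor (wireAt 2 (by omega) J) (wireAt 1 (by omega) J)
      (wireAt 0 (by omega) J) (by simp [wireAt]) (by simp [wireAt])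
    have hhigh : IsMonomial (gatesUnitary (S.checkHigh J)) _ := S.isMonomial_nor (wireAt 4 (by omega) J) (wireAt 3 (by omega) J)
      (wireAt 2 (by omega) J) (by simp [wireAt]) (by simp [wireAt])
    set σ := flipIf (wireAt 0 (by omega) J)
      fun y => !(y (wireAt 2 (by omega) J) || y (wireAt 1 (by omega) J)) with hσ
    set ρ := flipIf (wireAt 2 (by omega) J)
      fun y => !(y (wireAt 4 (by omega) J) || y (wireAt 3 (by omega) J)) with hρ
    have hσi : Function.Involutive σ := by
      refine flipIf_involutive _ _ fun y b => ?_
      rw [Function.update_of_ne (by simp [wireAt]), Function.update_of_ne (by simp [wireAt])]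
    have hρi : Function.Involutive ρ := by
      refine flipIf_involutive _ _ fun y b => ?_
      rw [Function.update_of_ne (by simp [wireAt]), Function.update_of_ne (by simp [wireAt])]
    have hσne : ∀ z (i : Fin (4 * w + 2)), (i : ℕ) ≠ 4 * j → σ z i = z i := fun z i hi =>
      flipIf_of_ne (fun h => hi (by rw [h]; rfl)) _ _
    have hρne : ∀ z (i : Fin (4 * w + 2)), (i : ℕ) ≠ 4 * j + 2 → ρ z i = z i := fun z i hi =>
      flipIf_of_ne (fun h => hi (by rw [h]; rfl)) _ _
    -- The circuit is a palindrome, so the map is a conjugate of the inner involution.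
    refine ⟨σ ∘ (ρ ∘ τ ∘ ρ) ∘ σ, ?_, (involutive_conj hσi (involutive_conj hρi hinv)), ?_, ?_⟩
    · rw [hdrop, checkGates_cons]
      simp only [gatesUnitary_append]
      simp only [Function.comp_assoc]
      exact hlow.mul (hhigh.mul (hτ.mul (hhigh.mul hlow)))
    · intro z i hi
      simp only [Function.comp]
      rw [hσne _ _ (by omega), hρne _ _ (by omega), hodd _ _ (by omega), hρne _ _ (by omega),
        hσne _ _ (by omega)]
    · intro z i hi
      obtain rfl : i = wireAt 0 (by decide) J := Fin.ext hi
      have e0 : ((wireAt 0 (by omega) J : Fin (4 * w + 2)) : ℕ) = 4 * j := rfl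
      have e1 : ((wireAt 1 (by omega) J : Fin (4 * w + 2)) : ℕ) = 4 * j + 1 := rfl
      have e2 : ((wireAt 2 (by omega) J : Fin (4 * w + 2)) : ℕ) = 4 * j + 2 := rfl
      have e3 : ((wireAt 3 (by omega) J : Fin (4 * w + 2)) : ℕ) = 4 * j + 3 := rfl
      have e4 : ((wireAt 4 (by omega) J : Fin (4 * w + 2)) : ℕ) = 4 * j + 4 := rfl
      simp only [Function.comp]
      have hR : ReadyFrom (j + 1) (ρ (σ z)) ↔ ReadyFrom (j + 1) z := by
        have : ∀ i : Fin (4 * w + 2), (i : ℕ) % 2 = 1 → ρ (σ z) i = z i := fun i hi => by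
          rw [hρne _ _ (by omega), hσne _ _ (by omega)]
        simp only [ReadyFrom]
        rw [this (flagWire w) (by simp only [flagWire]; omega)]
        refine and_congr_right fun _ => forall₂_congr fun i _ => ?_
        rw [this _ (by simp only [wireAt]; omega), this _ (by simp only [wireAt]; omega)]
      have hR' : ReadyFrom j z ↔ ReadyFrom (j + 1) z ∧ z (wireAt 1 (by omega) J) = false ∧
          z (wireAt 3 (by omega) J) = false := by
        constructor
        · intro h
          exact ⟨⟨h.1, fun i hi => h.2 i (by omega)⟩, h.2 J le_rfl⟩
        · rintro ⟨h, h'⟩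
          refine ⟨h.1, fun i hi => ?_⟩
          rcases Nat.eq_or_lt_of_le hi with hi | hi
          · obtain rfl : i = J := Fin.ext hi.symm
            exact h'
          · exact h.2 i hi
      have a0 : τ (ρ (σ z)) (wireAt 0 (by omega) J) = σ z (wireAt 0 (by omega) J) := by
        rw [hodd _ _ (by omega), hρne _ _ (by omega)]
      have a1 : ∀ z, ρ z (wireAt 2 (by omega) J) = xor (z (wireAt 2 (by omega) J))
          (!(z (wireAt 4 (by omega) J) || z (wireAt 3 (by omega) J))) := fun z => flipIf_self _ _ _
      have a2 : ∀ z, σ z (wireAt 0 (by omega) J) = xor (z (wireAt 0 (by omega) J))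
          (!(z (wireAt 2 (by omega) J) || z (wireAt 1 (by omega) J))) := fun z => flipIf_self _ _ _
      rw [a2, a1, hρne _ _ (by omega), hρne _ _ (by omega), a0, a2, hodd _ _ (by omega), a1,
        hact _ _ (by omega), hρne _ _ (by omega), hσne _ _ (by omega), hσne _ _ (by omega),
        hσne _ _ (by omega), hodd _ _ (by omega), hodd _ _ (by omega), hρne _ _ (by omega),
        hρne _ _ (by omega), hσne _ _ (by omega), hσne _ _ (by omega)]
      have : decide (ReadyFrom j z) = (decide (ReadyFrom (j + 1) (ρ (σ z))) &&
          (!z (wireAt 1 (by omega) J) && !z (wireAt 3 (by omega) J))) := by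
        rw [Bool.eq_iff_iff]
        simp [hR, hR']
      rw [this]
      -- What remains is the cancellation of the ancilla values, an identity in six Boolean
      -- variables.
      generalize z (wireAt 0 (by omega) J) = b0
      generalize z (wireAt 1 (by omega) J) = b1
      generalize z (wireAt 2 (by omega) J) = b2
      generalize z (wireAt 3 (by omega) J) = b3
      generalize z (wireAt 4 (by omega) J) = b4
      generalize decide (ReadyFrom (j + 1) (ρ (σ z))) = b
      revert b0 b1 b2 b3 b4 b
      decide

theorem isMonomial_checkGates :
    ∃ τ : (Fin (4 * w + 2) → Bool) → (Fin (4 * w + 2) → Bool),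
      IsMonomial (gatesUnitary (S.checkGates (List.finRange w))) τ ∧
      Function.Involutive τ ∧
      (∀ z (i : Fin (4 * w + 2)), (i : ℕ) % 2 = 1 → τ z i = z i) ∧
      (∀ z, τ z 0 = xor (z 0) (decide (ReadyFrom 0 z))) := by
  obtain ⟨τ, h1, h2, h3, h4⟩ := S.isMonomial_checkGates_drop w 0 (Nat.zero_add w)
  exact ⟨τ, by simpa using h1, h2, fun z i hi => h3 z i (Or.inl hi), fun z => h4 z 0 rfl⟩

end StdGates

/-! ### One clean qubit suffices -/

/-- The qubits with even numbers. -/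
def evenWires (w : ℕ) : Fin (2 * w + 1) ↪ Fin (4 * w + 2) :=
  ⟨fun j => ⟨2 * j, by omega⟩, fun i j h => by
    have := congrArg Fin.val h
    simp only at this
    exact Fin.ext (by omega)⟩

theorem evenWires_val {w : ℕ} (j : Fin (2 * w + 1)) : (evenWires w j : ℕ) = 2 * j := rfl

theorem copyWires_val {w r : ℕ} (hr : r < 4) (j : Fin w) :
    (copyWires w r hr j : ℕ) = 4 * j + r := rfl

theorem evenWires_ne_iff {w : ℕ} (i : Fin (4 * w + 2)) :
    (∀ j, evenWires w j ≠ i) ↔ (i : ℕ) % 2 = 1 := by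
  constructor
  · intro h
    by_contra hi
    exact h ⟨i / 2, by omega⟩ (Fin.ext (by simp only [evenWires_val]; omega))
  · rintro h j rfl
    simp only [evenWires_val] at h
    omega

namespace StdGates

/-- From level `0` on, readiness prescribes precisely the odd-numbered qubits. In this form the
ready states can be counted by `sum_agree`. -/
theorem readyFrom_zero_iff {w : ℕ} (z : Fin (4 * w + 2) → Bool) :
    ReadyFrom 0 z ↔ ∀ i, (∀ j, evenWires w j ≠ i) → z i = decide (i = flagWire w) := by
  simp only [evenWires_ne_iff]
  constructor
  · rintro ⟨h, h'⟩ i hi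
    by_cases hf : i = flagWire w
    · rw [hf, h]; simp
    · rw [decide_eq_false hf]
      have hf' : (i : ℕ) ≠ 4 * w + 1 := fun h => hf (Fin.ext h)
      have hw := i.2
      obtain ⟨h1, h3⟩ := h' ⟨i / 4, by omega⟩ (Nat.zero_le _)
      rcases (by omega : (i : ℕ) = 4 * (i / 4) + 1 ∨ (i : ℕ) = 4 * (i / 4) + 3) with h4 | h4
      · rw [← h1]; exact congrArg z (Fin.ext h4)
      · rw [← h3]; exact congrArg z (Fin.ext h4)
  · intro h
    refine ⟨?_, fun i _ => ⟨?_, ?_⟩⟩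
    · rw [h _ (by simp only [flagWire]; omega)]; simp
    · rw [h _ (by simp only [wireAt]; omega), decide_eq_false]
      intro h; have := congrArg Fin.val h; simp only [wireAt, flagWire] at this; omega
    · rw [h _ (by simp only [wireAt]; omega), decide_eq_false]
      intro h; have := congrArg Fin.val h; simp only [wireAt, flagWire] at this; omega

variable {G : GateSet} (S : StdGates G)
  (inv : ∀ g : Fin G.size, List (Instr G (G.gate g).arity))

/-- Two copies of `C`, a flip of the flag if both accept, and the inverse of the two copies. -/
noncomputable def coreGates {w : ℕ} (o : Fin w) (C : List (Instr G w)) :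
    List (Instr G (4 * w + 2)) :=
  twoCopies (copyWires w 1 (by omega)) (copyWires w 3 (by omega)) C ++
  S.nor (wireAt 1 (by omega) o) (wireAt 3 (by omega) o) (flagWire w)
    (fun h => by have := congrArg Fin.val h; simp only [wireAt, flagWire] at this; omega)
    (fun h => by have := congrArg Fin.val h; simp only [wireAt, flagWire] at this; omega) ++
  twoCopies (copyWires w 1 (by omega)) (copyWires w 3 (by omega)) (invGates inv C)

theorem copyWires_ne {w : ℕ} (i j : Fin w) :
    copyWires w 1 (by omega) i ≠ copyWires w 3 (by omega) j := by
  intro h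
  have := congrArg Fin.val h
  simp only [copyWires_val] at this
  omega

theorem preservesBit_coreGates {w : ℕ} (o : Fin w) (C : List (Instr G w)) (i : Fin (4 * w + 2))
    (hi : (i : ℕ) % 2 = 0) : PreservesBit (gatesUnitary (S.coreGates inv o C)) i := by
  have h1 : ∀ M, PreservesBit (applyOn M (copyWires w 1 (by omega))) i := fun M =>
    preservesBit_applyOn _ _ _ fun j h => by
      have := congrArg Fin.val h
      simp only [copyWires_val] at this
      omega
  have h3 : ∀ M, PreservesBit (applyOn M (copyWires w 3 (by omega))) i := fun M =>
    preservesBit_applyOn _ _ _ fun j h => by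
      have := congrArg Fin.val h
      simp only [copyWires_val] at this
      omega
  rw [coreGates, gatesUnitary_append, gatesUnitary_append,
    gatesUnitary_twoCopies _ _ copyWires_ne, gatesUnitary_twoCopies _ _ copyWires_ne,
    gatesUnitary_nor]
  refine ((h1 _).mul (h3 _)).mul ((preservesBit_ctrl _ _ _ ?_).mul ((h1 _).mul (h3 _)))
  rintro rfl
  simp only [flagWire] at hi
  omega

/-- The copies are independent, so the probability that both outcomes satisfy `p` is a square. The
final states of nonzero amplitude are parametrized by pairs of local states. -/
theorem sum_normSq_two_copies {k w : ℕ} (U : Matrix (Fin k → Bool) (Fin k → Bool) ℂ)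
    (e f : Fin k ↪ Fin w) (hef : ∀ i j, e i ≠ f j) (u : Fin w → Bool) (s : Fin k → Bool)
    (hue : u ∘ e = s) (huf : u ∘ f = s) (p : (Fin k → Bool) → Prop) [DecidablePred p] :
    (∑ v, if p (v ∘ e) ∧ p (v ∘ f) then
      Complex.normSq ((applyOn U e * applyOn U f) v u) else 0) =
      (∑ t, if p t then Complex.normSq (U t s) else 0) ^ 2 := by
  have hx : ∀ t t' : Fin k → Bool,
      Function.extend e t (Function.extend f t' u) ∘ f = t' := fun t t' => by
    funext j
    simp only [Function.comp]
    rw [extend_agree e _ _ _ fun i => hef i j, f.injective.extend_apply]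
  rw [pow_two, Finset.sum_mul_sum, ← Fintype.sum_prod_type']
  symm
  refine Fintype.sum_of_injective
    (fun t : (Fin k → Bool) × (Fin k → Bool) =>
      Function.extend e t.1 (Function.extend f t.2 u)) ?_ _ _ ?_ ?_
  · rintro ⟨t, t'⟩ ⟨r, r'⟩ h
    have h1 := congrArg (· ∘ e) h
    have h2 := congrArg (· ∘ f) h
    simp only [extend_comp_self, hx] at h1 h2
    rw [h1, h2]
  · intro v hv
    rw [applyOn_mul_apply_of_disjoint U U e f hef, if_neg (c := ∀ i, _), map_zero, ite_self]
    intro h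
    refine hv ⟨(v ∘ e, v ∘ f), ?_⟩
    symm
    simp only
    rw [← eq_extend_iff]
    intro i hi
    by_cases hf : ∃ j, f j = i
    · obtain ⟨j, rfl⟩ := hf
      rw [f.injective.extend_apply]; rfl
    · rw [Function.extend_apply' _ _ _ hf]
      exact h i hi fun j hj => hf ⟨j, hj⟩
  · rintro ⟨t, t'⟩
    simp only [extend_comp_self, hx]
    rw [applyOn_mul_apply_of_disjoint U U e f hef, if_pos (c := ∀ i, _)]
    · rw [extend_comp_self, hx, hue, huf, map_mul]
      by_cases h : p t <;> by_cases h' : p t' <;> simp [h, h']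
    · intro i hi hi'
      rw [extend_agree e _ _ i hi, extend_agree f _ _ i hi']

/-- With `C` for the two copies, the entry is `⟨Cu, N Cu⟩`, where `N` multiplies by `i` unless both
outputs are `0`. The branches that are not flipped have total weight one minus the square of the
acceptance probability. -/
theorem coreGates_diag (hinv : ∀ g, gatesUnitary (inv g) = (G.gate g).matᴴ) (Q : Circuit G)
    (u : Fin (4 * Q.width + 2) → Bool) (hu : ReadyFrom 0 u) :
    gatesUnitary (S.coreGates inv Q.output Q.gates) u u =
      Complex.I * ((1 - accProb Q Q.width ^ 2 : ℝ) : ℂ) := by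
  set e := copyWires Q.width 1 (by omega) with he
  set f := copyWires Q.width 3 (by omega) with hf
  have hef : ∀ i j, e i ≠ f j := copyWires_ne
  set U := Q.unitary with hU
  set C := applyOn U e * applyOn U f with hC
  set M := fun y : Fin (4 * Q.width + 2) → Bool =>
    norMat (y (e Q.output)) (y (f Q.output)) with hM
  have hcore : gatesUnitary (S.coreGates inv Q.output Q.gates) =
      Cᴴ * (ctrl (flagWire Q.width) M * C) := by
    rw [coreGates, gatesUnitary_append, gatesUnitary_append, gatesUnitary_twoCopies _ _ hef,
      gatesUnitary_twoCopies _ _ hef, gatesUnitary_nor, gatesUnitary_invGates hinv, hC,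
      Matrix.conjTranspose_mul, ← applyOn_conjTranspose, ← applyOn_conjTranspose,
      applyOn_commute _ _ f e fun i j => (hef j i).symm]
    rfl
  have hCu : C ∈ Matrix.unitaryGroup (Fin (4 * Q.width + 2) → Bool) ℂ :=
    mul_mem (applyOn_unitary (gatesUnitary_mem _) _) (applyOn_unitary (gatesUnitary_mem _) _)
  have hflag : PreservesBit C (flagWire Q.width) := by
    refine (preservesBit_applyOn _ _ _ fun j h => ?_).mul
      (preservesBit_applyOn _ _ _ fun j h => ?_) <;>
    · have := congrArg Fin.val h
      simp only [he, hf, copyWires_val, flagWire] at this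
      omega
  -- When both outputs are `0`, the operator moves `v` to the opposite flag, where the column of `C`
  -- at `u` vanishes because `C` does not touch the flag.
  have hentry : ∀ v, star (C v u) * ((ctrl (flagWire Q.width) M * C) v u) =
      Complex.I * ((Complex.normSq (C v u) -
        if v (e Q.output) = false ∧ v (f Q.output) = false then Complex.normSq (C v u) else 0 :
          ℝ) : ℂ) := by
    intro v
    by_cases hv : v (flagWire Q.width) = u (flagWire Q.width)
    · rw [Matrix.mul_apply, Finset.sum_eq_single v]
      · have hvt : v (flagWire Q.width) = true := by rw [hv]; exact hu.1
        have h1 : ctrl (flagWire Q.width) M v v =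
            if v (e Q.output) = false ∧ v (f Q.output) = false then 0 else Complex.I := by
          simp only [ctrl, Matrix.of_apply, hvt, hM, norMat]
          rcases v (e Q.output) <;> rcases v (f Q.output) <;> simp [flipMat]
        rw [h1]
        split_ifs
        · simp
        · rw [sub_zero, mul_left_comm, RCLike.star_def, mul_comm (starRingEnd ℂ _),
            Complex.mul_conj]
      · intro v' _ hv'
        by_cases hv2 : v' (flagWire Q.width) = u (flagWire Q.width)
        · have : ctrl (flagWire Q.width) M v v' = 0 := by
            simp only [ctrl, Matrix.of_apply]
            rw [if_neg]
            intro h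
            apply hv'
            funext i
            by_cases hi : i = flagWire Q.width
            · rw [hi, hv, hv2]
            · exact (h i hi).symm
          rw [this, zero_mul]
        · rw [hflag _ _ hv2, mul_zero]
      · simp
    · rw [hflag _ _ hv]
      simp
  have hodd : ∀ i : Fin (4 * Q.width + 2), (i : ℕ) % 2 = 1 → i ≠ flagWire Q.width →
      u i = false := by
    intro i hi hif
    rw [(readyFrom_zero_iff u).1 hu i ((evenWires_ne_iff i).2 hi), decide_eq_false hif]
  have hue : u ∘ e = fun _ => false := by
    funext j
    refine hodd _ ?_ fun h => ?_
    · simp only [he, copyWires_val]; omega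
    · have := congrArg Fin.val h
      simp only [he, copyWires_val, flagWire] at this
      omega
  have huf : u ∘ f = fun _ => false := by
    funext j
    refine hodd _ ?_ fun h => ?_
    · simp only [hf, copyWires_val]; omega
    · have := congrArg Fin.val h
      simp only [hf, copyWires_val, flagWire] at this
      omega
  have hsum := sum_normSq_two_copies U e f hef u (fun _ => false) hue huf
    fun v => v Q.output = false
  rw [hcore, Matrix.mul_apply]
  simp only [Matrix.conjTranspose_apply, hentry]
  rw [← Finset.mul_sum, ← Complex.ofReal_sum, Finset.sum_sub_distrib, sum_normSq_col hCu]
  rw [accProb_width, ← hsum]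
  rfl

/-- The one-clean-qubit circuit that simulates the circuit `Q`. -/
noncomputable def oneClean (Q : Circuit G) : Circuit G where
  width := 4 * Q.width + 2
  output := 0
  gates := S.checkGates (List.finRange Q.width) ++ S.coreGates inv Q.output Q.gates ++
    S.checkGates (List.finRange Q.width) ++ S.flip 0

/-- Counts the transitions between ready and non-ready states. A ready column or row of `W` has norm
one, its diagonal entry contributes `c`, and all other ready entries vanish, so it sends weight `1 -
c` to non-ready states. There are `2 ^ (2w + 1)` ready states, one for each value of the
even-numbered qubits. -/
theorem sum_check {w : ℕ} {W : Matrix (Fin (4 * w + 2) → Bool) (Fin (4 * w + 2) → Bool) ℂ}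
    (hW : W ∈ Matrix.unitaryGroup (Fin (4 * w + 2) → Bool) ℂ)
    (hpres : ∀ i : Fin (4 * w + 2), (i : ℕ) % 2 = 0 → PreservesBit W i) (c : ℝ)
    (hdiag : ∀ u, ReadyFrom 0 u → Complex.normSq (W u u) = c) :
    (∑ v, ∑ u, if xor (v 0) (decide (ReadyFrom 0 v)) = true ∧
      xor (u 0) (decide (ReadyFrom 0 u)) = false then Complex.normSq (W v u) else 0) =
      2 ^ (2 * w + 1) * (1 - c) := by
  have hsame : ∀ v u, ReadyFrom 0 v → ReadyFrom 0 u → v ≠ u → W v u = 0 := by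
    intro v u hv hu hvu
    by_contra hne
    apply hvu
    funext i
    by_cases hi : (i : ℕ) % 2 = 0
    · by_contra h
      exact hne (hpres i hi v u h)
    · have hi' := (evenWires_ne_iff i).2 (by omega)
      rw [(readyFrom_zero_iff v).1 hv i hi', (readyFrom_zero_iff u).1 hu i hi']
  -- Qubit `0` is preserved, so the condition says that exactly one of `u` and `v` is ready: `u` if
  -- the qubit is `1`, and `v` if it is `0`. Subtracting the diagonal entry removes every ready
  -- partner, by `hsame`.
  have hterm : ∀ v u, (if xor (v 0) (decide (ReadyFrom 0 v)) = true ∧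
      xor (u 0) (decide (ReadyFrom 0 u)) = false then Complex.normSq (W v u) else 0) =
      (if ReadyFrom 0 u ∧ u 0 = true then
        Complex.normSq (W v u) - if v = u then Complex.normSq (W v u) else 0 else 0) +
      (if ReadyFrom 0 v ∧ v 0 = false then
        Complex.normSq (W v u) - if u = v then Complex.normSq (W v u) else 0 else 0) := by
    intro v u
    by_cases h0 : v 0 = u 0
    · by_cases hv : ReadyFrom 0 v
      · by_cases hu : ReadyFrom 0 u
        · by_cases hvu : v = u
          · subst hvu
            rcases h : v 0 <;> simp [hv]
          · rw [hsame v u hv hu hvu]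
            simp
        · have hvu : u ≠ v := fun h => hu (h ▸ hv)
          rcases h : u 0 <;> simp [hv, hu, h0, h, hvu]
      · by_cases hu : ReadyFrom 0 u
        · have hvu : v ≠ u := fun h => hv (h ▸ hu)
          rcases h : u 0 <;> simp [hv, hu, h0, h, hvu]
        · rcases h : u 0 <;> simp [hv, hu, h0, h]
    · rw [hpres 0 rfl v u h0]
      simp
  have hcol : ∀ u, (∑ v, if ReadyFrom 0 u ∧ u 0 = true then
        Complex.normSq (W v u) - if v = u then Complex.normSq (W v u) else 0 else 0) =
      if ReadyFrom 0 u ∧ u 0 = true then 1 - c else 0 := by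
    intro u
    split_ifs with h
    · rw [Finset.sum_sub_distrib, sum_normSq_col hW, Finset.sum_ite_eq' Finset.univ u,
        if_pos (Finset.mem_univ _), hdiag u h.1]
    · simp
  have hrow : ∀ v, (∑ u, if ReadyFrom 0 v ∧ v 0 = false then
        Complex.normSq (W v u) - if u = v then Complex.normSq (W v u) else 0 else 0) =
      if ReadyFrom 0 v ∧ v 0 = false then 1 - c else 0 := by
    intro v
    split_ifs with h
    · rw [Finset.sum_sub_distrib, sum_normSq_row hW, Finset.sum_ite_eq' Finset.univ v,
        if_pos (Finset.mem_univ _), hdiag v h.1]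
    · simp
  simp only [hterm, Finset.sum_add_distrib]
  rw [Finset.sum_comm]
  simp only [hcol, hrow]
  rw [← Finset.sum_add_distrib]
  have hcomb : ∀ u : Fin (4 * w + 2) → Bool, ((if ReadyFrom 0 u ∧ u 0 = true then 1 - c else 0) +
      if ReadyFrom 0 u ∧ u 0 = false then 1 - c else 0) =
      if ∀ i, (∀ j, evenWires w j ≠ i) → u i = decide (i = flagWire w) then 1 - c else 0 := by
    intro u
    rw [← if_congr (readyFrom_zero_iff u) rfl rfl]
    by_cases hu : ReadyFrom 0 u <;> rcases h : u 0 <;> simp [hu]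
  simp only [hcomb]
  have := sum_agree (evenWires w) (fun i => decide (i = flagWire w)) fun _ => 1 - c
  simp only [Finset.sum_const, Finset.card_univ, Fintype.card_fun, Fintype.card_bool,
    Fintype.card_fin, nsmul_eq_mul, Nat.cast_pow, Nat.cast_ofNat] at this
  rw [← this]

/-- The tests and the final flip only permute the basis up to phases, so after reindexing the
probability becomes the sum in `sum_check` with `c = (1 - a²)²`, where `a` is the acceptance
probability of `Q`. -/
theorem accProb_oneClean (hinv : ∀ g, gatesUnitary (inv g) = (G.gate g).matᴴ) (Q : Circuit G) :
    accProb (S.oneClean inv Q) 1 =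
      (1 / 4) ^ Q.width * (accProb Q Q.width ^ 2 * (2 - accProb Q Q.width ^ 2)) := by
  obtain ⟨τ, hτ, hτi, -, hτ0⟩ := S.isMonomial_checkGates (w := Q.width)
  set W := gatesUnitary (S.coreGates inv Q.output Q.gates) with hW
  have hU : (S.oneClean inv Q).unitary = gatesUnitary (S.flip 0) *
      (gatesUnitary (S.checkGates (List.finRange Q.width)) *
        (W * gatesUnitary (S.checkGates (List.finRange Q.width)))) := by
    simp only [Circuit.unitary, oneClean, gatesUnitary_append, ← hW]
  have hφ : Function.Involutive (flipIf (0 : Fin (4 * Q.width + 2)) fun _ => true) :=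
    flipIf_involutive _ _ fun _ _ => rfl
  have hns : ∀ v u : Fin (4 * Q.width + 2) → Bool, Complex.normSq ((S.oneClean inv Q).unitary v u) =
      Complex.normSq (W (τ (flipIf (0 : Fin (4 * Q.width + 2)) (fun _ => true) v)) (τ u)) := by
    intro v u
    rw [hU]
    refine ((S.isMonomial_flip 0).normSq_mul_left hφ _ v u).trans ?_
    rw [hτ.normSq_mul_left hτi, hτ.normSq_mul_right]
  rw [accProb_eq]
  have key := sum_check (gatesUnitary_mem (S.coreGates inv Q.output Q.gates))
    (fun i hi => S.preservesBit_coreGates inv Q.output Q.gates i hi)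
    ((1 - accProb Q Q.width ^ 2) ^ 2) (fun u hu => by
      rw [S.coreGates_diag inv hinv Q u hu, map_mul, Complex.normSq_I, Complex.normSq_ofReal,
        one_mul, ← pow_two])
  have hsum : (∑ v : Fin (4 * Q.width + 2) → Bool, if v 0 = false then
      ∑ u : Fin (4 * Q.width + 2) → Bool,
        if ∀ i : Fin (4 * Q.width + 2), (i : ℕ) < 1 → u i = false then
        (1 / 2) ^ (4 * Q.width + 2 - 1) *
          Complex.normSq (W (τ (flipIf (0 : Fin (4 * Q.width + 2)) (fun _ => true) v)) (τ u))
        else 0 else 0) = (1 / 2) ^ (4 * Q.width + 1) *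
      (2 ^ (2 * Q.width + 1) * (1 - (1 - accProb Q Q.width ^ 2) ^ 2)) := by
    -- Reindexing both sums by bijections absorbs the tests; the ancillas they leave changed need no
    -- clean-up.
    have hre : ∀ g : (Fin (4 * Q.width + 2) → Bool) → (Fin (4 * Q.width + 2) → Bool) → ℝ,
        ∑ v, ∑ u, g v u = ∑ v, ∑ u, g (τ (flipIf 0 (fun _ => true) v)) (τ u) := by
      intro g
      rw [← (hτi.bijective.comp hφ.bijective).sum_comp]
      exact Finset.sum_congr rfl fun v _ => (hτi.bijective.sum_comp _).symm
    rw [← key, hre, Finset.mul_sum]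
    refine Finset.sum_congr rfl fun v _ => ?_
    rw [Finset.mul_sum]
    -- As `τ` is an involution, the old value of qubit `0` is recovered from the new state and its
    -- readiness.
    have hc : ∀ z, xor (τ z 0) (decide (ReadyFrom 0 (τ z))) = z 0 := fun z => by
      rw [← hτ0, hτi]
    simp only [hc, flipIf_self]
    rcases hv : v 0
    · rw [if_pos rfl]
      refine Finset.sum_congr rfl fun u _ => ?_
      rw [mul_ite, mul_zero]
      refine if_congr ?_ rfl rfl
      constructor
      · intro h
        exact ⟨rfl, h 0 (by simp)⟩
      · rintro ⟨-, h⟩ i hi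
        obtain rfl : i = 0 := Fin.ext (by simpa using hi)
        exact h
    · simp
  refine Eq.trans ?_ (hsum.trans ?_)
  · refine Finset.sum_congr rfl fun v _ => ?_
    refine @if_congr _ _ _ _ _ _ _ _ _ Iff.rfl (Finset.sum_congr rfl fun u _ => ?_) rfl
    exact congrArg (fun t => @ite ℝ _ _ ((1 / 2) ^ (4 * Q.width + 2 - 1) * t) 0) (hns v u)
  -- The first factor is the weight of a state of the `4w + 1` mixed qubits, the second the number
  -- of ready states.
  · have h2 : (1 / 2 : ℝ) ^ (4 * Q.width + 1) * 2 ^ (2 * Q.width + 1) = (1 / 4) ^ Q.width := by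
      rw [show 4 * Q.width + 1 = 2 * Q.width + (2 * Q.width + 1) by omega, pow_add, mul_assoc,
        ← mul_pow, pow_mul]
      norm_num
    rw [← mul_assoc, h2]
    ring

end StdGates

/-! ### Simulating mixed qubits by clean qubits

The circuit has `2w` qubits; the qubit `2j` of the simulated circuit is made maximally mixed by
entangling it with the qubit `2j + 1`. -/

theorem ctrl_mul_apply {w : ℕ} (t : Fin w) (M : (Fin w → Bool) → Matrix Bool Bool ℂ)
    (A : Matrix (Fin w → Bool) (Fin w → Bool) ℂ) (x z : Fin w → Bool) :
    (ctrl t M * A) x z = ∑ b, M (Function.update x t b) (x t) b * A (Function.update x t b) z := by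
  rw [Matrix.mul_apply]
  symm
  refine Fintype.sum_of_injective (fun b => Function.update x t b) ?_ _ _ ?_ ?_
  · intro b b' h
    simpa using congrFun h t
  · intro v hv
    have : ctrl t M x v = 0 := by
      simp only [ctrl, Matrix.of_apply]
      rw [if_neg]
      intro h
      exact hv ⟨_, ((eq_update_iff t v x).1 fun i hi => (h i hi).symm).symm⟩
    rw [this, zero_mul]
  · intro b
    simp only [ctrl, Matrix.of_apply, Function.update_self]
    rw [if_pos fun i hi => (Function.update_of_ne hi _ _).symm]

/-- The qubits `2j + r`. -/
def pairWires (w r : ℕ) (hr : r < 2) : Fin w ↪ Fin (2 * w) :=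
  ⟨fun j => ⟨2 * j + r, by omega⟩, fun i j h => by
    have := congrArg Fin.val h
    simp only at this
    exact Fin.ext (by omega)⟩

theorem pairWires_val {w r : ℕ} (hr : r < 2) (j : Fin w) :
    (pairWires w r hr j : ℕ) = 2 * j + r := rfl

theorem pairWires_ne {w : ℕ} (i j : Fin w) :
    pairWires w 0 (by omega) i ≠ pairWires w 1 (by omega) j := by
  intro h
  have := congrArg Fin.val h
  simp only [pairWires_val] at this
  omega

namespace StdGates

variable {G : GateSet} (S : StdGates G)

/-- Preparation of the maximally mixed state on the qubits `2, 4, …, 2k`. -/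
noncomputable def mixGates (w k : ℕ) (hk : k < w) : List (Instr G (2 * w)) :=
  (List.finRange k).flatMap fun j : Fin k =>
    [S.h ⟨2 * (j : ℕ) + 2, by have := j.2; omega⟩,
      S.cn ⟨2 * (j : ℕ) + 2, by have := j.2; omega⟩ ⟨2 * (j : ℕ) + 3, by have := j.2; omega⟩ (by simp)]

/-- The basis states that occur in the state prepared by `mixGates`. -/
def PairedUpTo {w : ℕ} (k : ℕ) (t : Fin (2 * w) → Bool) : Prop :=
  ∀ i : Fin w, t (pairWires w 0 (by omega) i) = t (pairWires w 1 (by omega) i) ∧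
    ((i : ℕ) = 0 ∨ k < i → t (pairWires w 1 (by omega) i) = false)

instance {w : ℕ} (k : ℕ) (t : Fin (2 * w) → Bool) : Decidable (PairedUpTo k t) := by
  unfold PairedUpTo; infer_instance

/-- Each Hadamard and controlled-NOT turns one more pair from `00` into `(|00⟩ + |11⟩)/√2`, hence
equal amplitudes on all states whose pairs agree. Pair `0` stays `00`, as it belongs to the clean
qubit. -/
theorem gatesUnitary_mixGates_apply (w k : ℕ) (hk : k < w) (t : Fin (2 * w) → Bool) :
    gatesUnitary (S.mixGates w k hk) t (fun _ => false) =
      if PairedUpTo k t then (1 / (√2 : ℝ) : ℂ) ^ k else 0 := by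
  induction k generalizing t with
  | zero =>
    have h : PairedUpTo 0 t ↔ t = fun _ => false := by
      constructor
      · intro h
        funext i
        have hi := i.2
        obtain ⟨h1, h2⟩ := h ⟨i / 2, by omega⟩
        have h2 := h2 (Nat.eq_zero_or_pos _)
        rcases Nat.mod_two_eq_zero_or_one i with h0 | h0
        · rw [← h2, ← h1]
          exact congrArg t (Fin.ext (by simp only [pairWires_val]; omega))
        · rw [← h2]
          exact congrArg t (Fin.ext (by simp only [pairWires_val]; omega))
      · rintro rfl i
        simp
    simp [mixGates, gatesUnitary, Matrix.one_apply, h]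
  | succ k ih =>
    have hsplit : S.mixGates w (k + 1) hk = S.mixGates w k (by omega) ++
        ([S.h ⟨2 * k + 2, by omega⟩] ++
          [S.cn ⟨2 * k + 2, by omega⟩ ⟨2 * k + 3, by omega⟩ (by simp)]) := by
      simp [mixGates, List.finRange_succ_last, List.flatMap_append, List.flatMap_map]
    set K : Fin w := ⟨k + 1, hk⟩ with hK
    set a := pairWires w 0 (by omega) K with ha
    set b := pairWires w 1 (by omega) K with hb
    have ha' : (⟨2 * k + 2, by omega⟩ : Fin (2 * w)) = a := Fin.ext rfl
    have hb' : (⟨2 * k + 3, by omega⟩ : Fin (2 * w)) = b := Fin.ext rfl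
    have hab : a ≠ b := pairWires_ne _ _
    have hne : ∀ i : Fin w, i ≠ K → pairWires w 0 (by omega) i ≠ a ∧
        pairWires w 1 (by omega) i ≠ b ∧ pairWires w 1 (by omega) i ≠ a ∧
        pairWires w 0 (by omega) i ≠ b := by
      intro i hi
      exact ⟨fun h => hi ((pairWires w 0 _).injective h),
        fun h => hi ((pairWires w 1 _).injective h), (pairWires_ne _ _).symm, pairWires_ne _ _⟩
    have hcond : ∀ u : Fin (2 * w) → Bool, u a = false → (∀ i, i ≠ a → i ≠ b → u i = t i) →
        (PairedUpTo k u ↔ u b = false ∧ ∀ i : Fin w, i ≠ K →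
          t (pairWires w 0 (by omega) i) = t (pairWires w 1 (by omega) i) ∧
          ((i : ℕ) = 0 ∨ k + 1 < i → t (pairWires w 1 (by omega) i) = false)) := by
      intro u hu hut
      constructor
      · intro h
        refine ⟨?_, fun i hi => ?_⟩
        · rw [← (h K).1, ← ha, hu]
        · obtain ⟨h1, h2, h3, h4⟩ := hne i hi
          have := h i
          rw [hut _ h1 h4, hut _ h3 h2] at this
          exact ⟨this.1, fun h => this.2 (by omega)⟩
      · rintro ⟨h, h'⟩ i
        by_cases hi : i = K
        · subst hi
          rw [← ha, ← hb, hu, h]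
          simp
        · obtain ⟨h1, h2, h3, h4⟩ := hne i hi
          rw [hut _ h1 h4, hut _ h3 h2]
          have hi' : (i : ℕ) ≠ k + 1 := fun h => hi (Fin.ext h)
          exact ⟨(h' i hi).1, fun h => (h' i hi).2 (by omega)⟩
    have hP : PairedUpTo (k + 1) t ↔ t a = t b ∧ ∀ i : Fin w, i ≠ K →
          t (pairWires w 0 (by omega) i) = t (pairWires w 1 (by omega) i) ∧
          ((i : ℕ) = 0 ∨ k + 1 < i → t (pairWires w 1 (by omega) i) = false) := by
      constructor
      · exact fun h => ⟨(h K).1, fun i _ => h i⟩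
      · rintro ⟨h, h'⟩ i
        by_cases hi : i = K
        · subst hi
          refine ⟨h, fun h => ?_⟩
          simp [hK] at h
        · exact h' i hi
    -- Before the new Hadamard gate the pair `k + 1` is `00`, so only one of the two preimages of
    -- its first qubit contributes.
    have hu0 : ∀ c : Bool, ¬ PairedUpTo k (Function.update (Function.update t b c) a true) := by
      intro c h
      have := h K
      rw [← ha, ← hb, Function.update_self] at this
      have h2 := this.2 (Or.inr (by simp [hK]))
      rw [h2] at this
      exact absurd this.1 (by simp)
    have hu1 : ∀ c : Bool, PairedUpTo k (Function.update (Function.update t b c) a false) ↔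
        c = false ∧ ∀ i : Fin w, i ≠ K →
          t (pairWires w 0 (by omega) i) = t (pairWires w 1 (by omega) i) ∧
          ((i : ℕ) = 0 ∨ k + 1 < i → t (pairWires w 1 (by omega) i) = false) := by
      intro c
      rw [hcond _ (Function.update_self _ _ _) fun i hi hi' => by
        rw [Function.update_of_ne hi, Function.update_of_ne hi']]
      rw [Function.update_of_ne hab.symm, Function.update_self]
    rw [hsplit, gatesUnitary_append, gatesUnitary_append, gatesUnitary_h, gatesUnitary_cn,
      Matrix.mul_assoc]
    simp only [ha', hb']
    rw [ctrl_mul_apply]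
    simp only [ctrl_mul_apply, Fintype.sum_bool, ih (by omega), hu0, hu1, if_false, mul_zero,
      zero_add, Function.update_of_ne hab, Bool.true_eq_false, false_and, true_and]
    have hH : ∀ c, hMat c false = 1 / (√2 : ℝ) := fun c => by
      rw [hMat_eq]; simp
    rw [hH]
    have hX : (if t a = true then flipMat else 1 : Matrix Bool Bool ℂ) (t b) false =
        if t a = t b then 1 else 0 := by
      rcases t a <;> rcases t b <;> simp [flipMat]
    rw [hX, if_congr hP rfl rfl]
    by_cases h1 : t a = t b
    · rw [if_pos h1, one_mul, mul_ite, mul_zero, pow_succ']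
      exact if_congr (and_iff_right h1).symm rfl rfl
    · rw [if_neg h1, zero_mul, if_neg fun h => h1 h.1]

/-- The circuit that simulates the one-clean-qubit computation of `Q` with clean qubits only. -/
noncomputable def purify (Q : Circuit G) : Circuit G where
  width := 2 * Q.width
  output := pairWires Q.width 0 (by omega) Q.output
  gates := S.mixGates Q.width (Q.width - 1) (by have := Q.output.2; omega) ++
    Q.gates.map (Instr.map (pairWires Q.width 0 (by omega)))

/-- Acting on one half of the Bell pairs puts the entry of `Q.unitary` with row the values on `e`
and column the values on `f` into the amplitude, times `2^{-(w-1)/2}`. Summing over the values on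
`f` is then averaging over the mixed input. -/
theorem accProb_purify (Q : Circuit G) :
    accProb (S.purify Q) (2 * Q.width) = accProb Q 1 := by
  have hw : 0 < Q.width := by have := Q.output.2; omega
  set e := pairWires Q.width 0 (by omega) with he
  set f := pairWires Q.width 1 (by omega) with hf
  have hfull : ∀ (t : Fin (2 * Q.width) → Bool),
      PairedUpTo (Q.width - 1) t ↔ t ∘ e = t ∘ f ∧ t (f ⟨0, hw⟩) = false := by
    intro t
    constructor
    · exact fun h => ⟨funext fun i => (h i).1, (h ⟨0, hw⟩).2 (Or.inl rfl)⟩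
    · rintro ⟨h1, h2⟩ i
      refine ⟨congrFun h1 i, fun h => ?_⟩
      have : i = ⟨0, hw⟩ := Fin.ext (show (i : ℕ) = 0 by have := i.2; omega)
      rw [this]
      exact h2
  have hprod : ∀ v : Fin (2 * Q.width) → Bool, (applyOn Q.unitary e *
        gatesUnitary (S.mixGates Q.width (Q.width - 1) (by omega))) v (fun _ => false) =
      if v (f ⟨0, hw⟩) = false then
        Q.unitary (v ∘ e) (v ∘ f) * (1 / (√2 : ℝ) : ℂ) ^ (Q.width - 1) else 0 := by
    intro v
    rw [Matrix.mul_apply, sum_applyOn_right]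
    simp only [gatesUnitary_mixGates_apply, hfull, extend_comp_self]
    have h2 : ∀ s i, Function.extend e s v (f i) = v (f i) := fun s i =>
      extend_agree e s v _ fun j => pairWires_ne _ _
    have h3 : ∀ s, Function.extend e s v ∘ f = v ∘ f := fun s => funext fun i => h2 s i
    simp only [h2, h3]
    rw [Finset.sum_eq_single (v ∘ f)]
    · by_cases h : v (f ⟨0, hw⟩) = false <;> simp [h]
    · intro s _ hs
      rw [if_neg fun h => hs h.1, mul_zero]
    · simp
  have hentry : ∀ v : Fin (2 * Q.width) → Bool, (S.purify Q).unitary v (fun _ => false) =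
      if v (f ⟨0, hw⟩) = false then
        Q.unitary (v ∘ e) (v ∘ f) * (1 / (√2 : ℝ) : ℂ) ^ (Q.width - 1) else 0 := by
    intro v
    have h1 : (S.purify Q).unitary = applyOn Q.unitary e *
        gatesUnitary (S.mixGates Q.width (Q.width - 1) (by omega)) := by
      simp only [Circuit.unitary, purify, gatesUnitary_append, gatesUnitary_map]
      rfl
    rw [h1]
    exact hprod v
  have hnorm : ∀ v : Fin (2 * Q.width) → Bool,
      Complex.normSq ((S.purify Q).unitary v (fun _ => false)) =
      if v (f ⟨0, hw⟩) = false then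
        (1 / 2) ^ (Q.width - 1) * Complex.normSq (Q.unitary (v ∘ e) (v ∘ f)) else 0 := by
    intro v
    rw [hentry]
    split_ifs
    · have : Complex.normSq (1 / (√2 : ℝ) : ℂ) = 1 / 2 := by
        rw [← Complex.ofReal_one, ← Complex.ofReal_div, Complex.normSq_ofReal, div_mul_div_comm,
          Real.mul_self_sqrt (by norm_num), one_mul]
      rw [map_mul, map_pow, this, mul_comm]
    · simp
  have hbij : Function.Bijective fun v : Fin (2 * Q.width) → Bool => (v ∘ e, v ∘ f) := by
    rw [Fintype.bijective_iff_injective_and_card]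
    constructor
    · intro v v' h
      funext i
      obtain ⟨h1, h2⟩ := Prod.mk.inj h
      have hi := i.2
      rcases Nat.mod_two_eq_zero_or_one i with h0 | h0
      · have : i = e ⟨i / 2, by omega⟩ := Fin.ext (by simp only [he, pairWires_val]; omega)
        rw [this]
        exact congrFun h1 _
      · have : i = f ⟨i / 2, by omega⟩ := Fin.ext (by simp only [hf, pairWires_val]; omega)
        rw [this]
        exact congrFun h2 _
    · simp [← pow_add, two_mul]
  refine (accProb_width (S.purify Q)).trans ?_
  rw [accProb_eq]
  have hout : ∀ v : Fin (2 * Q.width) → Bool, v (S.purify Q).output = (v ∘ e) Q.output :=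
    fun _ => rfl
  have hfin : ∀ u : Fin Q.width → Bool, (∀ i : Fin Q.width, (i : ℕ) < 1 → u i = false) ↔
      u ⟨0, hw⟩ = false := by
    intro u
    constructor
    · exact fun h => h ⟨0, hw⟩ (by simp)
    · intro h i hi
      rw [← h]
      exact congrArg u (Fin.ext (by simpa using hi))
  calc _ = ∑ v : Fin (2 * Q.width) → Bool, if (v ∘ e) Q.output = false then
        if (v ∘ f) ⟨0, hw⟩ = false then
        (1 / 2) ^ (Q.width - 1) * Complex.normSq (Q.unitary (v ∘ e) (v ∘ f)) else 0 else 0 := by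
        refine Finset.sum_congr rfl fun v _ => ?_
        exact @if_congr _ _ _ _ _ _ _ _ _ Iff.rfl (hnorm v) rfl
    _ = ∑ p : (Fin Q.width → Bool) × (Fin Q.width → Bool), if p.1 Q.output = false then
        if p.2 ⟨0, hw⟩ = false then
        (1 / 2) ^ (Q.width - 1) * Complex.normSq (Q.unitary p.1 p.2) else 0 else 0 :=
        hbij.sum_comp fun p => if p.1 Q.output = false then
          if p.2 ⟨0, hw⟩ = false then
          (1 / 2) ^ (Q.width - 1) * Complex.normSq (Q.unitary p.1 p.2) else 0 else 0
    _ = _ := by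
        rw [Fintype.sum_prod_type]
        refine Finset.sum_congr rfl fun v _ => ?_
        by_cases h : v Q.output = false
        · simp only [h, if_true]
          exact Finset.sum_congr rfl fun u _ => if_congr (hfin u).symm rfl rfl
        · simp [h]

end StdGates

/-! ### Multi-stack machines and their composition -/

/-- `StepsTo m n c d`: the program `m` takes the configuration `c` to `d` in exactly `n` steps. -/
inductive StepsTo {K : Type} [DecidableEq K] {Γ : K → Type} {Λ σ : Type}
    (m : Λ → TM2.Stmt Γ Λ σ) : ℕ → TM2.Cfg Γ Λ σ → TM2.Cfg Γ Λ σ → Prop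
  | refl (c : TM2.Cfg Γ Λ σ) : StepsTo m 0 c c
  | head {n : ℕ} {c d e : TM2.Cfg Γ Λ σ} (h : TM2.step m c = some d) (h' : StepsTo m n d e) :
      StepsTo m (n + 1) c e

namespace StepsTo

variable {K : Type} [DecidableEq K] {Γ : K → Type} {Λ σ : Type} {m : Λ → TM2.Stmt Γ Λ σ}

theorem trans {a b : ℕ} {c d e : TM2.Cfg Γ Λ σ} (h : StepsTo m a c d) (h' : StepsTo m b d e) :
    StepsTo m (a + b) c e := by
  induction h with
  | refl => simpa using h'
  | head h _ ih => rw [Nat.add_right_comm]; exact head h (ih h')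

theorem single {c d : TM2.Cfg Γ Λ σ} (h : TM2.step m c = some d) : StepsTo m 1 c d :=
  head h (refl d)

theorem iterate_iff {n : ℕ} {c d : TM2.Cfg Γ Λ σ} :
    (flip bind (TM2.step m))^[n] (some c) = some d ↔ StepsTo m n c d := by
  induction n generalizing c with
  | zero =>
    constructor
    · intro h
      obtain rfl : c = d := by simpa using h
      exact refl c
    · rintro ⟨⟩
      rfl
  | succ n ih =>
    rw [Function.iterate_succ_apply]
    change (flip bind (TM2.step m))^[n] (TM2.step m c) = some d ↔ _
    constructor
    · intro h
      rcases hc : TM2.step m c with _ | c'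
      · rw [hc] at h
        have : ∀ k, (flip bind (TM2.step m))^[k] none = none := fun k => by
          induction k with
          | zero => rfl
          | succ k ih => rw [Function.iterate_succ_apply]; exact ih
        rw [this] at h
        exact absurd h (by simp)
      · rw [hc, ih] at h
        exact head hc h
    · rintro (_ | ⟨h, h'⟩)
      rw [h]
      exact ih.2 h'

end StepsTo

/-- A program for a machine with stacks indexed by `K` and registers `σ`. -/
structure Machine (K : Type) (Γ : K → Type) (σ : Type) where
  Λ : Type
  [fin : Fintype Λ]
  main : Λ
  code : Λ → TM2.Stmt Γ Λ σ

/-- Started with stacks `S` and register `v`, the machine halts within `t` steps with stacks `S'`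
and register `v`. -/
def Machine.Runs {K : Type} [DecidableEq K] {Γ : K → Type} {σ : Type} (M : Machine K Γ σ) (v : σ)
    (S S' : ∀ k, List (Γ k)) (t : ℕ) : Prop :=
  ∃ n ≤ t, StepsTo M.code n ⟨some M.main, v, S⟩ ⟨none, v, S'⟩

namespace Machine

section relabel

variable {K : Type} {Γ : K → Type} {Λ Λ' σ : Type}

/-- Relabelling of a statement; `halt` is replaced by a jump to `ex`, if given. -/
def relabel (f : Λ → Λ') (ex : Option Λ') : TM2.Stmt Γ Λ σ → TM2.Stmt Γ Λ' σ
  | .push k g q => .push k g (relabel f ex q)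
  | .peek k g q => .peek k g (relabel f ex q)
  | .pop k g q => .pop k g (relabel f ex q)
  | .load g q => .load g (relabel f ex q)
  | .branch g q q' => .branch g (relabel f ex q) (relabel f ex q')
  | .goto l => .goto fun v => f (l v)
  | .halt => match ex with
    | none => .halt
    | some l => .goto fun _ => l

/-- Relabelling of a configuration. -/
def relabelCfg (f : Λ → Λ') (ex : Option Λ') (c : TM2.Cfg Γ Λ σ) : TM2.Cfg Γ Λ' σ :=
  ⟨match c.l with
    | some l => some (f l)
    | none => ex, c.var, c.stk⟩

variable [DecidableEq K]

theorem stepAux_relabel (f : Λ → Λ') (ex : Option Λ') (q : TM2.Stmt Γ Λ σ) (v : σ)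
    (S : ∀ k, List (Γ k)) :
    TM2.stepAux (relabel f ex q) v S = relabelCfg f ex (TM2.stepAux q v S) := by
  induction q generalizing v S with
  | push k g q ih => exact ih _ _
  | peek k g q ih => exact ih _ _
  | pop k g q ih => exact ih _ _
  | load g q ih => exact ih _ _
  | branch g q q' ih ih' =>
    simp only [relabel, TM2.stepAux]
    rcases g v
    · exact ih' _ _
    · exact ih _ _
  | goto l => rfl
  | halt => rcases ex with _ | l <;> rfl

theorem stepsTo_relabel {f : Λ → Λ'} {ex : Option Λ'} {m : Λ → TM2.Stmt Γ Λ σ}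
    {m' : Λ' → TM2.Stmt Γ Λ' σ} (h : ∀ l, m' (f l) = relabel f ex (m l)) {n : ℕ}
    {c d : TM2.Cfg Γ Λ σ} (hs : StepsTo m n c d) :
    StepsTo m' n (relabelCfg f ex c) (relabelCfg f ex d) := by
  induction hs with
  | refl => exact .refl _
  | @head n c d e hcd _ ih =>
    refine .head ?_ ih
    obtain ⟨_ | l, v, S⟩ := c
    · simp at hcd
    · simp only [TM2.step, Option.some.injEq] at hcd
      rw [← hcd, ← stepAux_relabel, ← h]
      rfl

end relabel

variable {K : Type} [DecidableEq K] {Γ : K → Type} {σ : Type}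

theorem Runs.mono {M : Machine K Γ σ} {v : σ} {S S' : ∀ k, List (Γ k)} {t t' : ℕ}
    (h : M.Runs v S S' t) (ht : t ≤ t') : M.Runs v S S' t' := by
  obtain ⟨n, hn, h⟩ := h
  exact ⟨n, hn.trans ht, h⟩

theorem Runs.stepsTo_relabel {M : Machine K Γ σ} {v : σ} {S S' : ∀ k, List (Γ k)} {t : ℕ}
    (h : M.Runs v S S' t) {Λ' : Type} {f : M.Λ → Λ'} {ex : Option Λ'}
    {m' : Λ' → TM2.Stmt Γ Λ' σ} (hm : ∀ l, m' (f l) = relabel f ex (M.code l)) :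
    ∃ n ≤ t, StepsTo m' n ⟨some (f M.main), v, S⟩ ⟨ex, v, S'⟩ := by
  obtain ⟨n, hn, h⟩ := h
  exact ⟨n, hn, Machine.stepsTo_relabel hm h⟩

/-- A single statement. -/
def op (q : TM2.Stmt Γ Unit σ) : Machine K Γ σ := ⟨Unit, (), fun _ => q⟩

theorem runs_op {q : TM2.Stmt Γ Unit σ} {v : σ} {S S' : ∀ k, List (Γ k)}
    (h : TM2.stepAux q v S = ⟨none, v, S'⟩) : (op q).Runs v S S' 1 :=
  ⟨1, le_rfl, .single (congrArg some h)⟩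

/-- The machine that does nothing. -/
def skip : Machine K Γ σ := op .halt

theorem runs_skip (v : σ) (S : ∀ k, List (Γ k)) : (skip : Machine K Γ σ).Runs v S S 1 :=
  runs_op rfl

/-- Sequential composition. -/
def seq (M N : Machine K Γ σ) : Machine K Γ σ where
  Λ := M.Λ ⊕ N.Λ
  fin := @instFintypeSum _ _ M.fin N.fin
  main := .inl M.main
  code
    | .inl l => relabel .inl (some (.inr N.main)) (M.code l)
    | .inr l => relabel .inr none (N.code l)

theorem Runs.seq {M N : Machine K Γ σ} {v : σ} {S S' S'' : ∀ k, List (Γ k)} {t t' : ℕ}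
    (h : M.Runs v S S' t) (h' : N.Runs v S' S'' t') : (M.seq N).Runs v S S'' (t + t') := by
  obtain ⟨n, hn, h⟩ := h.stepsTo_relabel (m' := (M.seq N).code) (f := .inl)
    (ex := some (.inr N.main)) (fun _ => rfl)
  obtain ⟨n', hn', h'⟩ := h'.stepsTo_relabel (m' := (M.seq N).code) (f := .inr) (ex := none)
    (fun _ => rfl)
  exact ⟨n + n', add_le_add hn hn', h.trans h'⟩

/-! #### Machines on a part of the stacks -/

section lift

variable {K₁ K₂ : Type} {Γ₁ : K₁ → Type} {Γ₂ : K₂ → Type} {Λ σ₁ σ₂ : Type}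

/-- The disjoint union of two families of alphabets. -/
abbrev SumFam (Γ₁ : K₁ → Type) (Γ₂ : K₂ → Type) : K₁ ⊕ K₂ → Type
  | .inl k => Γ₁ k
  | .inr k => Γ₂ k

/-- Contents of two families of stacks. -/
def join (A : ∀ k, List (Γ₁ k)) (B : ∀ k, List (Γ₂ k)) : ∀ k, List (SumFam Γ₁ Γ₂ k)
  | .inl k => A k
  | .inr k => B k

variable [DecidableEq K₁] [DecidableEq K₂]

theorem update_join_inl (A : ∀ k, List (Γ₁ k)) (B : ∀ k, List (Γ₂ k)) (k : K₁)
    (l : List (Γ₁ k)) :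
    Function.update (join A B) (.inl k) l = join (Function.update A k l) B := by
  funext k'
  rcases k' with k' | k'
  · by_cases h : k' = k
    · subst h
      rw [Function.update_self]
      exact (Function.update_self (β := fun k => List (Γ₁ k)) _ _ _).symm
    · rw [Function.update_of_ne (by simpa using h)]
      exact (Function.update_of_ne (β := fun k => List (Γ₁ k)) h _ _).symm
  · rw [Function.update_of_ne (by simp)]
    rfl

theorem update_join_inr (A : ∀ k, List (Γ₁ k)) (B : ∀ k, List (Γ₂ k)) (k : K₂)
    (l : List (Γ₂ k)) :
    Function.update (join A B) (.inr k) l = join A (Function.update B k l) := by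
  funext k'
  rcases k' with k' | k'
  · rw [Function.update_of_ne (by simp)]
    rfl
  · by_cases h : k' = k
    · subst h
      rw [Function.update_self]
      exact (Function.update_self (β := fun k => List (Γ₂ k)) _ _ _).symm
    · rw [Function.update_of_ne (by simpa using h)]
      exact (Function.update_of_ne (β := fun k => List (Γ₂ k)) h _ _).symm

/-- A statement on the first of two families of stacks. -/
def stmtL : TM2.Stmt Γ₁ Λ σ₁ → TM2.Stmt (SumFam Γ₁ Γ₂) Λ (σ₁ × σ₂)
  | .push k g q => .push (.inl k) (fun v => g v.1) (stmtL q)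
  | .peek k g q => .peek (.inl k) (fun v x => (g v.1 x, v.2)) (stmtL q)
  | .pop k g q => .pop (.inl k) (fun v x => (g v.1 x, v.2)) (stmtL q)
  | .load g q => .load (fun v => (g v.1, v.2)) (stmtL q)
  | .branch g q q' => .branch (fun v => g v.1) (stmtL q) (stmtL q')
  | .goto l => .goto fun v => l v.1
  | .halt => .halt

/-- A statement on the second of two families of stacks. -/
def stmtR : TM2.Stmt Γ₂ Λ σ₂ → TM2.Stmt (SumFam Γ₁ Γ₂) Λ (σ₁ × σ₂)
  | .push k g q => .push (.inr k) (fun v => g v.2) (stmtR q)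
  | .peek k g q => .peek (.inr k) (fun v x => (v.1, g v.2 x)) (stmtR q)
  | .pop k g q => .pop (.inr k) (fun v x => (v.1, g v.2 x)) (stmtR q)
  | .load g q => .load (fun v => (v.1, g v.2)) (stmtR q)
  | .branch g q q' => .branch (fun v => g v.2) (stmtR q) (stmtR q')
  | .goto l => .goto fun v => l v.2
  | .halt => .halt

theorem stepAux_stmtL (q : TM2.Stmt Γ₁ Λ σ₁) (v : σ₁) (u : σ₂) (A : ∀ k, List (Γ₁ k))
    (B : ∀ k, List (Γ₂ k)) :
    TM2.stepAux (stmtL q) (v, u) (join A B) =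
      ⟨(TM2.stepAux q v A).l, ((TM2.stepAux q v A).var, u), join (TM2.stepAux q v A).stk B⟩ := by
  induction q generalizing v A with
  | push k g q ih =>
    simp only [stmtL, TM2.stepAux]
    rw [← ih, ← update_join_inl]
    rfl
  | peek k g q ih => exact ih _ _
  | pop k g q ih =>
    simp only [stmtL, TM2.stepAux]
    rw [← ih, ← update_join_inl]
    rfl
  | load g q ih => exact ih _ _
  | branch g q q' ih ih' =>
    simp only [stmtL, TM2.stepAux]
    rcases g v
    · exact ih' _ _
    · exact ih _ _
  | goto l => rfl
  | halt => rfl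

theorem stepAux_stmtR (q : TM2.Stmt Γ₂ Λ σ₂) (u : σ₁) (v : σ₂) (A : ∀ k, List (Γ₁ k))
    (B : ∀ k, List (Γ₂ k)) :
    TM2.stepAux (stmtR q) (u, v) (join A B) =
      ⟨(TM2.stepAux q v B).l, (u, (TM2.stepAux q v B).var), join A (TM2.stepAux q v B).stk⟩ := by
  induction q generalizing v B with
  | push k g q ih =>
    simp only [stmtR, TM2.stepAux]
    rw [← ih, ← update_join_inr]
    rfl
  | peek k g q ih => exact ih _ _
  | pop k g q ih =>
    simp only [stmtR, TM2.stepAux]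
    rw [← ih, ← update_join_inr]
    rfl
  | load g q ih => exact ih _ _
  | branch g q q' ih ih' =>
    simp only [stmtR, TM2.stepAux]
    rcases g v
    · exact ih' _ _
    · exact ih _ _
  | goto l => rfl
  | halt => rfl

/-- A machine on the first of two families of stacks. -/
def liftL (M : Machine K₁ Γ₁ σ₁) (Γ₂ : K₂ → Type) (σ₂ : Type) :
    Machine (K₁ ⊕ K₂) (SumFam Γ₁ Γ₂) (σ₁ × σ₂) where
  Λ := M.Λ
  fin := M.fin
  main := M.main
  code l := stmtL (M.code l)

/-- A machine on the second of two families of stacks. -/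
def liftR (M : Machine K₂ Γ₂ σ₂) (Γ₁ : K₁ → Type) (σ₁ : Type) :
    Machine (K₁ ⊕ K₂) (SumFam Γ₁ Γ₂) (σ₁ × σ₂) where
  Λ := M.Λ
  fin := M.fin
  main := M.main
  code l := stmtR (M.code l)

/-- Stacks and registers of the other family are carried along unchanged, so machines with unrelated
alphabets can be run one after the other. -/
theorem Runs.liftL {M : Machine K₁ Γ₁ σ₁} {v : σ₁} {A A' : ∀ k, List (Γ₁ k)} {t : ℕ}
    (h : M.Runs v A A' t) (u : σ₂) (B : ∀ k, List (Γ₂ k)) :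
    (M.liftL Γ₂ σ₂).Runs (v, u) (join A B) (join A' B) t := by
  obtain ⟨n, hn, h⟩ := h
  refine ⟨n, hn, ?_⟩
  have key : ∀ {n : ℕ} {c d : TM2.Cfg Γ₁ M.Λ σ₁}, StepsTo M.code n c d →
      StepsTo (M.liftL Γ₂ σ₂).code n ⟨c.l, (c.var, u), join c.stk B⟩
        ⟨d.l, (d.var, u), join d.stk B⟩ := by
    intro n c d h
    induction h with
    | refl => exact .refl _
    | @head n c d e hcd _ ih =>
      refine .head ?_ ih
      obtain ⟨_ | l, v, S⟩ := c
      · simp at hcd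
      · simp only [TM2.step, Option.some.injEq] at hcd
        rw [← hcd]
        exact congrArg some (stepAux_stmtL _ _ _ _ _)
  exact key h

theorem Runs.liftR {M : Machine K₂ Γ₂ σ₂} {v : σ₂} {B B' : ∀ k, List (Γ₂ k)} {t : ℕ}
    (h : M.Runs v B B' t) (u : σ₁) (A : ∀ k, List (Γ₁ k)) :
    (M.liftR Γ₁ σ₁).Runs (u, v) (join A B) (join A B') t := by
  obtain ⟨n, hn, h⟩ := h
  refine ⟨n, hn, ?_⟩
  have key : ∀ {n : ℕ} {c d : TM2.Cfg Γ₂ M.Λ σ₂}, StepsTo M.code n c d →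
      StepsTo (M.liftR Γ₁ σ₁).code n ⟨c.l, (u, c.var), join A c.stk⟩
        ⟨d.l, (u, d.var), join A d.stk⟩ := by
    intro n c d h
    induction h with
    | refl => exact .refl _
    | @head n c d e hcd _ ih =>
      refine .head ?_ ih
      obtain ⟨_ | l, v, S⟩ := c
      · simp at hcd
      · simp only [TM2.step, Option.some.injEq] at hcd
        rw [← hcd]
        exact congrArg some (stepAux_stmtR _ _ _ _ _)
  exact key h

end lift

/-! #### Moving the contents of a stack -/

/-- Moves the contents of the stack `a` to the stack `b`, in reverse order. -/
def transfer (a b : K) (φ : Γ a → Bool) (ψ : Bool → Γ b) : Machine K Γ (σ × Option Bool) where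
  Λ := Unit
  main := ()
  code _ := .pop a (fun v x => (v.1, x.map φ))
    (.branch (fun v => v.2.isNone) .halt
      (.push b (fun v => ψ (v.2.getD false)) (.load (fun v => (v.1, none)) (.goto fun _ => ()))))

/-- Each symbol costs one step, since a whole statement up to its jump is one step. A second
transfer restores the order. The symbol register is emptied before each jump, as `Runs` demands its
initial value at the end. -/
theorem runs_transfer {a b : K} (hab : a ≠ b) (φ : Γ a → Bool) (ψ : Bool → Γ b) (v : σ)
    (l : List (Γ a)) : ∀ S : ∀ k, List (Γ k), S a = l →
    (transfer a b φ ψ).Runs (v, none) S (Function.update (Function.update S a []) b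
      ((l.map fun x => ψ (φ x)).reverse ++ S b)) (l.length + 1) := by
  induction l with
  | nil =>
    intro S hS
    refine ⟨1, by simp, .single ?_⟩
    have h1 : Function.update S a [] = S := by rw [← hS, Function.update_eq_self]
    simp [transfer, hS, h1]
  | cons x l ih =>
    intro S hS
    set S' := Function.update (Function.update S a l) b (ψ (φ x) :: S b) with hS'
    have hSa : S' a = l := by simp [hS', Function.update_of_ne hab]
    obtain ⟨n, hn, h⟩ := ih S' hSa
    have h1 : Function.update (Function.update S' a []) b
        ((l.map fun x => ψ (φ x)).reverse ++ S' b) =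
        Function.update (Function.update S a []) b
        (((x :: l).map fun x => ψ (φ x)).reverse ++ S b) := by
      rw [hS', Function.update_comm hab.symm, Function.update_idem, Function.update_idem,
        Function.update_self]
      simp
    rw [h1] at h
    refine ⟨n + 1, by simpa using hn, .head ?_ h⟩
    simp [transfer, hS, hS', Function.update_of_ne hab.symm]

/-! #### Growth of the stacks -/

/-- An upper bound on the number of symbols that a statement pushes. -/
def pushCount {Λ : Type} : TM2.Stmt Γ Λ σ → ℕ
  | .push _ _ q => pushCount q + 1
  | .peek _ _ q => pushCount q
  | .pop _ _ q => pushCount q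
  | .load _ q => pushCount q
  | .branch _ q q' => pushCount q + pushCount q'
  | .goto _ => 0
  | .halt => 0

theorem length_stepAux_le {Λ : Type} (q : TM2.Stmt Γ Λ σ) (v : σ) (S : ∀ k, List (Γ k)) (k : K) :
    ((TM2.stepAux q v S).stk k).length ≤ (S k).length + pushCount q := by
  induction q generalizing v S with
  | push k' g q ih =>
    refine (ih _ _).trans ?_
    by_cases h : k = k'
    · subst h; simp [pushCount]; omega
    · rw [Function.update_of_ne h]; simp [pushCount]
  | peek k g q ih => exact ih _ _
  | pop k' g q ih =>
    refine (ih _ _).trans ?_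
    by_cases h : k = k'
    · subst h; simp [pushCount]
    · rw [Function.update_of_ne h]; simp [pushCount]
  | load g q ih => exact ih _ _
  | branch g q q' ih ih' =>
    simp only [TM2.stepAux, pushCount]
    rcases g v
    · exact (ih' _ _).trans (by omega)
    · exact (ih _ _).trans (by omega)
  | goto l => simp [pushCount]
  | halt => simp [pushCount]

/-- A step executes one statement, which pushes a bounded number of symbols. This bounds the output
length by a polynomial, as needed for the running time of compositions. -/
theorem Runs.length_le {M : Machine K Γ σ} {v : σ} {S S' : ∀ k, List (Γ k)} {t : ℕ}
    (h : M.Runs v S S' t) (k : K) : (S' k).length ≤ (S k).length +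
      (@Finset.univ _ M.fin).sum (fun l => pushCount (M.code l)) * t := by
  obtain ⟨n, hn, h⟩ := h
  let _ := M.fin
  have key : ∀ {n : ℕ} {c d : TM2.Cfg Γ M.Λ σ}, StepsTo M.code n c d →
      (d.stk k).length ≤ (c.stk k).length + (∑ l, pushCount (M.code l)) * n := by
    intro n c d h
    induction h with
    | refl => simp
    | @head n c d e hcd _ ih =>
      obtain ⟨_ | l, v, S⟩ := c
      · simp at hcd
      · simp only [TM2.step, Option.some.injEq] at hcd
        have h1 := length_stepAux_le (M.code l) v S k
        rw [hcd] at h1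
        have h2 : pushCount (M.code l) ≤ ∑ l, pushCount (M.code l) :=
          Finset.single_le_sum (f := fun l => pushCount (M.code l)) (fun _ _ => Nat.zero_le _)
            (Finset.mem_univ l)
        simp only
        rw [Nat.mul_succ]
        omega
  exact (key h).trans (Nat.add_le_add_left (Nat.mul_le_mul_left _ hn) _)

/-! #### Polynomial-time computable functions -/

/-- Only the stack `k` is nonempty. -/
def only (k : K) (l : List (Γ k)) : ∀ k, List (Γ k) := Function.update (fun _ => []) k l

theorem only_self (k : K) (l : List (Γ k)) : only k l k = l := Function.update_self _ _ _

theorem only_of_ne {k k' : K} (h : k' ≠ k) (l : List (Γ k)) : only k l k' = [] :=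
  Function.update_of_ne h _ _

theorem length_only_le (k k' : K) (l : List (Γ k)) : (only k l k').length ≤ l.length := by
  by_cases h : k' = k
  · subst h; rw [only_self]
  · rw [only_of_ne h]; simp

theorem Runs.output_length_le {M : Machine K Γ σ} {v : σ} {a b : K} {x : List (Γ a)}
    {y : List (Γ b)} {t : ℕ} (h : M.Runs v (only a x) (only b y) t) :
    y.length ≤ x.length + (@Finset.univ _ M.fin).sum (fun l => pushCount (M.code l)) * t := by
  have := h.length_le b
  rw [only_self] at this
  exact this.trans (Nat.add_le_add_right (length_only_le _ _ _) _)

/-- The bundled machine, with input stack `a` and output stack `b`. -/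
def toFinTM2 [Fintype K] [Fintype σ] (M : Machine K Γ σ) (v : σ) (a b : K) [Fintype (Γ a)] :
    FinTM2 :=
  letI := M.fin
  { K := K, k₀ := a, k₁ := b, Γ := Γ, Λ := M.Λ, main := M.main, σ := σ, initialState := v
    m := M.code }

/-- The program of a bundled machine. -/
def ofFinTM2 (tm : FinTM2) : Machine tm.K tm.Γ tm.σ := @Machine.mk _ _ _ tm.Λ tm.ΛFin tm.main tm.m

end Machine

theorem initList_eq (tm : FinTM2) (s : List (tm.Γ tm.k₀)) :
    initList tm s = ⟨some tm.main, tm.initialState, Machine.only tm.k₀ s⟩ := by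
  unfold initList
  congr 1
  funext k
  by_cases h : k = tm.k₀
  · subst h
    rw [dif_pos rfl, Machine.only_self]
    rfl
  · rw [dif_neg h, Machine.only_of_ne h]

/-- A halted machine must have its initial register and no nonempty stack besides the output. Hence
all programs below clean up after themselves. -/
theorem haltList_eq (tm : FinTM2) (s : List (tm.Γ tm.k₁)) :
    haltList tm s = ⟨none, tm.initialState, Machine.only tm.k₁ s⟩ := by
  unfold haltList
  congr 1
  funext k
  by_cases h : k = tm.k₁
  · subst h
    rw [dif_pos rfl, Machine.only_self]
    rfl
  · rw [dif_neg h, Machine.only_of_ne h]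

/-- `PolyTime i o`: some polynomial-time machine maps `i a` to `o a`, for all `a`. -/
def PolyTime {α : Type} (i o : α → List Bool) : Prop :=
  Nonempty (TM2ComputableInPolyTime i (fun l : List Bool => l) o)

/-- The computation sees its result only through the code, so the problem becomes one about strings.
-/
theorem nonempty_tm2ComputableInPolyTime_iff {α β : Type} (ea : α → List Bool)
    (eb : β → List Bool) (f : α → β) :
    Nonempty (TM2ComputableInPolyTime ea eb f) ↔ PolyTime ea fun a => eb (f a) :=
  ⟨fun ⟨h⟩ => ⟨⟨h.toTM2ComputableAux, h.time, h.outputsFun⟩⟩,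
    fun ⟨h⟩ => ⟨⟨h.toTM2ComputableAux, h.time, h.outputsFun⟩⟩⟩

theorem polyTime_of_runs {α : Type} {i o : α → List Bool} {K : Type} [DecidableEq K] [Fintype K]
    {Γ : K → Type} {σ : Type} [Fintype σ] (M : Machine K Γ σ) (v : σ) (a b : K)
    (ea : Γ a ≃ Bool) (eb : Γ b ≃ Bool) (p : Polynomial ℕ)
    (h : ∀ x, M.Runs v (Machine.only a ((i x).map ea.symm)) (Machine.only b ((o x).map eb.symm))
      (p.eval (i x).length)) : PolyTime i o := by
  let _ : Fintype (Γ a) := Fintype.ofEquiv Bool ea.symm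
  refine ⟨⟨⟨M.toFinTM2 v a b, ea, eb⟩, p, fun x => ?_⟩⟩
  have h' : ∃ n ≤ p.eval (i x).length, (flip bind (M.toFinTM2 v a b).step)^[n]
      (some (initList (M.toFinTM2 v a b) ((i x).map ea.symm))) =
      some (haltList (M.toFinTM2 v a b) ((o x).map eb.symm)) := by
    obtain ⟨n, hn, h⟩ := h x
    refine ⟨n, hn, ?_⟩
    rw [initList_eq, haltList_eq]
    exact StepsTo.iterate_iff.2 h
  exact ⟨⟨h'.choose, h'.choose_spec.2⟩, h'.choose_spec.1⟩

theorem PolyTime.exists_machine {α : Type} {i o : α → List Bool} (h : PolyTime i o) :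
    ∃ (K : Type) (_ : DecidableEq K) (_ : Fintype K) (Γ : K → Type) (σ : Type) (_ : Fintype σ)
      (M : Machine K Γ σ) (v : σ) (a b : K) (ea : Γ a ≃ Bool) (eb : Γ b ≃ Bool)
      (p q : Polynomial ℕ), (∀ x, M.Runs v (Machine.only a ((i x).map ea.symm))
        (Machine.only b ((o x).map eb.symm)) (p.eval (i x).length)) ∧
        ∀ x, (o x).length ≤ q.eval (i x).length := by
  obtain ⟨h⟩ := h
  have hr : ∀ x, (Machine.ofFinTM2 h.tm).Runs h.tm.initialState
      (Machine.only h.tm.k₀ ((i x).map h.inputAlphabet.symm))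
      (Machine.only h.tm.k₁ ((o x).map h.outputAlphabet.symm)) (h.time.eval (i x).length) := by
    intro x
    obtain ⟨⟨n, hx⟩, hn⟩ := h.outputsFun x
    refine ⟨n, hn, ?_⟩
    rw [initList_eq] at hx
    simp only [Option.map_some, haltList_eq] at hx
    exact StepsTo.iterate_iff.1 hx
  refine ⟨h.tm.K, h.tm.kDecidableEq, h.tm.kFin, h.tm.Γ, h.tm.σ, h.tm.σFin, Machine.ofFinTM2 h.tm,
    h.tm.initialState, h.tm.k₀, h.tm.k₁, h.inputAlphabet, h.outputAlphabet, h.time,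
    Polynomial.X + Polynomial.C ((@Finset.univ _ h.tm.ΛFin).sum fun l =>
      Machine.pushCount (h.tm.m l)) * h.time, hr, fun x => ?_⟩
  have := (hr x).output_length_le
  rw [List.length_map, List.length_map] at this
  rw [Polynomial.eval_add, Polynomial.eval_X, Polynomial.eval_mul, Polynomial.eval_C]
  exact this

/-! ### Composition and concatenation of polynomial-time functions -/

namespace Machine

section

variable {K : Type} [DecidableEq K] {Γ : K → Type} {σ : Type}

theorem only_nil (k : K) : (only k [] : ∀ k, List (Γ k)) = fun _ => [] :=
  Function.update_eq_self (f := fun k => ([] : List (Γ k))) k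

theorem update_only (k : K) (l l' : List (Γ k)) :
    Function.update (only k l) k l' = only k l' := Function.update_idem _ _ _

theorem Runs.of_eq {M : Machine K Γ σ} {v : σ} {S S' A A' : ∀ k, List (Γ k)} {t : ℕ}
    (h : M.Runs v A A' t) (hS : S = A) (hS' : S' = A') : M.Runs v S S' t := by
  rwa [hS, hS']

theorem update_nil (k : K) (l : List (Γ k)) :
    Function.update (fun k => ([] : List (Γ k))) k l = only k l := rfl

/-- Moves the contents of the stack `a` to the stacks `b` and `c`, in reverse order. -/
def duplicate (a b c : K) (φ : Γ a → Bool) (ψ : Bool → Γ b) (χ : Bool → Γ c) :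
    Machine K Γ (σ × Option Bool) where
  Λ := Unit
  main := ()
  code _ := .pop a (fun v x => (v.1, x.map φ))
    (.branch (fun v => v.2.isNone) .halt
      (.push b (fun v => ψ (v.2.getD false)) (.push c (fun v => χ (v.2.getD false))
        (.load (fun v => (v.1, none)) (.goto fun _ => ())))))

theorem runs_duplicate {a b c : K} (hab : a ≠ b) (hac : a ≠ c) (hbc : b ≠ c) (φ : Γ a → Bool)
    (ψ : Bool → Γ b) (χ : Bool → Γ c) (v : σ) (l : List (Γ a)) :
    ∀ S : ∀ k, List (Γ k), S a = l →
    (duplicate a b c φ ψ χ).Runs (v, none) S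
      (Function.update (Function.update (Function.update S a []) b
        ((l.map fun x => ψ (φ x)).reverse ++ S b)) c ((l.map fun x => χ (φ x)).reverse ++ S c))
      (l.length + 1) := by
  induction l with
  | nil =>
    intro S hS
    refine ⟨1, by simp, .single ?_⟩
    have h1 : Function.update S a [] = S := by rw [← hS, Function.update_eq_self]
    simp [duplicate, hS, h1]
  | cons x l ih =>
    intro S hS
    set S' := Function.update (Function.update (Function.update S a l) b (ψ (φ x) :: S b)) c
      (χ (φ x) :: S c) with hS'
    have hSa : S' a = l := by simp [hS', Function.update_of_ne hab, Function.update_of_ne hac]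
    obtain ⟨n, hn, h⟩ := ih S' hSa
    have h1 : Function.update (Function.update (Function.update S' a []) b
        ((l.map fun x => ψ (φ x)).reverse ++ S' b)) c
        ((l.map fun x => χ (φ x)).reverse ++ S' c) =
        Function.update (Function.update (Function.update S a []) b
        (((x :: l).map fun x => ψ (φ x)).reverse ++ S b)) c
        (((x :: l).map fun x => χ (φ x)).reverse ++ S c) := by
      have hb : S' b = ψ (φ x) :: S b := by simp [hS', Function.update_of_ne hbc]
      have hc : S' c = χ (φ x) :: S c := by simp [hS']
      rw [hb, hc, hS', Function.update_comm hac.symm, Function.update_comm hab.symm,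
        Function.update_idem, Function.update_comm hbc.symm, Function.update_idem,
        Function.update_idem]
      simp
    rw [h1] at h
    refine ⟨n + 1, by simpa using hn, .head ?_ h⟩
    simp [duplicate, hS, hS', Function.update_of_ne hab.symm, Function.update_of_ne hac.symm,
      Function.update_of_ne hbc.symm]

end

variable {K₁ K₂ : Type} {Γ₁ : K₁ → Type} {Γ₂ : K₂ → Type}

theorem join_nil : (join (fun _ => []) fun _ => [] : ∀ k, List (SumFam Γ₁ Γ₂ k)) = fun _ => [] := by
  funext k
  rcases k with k | k <;> rfl

theorem join_inl (A : ∀ k, List (Γ₁ k)) (B : ∀ k, List (Γ₂ k)) (k : K₁) :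
    join A B (.inl k) = A k := rfl

theorem join_inr (A : ∀ k, List (Γ₁ k)) (B : ∀ k, List (Γ₂ k)) (k : K₂) :
    join A B (.inr k) = B k := rfl

variable [DecidableEq K₁] [DecidableEq K₂]

theorem only_inl (k : K₁) (l : List (Γ₁ k)) :
    (only (.inl k) l : ∀ k, List (SumFam Γ₁ Γ₂ k)) = join (only k l) fun _ => [] := by
  rw [← update_nil, ← update_nil, ← update_join_inl, join_nil]

theorem only_inr (k : K₂) (l : List (Γ₂ k)) :
    (only (.inr k) l : ∀ k, List (SumFam Γ₁ Γ₂ k)) = join (fun _ => []) (only k l) := by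
  rw [← update_nil, ← update_nil, ← update_join_inr, join_nil]

variable {K₃ : Type} [DecidableEq K₃] {Γ₃ : K₃ → Type}

theorem only_inl_inl (k : K₁) (l : List (Γ₁ k)) :
    (only (.inl (.inl k)) l : ∀ k, List (SumFam (SumFam Γ₁ Γ₂) Γ₃ k)) =
      join (join (only k l) fun _ => []) fun _ => [] :=
  (only_inl (Γ₁ := SumFam Γ₁ Γ₂) (Sum.inl k) l).trans
    (congrArg (fun s => join s fun _ => []) (only_inl k l))

theorem only_inl_inr (k : K₂) (l : List (Γ₂ k)) :
    (only (.inl (.inr k)) l : ∀ k, List (SumFam (SumFam Γ₁ Γ₂) Γ₃ k)) =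
      join (join (fun _ => []) (only k l)) fun _ => [] :=
  (only_inl (Γ₁ := SumFam Γ₁ Γ₂) (Sum.inr k) l).trans
    (congrArg (fun s => join s fun _ => []) (only_inr k l))

end Machine

theorem eval_mono_nat (p : Polynomial ℕ) {a b : ℕ} (h : a ≤ b) : p.eval a ≤ p.eval b := by
  rw [Polynomial.eval_eq_sum_range, Polynomial.eval_eq_sum_range]
  exact Finset.sum_le_sum fun i _ => Nat.mul_le_mul_left _ (Nat.pow_le_pow_left h i)

-- Both machines run side by side on separate stacks. The intermediate string passes through an
-- extra stack of bits, so that two reversals cancel and the alphabets are translated.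
open Machine in
theorem PolyTime.comp {α β : Type} {i o : α → List Bool} {i' o' : β → List Bool}
    (h : PolyTime i o) (h' : PolyTime i' o') (g : α → β) (hg : ∀ a, i' (g a) = o a) :
    PolyTime i fun a => o' (g a) := by
  obtain ⟨K₁, _, _, Γ₁, σ₁, _, M₁, v₁, a₁, b₁, ea₁, eb₁, p₁, q₁, h₁, hq₁⟩ := h.exists_machine
  obtain ⟨K₂, _, _, Γ₂, σ₂, _, M₂, v₂, a₂, b₂, ea₂, eb₂, p₂, q₂, h₂, hq₂⟩ := h'.exists_machine
  let L₁ := (M₁.liftL Γ₂ σ₂).liftL (fun _ : Unit => Bool) (Option Bool)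
  let L₂ := (M₂.liftR Γ₁ σ₁).liftL (fun _ : Unit => Bool) (Option Bool)
  let T₁ : Machine ((K₁ ⊕ K₂) ⊕ Unit) (SumFam (SumFam Γ₁ Γ₂) fun _ => Bool)
      ((σ₁ × σ₂) × Option Bool) := transfer (.inl (.inl b₁)) (.inr ()) eb₁ id
  let T₂ : Machine ((K₁ ⊕ K₂) ⊕ Unit) (SumFam (SumFam Γ₁ Γ₂) fun _ => Bool)
      ((σ₁ × σ₂) × Option Bool) := transfer (.inr ()) (.inl (.inr a₂)) id ea₂.symm
  -- The polynomial `q₁` bounds the length of the intermediate string, hence both transfers and the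
  -- argument of `p₂`.
  refine polyTime_of_runs (L₁.seq (T₁.seq (T₂.seq L₂))) ((v₁, v₂), none) (.inl (.inl a₁))
    (.inl (.inr b₂)) ea₁ eb₂ (p₁ + (q₁ + 1 + (q₁ + 1 + p₂.comp q₁))) fun x => ?_
  have hlen := hq₁ x
  have r₁ := ((h₁ x).liftL v₂ (fun k : K₂ => ([] : List (Γ₂ k)))).liftL (none : Option Bool)
    (fun _ : Unit => ([] : List Bool))
  have r₂ := ((h₂ (g x)).liftR v₁ (fun k : K₁ => ([] : List (Γ₁ k)))).liftL (none : Option Bool)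
    (fun _ : Unit => ([] : List Bool))
  have t₁ := runs_transfer (Γ := SumFam (SumFam Γ₁ Γ₂) fun _ : Unit => Bool)
    (a := .inl (.inl b₁)) (b := .inr ()) (by simp) eb₁ id (v₁, v₂) _
    (join (join (only b₁ ((o x).map eb₁.symm)) fun k : K₂ => ([] : List (Γ₂ k)))
      fun _ : Unit => ([] : List Bool)) rfl
  have t₂ := runs_transfer (Γ := SumFam (SumFam Γ₁ Γ₂) fun _ : Unit => Bool)
    (a := .inr ()) (b := .inl (.inr a₂)) (by simp) id ea₂.symm (v₁, v₂) _
    (join (join (fun k : K₁ => ([] : List (Γ₁ k))) fun k : K₂ => ([] : List (Γ₂ k)))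
      (only (Γ := fun _ : Unit => Bool) () (o x).reverse)) rfl
  simp only [update_join_inl, update_join_inr, join_inl, join_inr, only_self, update_only,
    only_nil, update_nil, List.map_map, List.append_nil, List.length_map, id_eq,
    List.map_reverse, List.reverse_reverse, List.length_reverse] at t₁ t₂
  have e₁ : List.map ((fun x => eb₁ x) ∘ eb₁.symm) (o x) = o x := by
    simp [Function.comp_def]
  rw [e₁] at t₁
  rw [hg] at r₂
  refine Runs.of_eq ?_ (only_inl_inl _ _) (only_inl_inr _ _)
  refine (r₁.seq ((t₁.mono ?_).seq ((t₂.mono ?_).seq (r₂.mono ?_)))).mono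
    (t' := _) (le_of_eq ?_) (t := p₁.eval (i x).length + ((q₁.eval (i x).length + 1) +
      ((q₁.eval (i x).length + 1) + p₂.eval (q₁.eval (i x).length))))
  · omega
  · omega
  · exact eval_mono_nat _ hlen
  · simp

namespace Machine

/-- Contents of four stacks. -/
def four (a b c d : List Bool) : Fin 4 → List Bool
  | 0 => a
  | 1 => b
  | 2 => c
  | 3 => d

variable (a b c d l : List Bool)

theorem four_nil : four [] [] [] [] = fun _ => [] := by funext k; fin_cases k <;> rfl
theorem update_four_zero : Function.update (four a b c d) 0 l = four l b c d := by
  funext k; fin_cases k <;> rfl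
theorem update_four_one : Function.update (four a b c d) 1 l = four a l c d := by
  funext k; fin_cases k <;> rfl
theorem update_four_two : Function.update (four a b c d) 2 l = four a b l d := by
  funext k; fin_cases k <;> rfl
theorem update_four_three : Function.update (four a b c d) 3 l = four a b c l := by
  funext k; fin_cases k <;> rfl

theorem only_four_zero : only (Γ := fun _ => Bool) 0 l = four l [] [] [] := by
  rw [← update_nil, ← four_nil]
  exact update_four_zero ..

theorem only_four_three : only (Γ := fun _ => Bool) 3 l = four [] [] [] l := by
  rw [← update_nil, ← four_nil]
  exact update_four_three ..

end Machine

-- The input is duplicated, both machines run on their own stacks, and the second output is pushed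
-- to the result before the first, which therefore ends up on top.
open Machine in
theorem PolyTime.append {α : Type} {i o o' : α → List Bool}
    (h : PolyTime i o) (h' : PolyTime i o') : PolyTime i fun a => o a ++ o' a := by
  obtain ⟨K₁, _, _, Γ₁, σ₁, _, M₁, v₁, a₁, b₁, ea₁, eb₁, p₁, q₁, h₁, hq₁⟩ := h.exists_machine
  obtain ⟨K₂, _, _, Γ₂, σ₂, _, M₂, v₂, a₂, b₂, ea₂, eb₂, p₂, q₂, h₂, hq₂⟩ := h'.exists_machine
  let Γ := SumFam (SumFam Γ₁ Γ₂) fun _ : Fin 4 => Bool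
  let σ := (σ₁ × σ₂) × Option Bool
  let L₁ := (M₁.liftL Γ₂ σ₂).liftL (fun _ : Fin 4 => Bool) (Option Bool)
  let L₂ := (M₂.liftR Γ₁ σ₁).liftL (fun _ : Fin 4 => Bool) (Option Bool)
  let D : Machine ((K₁ ⊕ K₂) ⊕ Fin 4) Γ σ := duplicate (.inr 0) (.inr 1) (.inr 2) id id id
  let T₁ : Machine ((K₁ ⊕ K₂) ⊕ Fin 4) Γ σ := transfer (.inr 1) (.inl (.inl a₁)) id ea₁.symm
  let T₂ : Machine ((K₁ ⊕ K₂) ⊕ Fin 4) Γ σ := transfer (.inr 2) (.inl (.inr a₂)) id ea₂.symm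
  let R₁ : Machine ((K₁ ⊕ K₂) ⊕ Fin 4) Γ σ := transfer (.inl (.inl b₁)) (.inr 1) eb₁ id
  let R₂ : Machine ((K₁ ⊕ K₂) ⊕ Fin 4) Γ σ := transfer (.inl (.inr b₂)) (.inr 2) eb₂ id
  let O₂ : Machine ((K₁ ⊕ K₂) ⊕ Fin 4) Γ σ := transfer (.inr 2) (.inr 3) id id
  let O₁ : Machine ((K₁ ⊕ K₂) ⊕ Fin 4) Γ σ := transfer (.inr 1) (.inr 3) id id
  refine polyTime_of_runs
    (D.seq (T₁.seq (T₂.seq (L₁.seq (L₂.seq (R₁.seq (R₂.seq (O₂.seq O₁))))))))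
    ((v₁, v₂), none) (.inr 0) (.inr 3) (Equiv.refl Bool) (Equiv.refl Bool)
    ((.X + 1) + ((.X + 1) + ((.X + 1) + (p₁ + (p₂ + ((q₁ + 1) + ((q₂ + 1) +
      ((q₂ + 1) + (q₁ + 1))))))))) fun x => ?_
  have e₁ : List.map ((fun x => eb₁ x) ∘ eb₁.symm) (o x) = o x := by
    simp [Function.comp_def]
  have e₂ : List.map ((fun x => eb₂ x) ∘ eb₂.symm) (o' x) = o' x := by
    simp [Function.comp_def]
  let N₁ : ∀ k, List (Γ₁ k) := fun _ => []
  let N₂ : ∀ k, List (Γ₂ k) := fun _ => []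
  have d := runs_duplicate (Γ := Γ) (a := .inr 0) (b := .inr 1) (c := .inr 2) (by simp)
    (by simp) (by simp) id id id (v₁, v₂) (i x) (join (join N₁ N₂) (four (i x) [] [] [])) rfl
  have t₁ := runs_transfer (Γ := Γ) (a := .inr 1) (b := .inl (.inl a₁)) (by simp) id ea₁.symm
    (v₁, v₂) (i x).reverse (join (join N₁ N₂) (four [] (i x).reverse (i x).reverse [])) rfl
  have t₂ := runs_transfer (Γ := Γ) (a := .inr 2) (b := .inl (.inr a₂)) (by simp) id ea₂.symm
    (v₁, v₂) (i x).reverse (join (join (only a₁ ((i x).map ea₁.symm)) N₂)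
      (four [] [] (i x).reverse [])) rfl
  have l₁ := ((h₁ x).liftL v₂ (only a₂ ((i x).map ea₂.symm))).liftL (none : Option Bool)
    (four [] [] [] [])
  have l₂ := ((h₂ x).liftR v₁ (only b₁ ((o x).map eb₁.symm))).liftL (none : Option Bool)
    (four [] [] [] [])
  have r₁ := runs_transfer (Γ := Γ) (a := .inl (.inl b₁)) (b := .inr 1) (by simp) eb₁ id
    (v₁, v₂) _ (join (join (only b₁ ((o x).map eb₁.symm)) (only b₂ ((o' x).map eb₂.symm)))
      (four [] [] [] [])) rfl
  have r₂ := runs_transfer (Γ := Γ) (a := .inl (.inr b₂)) (b := .inr 2) (by simp) eb₂ id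
    (v₁, v₂) _ (join (join N₁ (only b₂ ((o' x).map eb₂.symm)))
      (four [] (o x).reverse [] [])) rfl
  have u₂ := runs_transfer (Γ := Γ) (a := .inr 2) (b := .inr 3) (by simp) id id
    (v₁, v₂) (o' x).reverse (join (join N₁ N₂) (four [] (o x).reverse (o' x).reverse [])) rfl
  have u₁ := runs_transfer (Γ := Γ) (a := .inr 1) (b := .inr 3) (by simp) id id
    (v₁, v₂) (o x).reverse (join (join N₁ N₂) (four [] (o x).reverse [] (o' x))) rfl
  simp only [update_join_inl, update_join_inr, join_inl, join_inr, only_self, update_only,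
    only_nil, update_nil, List.map_map, List.append_nil, List.length_map, id_eq, N₁, N₂,
    List.map_reverse, List.reverse_reverse, List.length_reverse, update_four_zero,
    update_four_one, update_four_two, update_four_three] at d t₁ t₂ l₁ l₂ r₁ r₂ u₁ u₂
  rw [e₁] at r₁
  rw [e₂] at r₂
  simp only [List.map_id', four, List.append_nil] at d r₁ r₂ u₁ u₂
  have hp := hq₁ x
  have hp' := hq₂ x
  refine Runs.of_eq ?_ ((only_inr 0 _).trans (congr_arg₂ join join_nil.symm ?_))
    ((only_inr 3 _).trans (congr_arg₂ join join_nil.symm ?_)) (A := join _ (four (i x) [] [] []))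
    (A' := join _ (four [] [] [] (o x ++ o' x)))
  · refine (d.seq (t₁.seq (t₂.seq (l₁.seq (l₂.seq (r₁.seq (r₂.seq (u₂.seq u₁)))))))).mono ?_
    simp only [Polynomial.eval_add, Polynomial.eval_X, Polynomial.eval_one]
    omega
  · exact (only_four_zero _).trans (congrArg (four · [] [] []) (List.map_id _))
  · exact (only_four_three _).trans (congrArg (four [] [] [] ·) (List.map_id _))

namespace Machine

/-! #### Control flow -/

section

variable {K : Type} [DecidableEq K]

/-- Programs on stacks of bits. -/
abbrev BitMachine (K : Type) := Machine K (fun _ => Bool) (Unit × Option Bool)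

/-- Repeats `M` as long as the top of the stack `k` satisfies `c`. -/
def loop (c : Option Bool → Bool) (k : K) (M : BitMachine K) : BitMachine K where
  Λ := Option M.Λ
  fin := @instFintypeOption _ M.fin
  main := none
  code
    | none => .peek k (fun _ x => ((), x)) (.branch (fun v => c v.2)
        (.load (fun _ => ((), none)) (.goto fun _ => some M.main))
        (.load (fun _ => ((), none)) .halt))
    | some l => relabel some (some none) (M.code l)

theorem runs_loop_stop {c : Option Bool → Bool} {k : K} (M : BitMachine K) {S : K → List Bool}
    (h : c (S k).head? = false) : (loop c k M).Runs ((), none) S S 1 :=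
  ⟨1, le_rfl, .single (by simp [loop, h])⟩

theorem runs_loop_step {c : Option Bool → Bool} {k : K} {M : BitMachine K}
    {S S' S'' : K → List Bool} {t t' : ℕ} (hc : c (S k).head? = true)
    (h : M.Runs ((), none) S S' t) (h' : (loop c k M).Runs ((), none) S' S'' t') :
    (loop c k M).Runs ((), none) S S'' (t + 1 + t') := by
  obtain ⟨n, hn, h⟩ := h.stepsTo_relabel (m' := (loop c k M).code) (f := some)
    (ex := some none) (fun _ => rfl)
  obtain ⟨n', hn', h'⟩ := h'
  refine ⟨n + n' + 1, by omega, .head ?_ (h.trans h')⟩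
  simp [loop, hc]

/-- Runs `M` or `N`, depending on the top of the stack `k`. -/
def cond (c : Option Bool → Bool) (k : K) (M N : BitMachine K) : BitMachine K where
  Λ := Option (M.Λ ⊕ N.Λ)
  fin := @instFintypeOption _ (@instFintypeSum _ _ M.fin N.fin)
  main := none
  code
    | none => .peek k (fun _ x => ((), x)) (.branch (fun v => c v.2)
        (.load (fun _ => ((), none)) (.goto fun _ => some (.inl M.main)))
        (.load (fun _ => ((), none)) (.goto fun _ => some (.inr N.main))))
    | some (.inl l) => relabel (fun l => some (.inl l)) none (M.code l)
    | some (.inr l) => relabel (fun l => some (.inr l)) none (N.code l)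

theorem runs_cond_true {c : Option Bool → Bool} {k : K} {M N : BitMachine K}
    {S S' : K → List Bool} {t : ℕ} (hc : c (S k).head? = true)
    (h : M.Runs ((), none) S S' t) : (cond c k M N).Runs ((), none) S S' (t + 1) := by
  obtain ⟨n, hn, h⟩ := h.stepsTo_relabel (m' := (cond c k M N).code)
    (f := fun l => some (.inl l)) (ex := none) (fun _ => rfl)
  refine ⟨n + 1, by omega, .head ?_ h⟩
  simp [cond, hc]

theorem runs_cond_false {c : Option Bool → Bool} {k : K} {M N : BitMachine K}
    {S S' : K → List Bool} {t : ℕ} (hc : c (S k).head? = false)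
    (h : N.Runs ((), none) S S' t) : (cond c k M N).Runs ((), none) S S' (t + 1) := by
  obtain ⟨n, hn, h⟩ := h.stepsTo_relabel (m' := (cond c k M N).code)
    (f := fun l => some (.inr l)) (ex := none) (fun _ => rfl)
  refine ⟨n + 1, by omega, .head ?_ h⟩
  simp [cond, hc]

/-- Pushes a bit. -/
def push (k : K) (b : Bool) : BitMachine K := op (.push k (fun _ => b) .halt)

theorem runs_push (k : K) (b : Bool) (S : K → List Bool) :
    (push k b).Runs ((), none) S (Function.update S k (b :: S k)) 1 := runs_op rfl

/-- Pops a bit. -/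
def drop (k : K) : BitMachine K := op (.pop k (fun v _ => v) .halt)

theorem runs_drop (k : K) (S : K → List Bool) :
    (drop k).Runs ((), none) S (Function.update S k (S k).tail) 1 := runs_op rfl

/-- Empties a stack. -/
def drain (k : K) : BitMachine K := loop Option.isSome k (drop k)

theorem runs_drain (k : K) (l : List Bool) : ∀ S : K → List Bool, S k = l →
    (drain k).Runs ((), none) S (Function.update S k []) (2 * l.length + 1) := by
  induction l with
  | nil =>
    intro S h
    rw [← h, Function.update_eq_self]
    exact (runs_loop_stop (c := Option.isSome) _ (S := S) (by rw [h]; rfl)).mono (by simp)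
  | cons b l ih =>
    intro S h
    have h1 := ih (Function.update S k l) (Function.update_self _ _ _)
    rw [Function.update_idem] at h1
    refine (runs_loop_step (c := Option.isSome) (S := S) (by rw [h]; rfl) ?_ h1).mono (t := 1 + 1 + (2 * l.length + 1))
      (by simp; omega)
    simpa [h] using runs_drop k S

end

/-! #### Programs with unary registers -/

/-- Programs with an input stack, an auxiliary stack, an output stack and `A` unary registers. -/
abbrev Prog (A : ℕ) := BitMachine (Fin 3 ⊕ Fin A)

variable {A : ℕ}

/-- Contents of the stacks of a program. -/
def contents (i t o : List Bool) (R : Fin A → ℕ) : Fin 3 ⊕ Fin A → List Bool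
  | .inl 0 => i
  | .inl 1 => t
  | .inl 2 => o
  | .inr j => List.replicate (R j) true

section

variable (i t o l : List Bool) (R : Fin A → ℕ)

theorem update_contents_input :
    Function.update (contents i t o R) (.inl 0) l = contents l t o R := by
  funext k; rcases k with k | k
  · fin_cases k <;> rfl
  · rfl

theorem update_contents_aux :
    Function.update (contents i t o R) (.inl 1) l = contents i l o R := by
  funext k; rcases k with k | k
  · fin_cases k <;> rfl
  · rfl

theorem update_contents_output :
    Function.update (contents i t o R) (.inl 2) l = contents i t l R := by
  funext k; rcases k with k | k
  · fin_cases k <;> rfl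
  · rfl

theorem update_contents_reg (j : Fin A) (n : ℕ) :
    Function.update (contents i t o R) (.inr j) (List.replicate n true) =
      contents i t o (Function.update R j n) := by
  funext k; rcases k with k | k
  · fin_cases k <;> rfl
  · by_cases h : k = j
    · subst h; simp [contents]
    · simp [contents, h]

end

/-- The program `P` takes the input stack, output stack and registers `i`, `o`, `R` to `i'`,
`o'`, `R'` within `t` steps. -/
def Does (P : Prog A) (i o : List Bool) (R : Fin A → ℕ) (i' o' : List Bool) (R' : Fin A → ℕ)
    (t : ℕ) : Prop := P.Runs ((), none) (contents i [] o R) (contents i' [] o' R') t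

theorem does_putBit (b : Bool) (i o : List Bool) (R : Fin A → ℕ) :
    Does (push (.inl 2) b) i o R i (b :: o) R 1 := by
  have := runs_push (.inl 2) b (contents i [] o R)
  rwa [update_contents_output] at this

theorem does_inc (j : Fin A) (i o : List Bool) (R : Fin A → ℕ) :
    Does (push (.inr j) true) i o R i o (Function.update R j (R j + 1)) 1 := by
  have := runs_push (.inr j) true (contents i [] o R)
  rwa [show true :: contents i [] o R (.inr j) = List.replicate (R j + 1) true from rfl,
    update_contents_reg] at this

theorem does_dec (j : Fin A) (i o : List Bool) (R : Fin A → ℕ) :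
    Does (drop (.inr j)) i o R i o (Function.update R j (R j - 1)) 1 := by
  have := runs_drop (.inr j) (contents i [] o R)
  rwa [show (contents i [] o R (.inr j)).tail = List.replicate (R j - 1) true from
    List.tail_replicate, update_contents_reg] at this

theorem does_drop (b : Bool) (i o : List Bool) (R : Fin A → ℕ) :
    Does (drop (.inl 0)) (b :: i) o R i o R 1 := by
  have := runs_drop (.inl 0) (contents (b :: i) [] o R)
  rwa [update_contents_input] at this

theorem does_clearInput (i o : List Bool) (R : Fin A → ℕ) :
    Does (drain (.inl 0)) i o R [] o R (2 * i.length + 1) := by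
  have := runs_drain (.inl 0) i (contents i [] o R) rfl
  rwa [update_contents_input] at this

theorem does_clear (j : Fin A) (i o : List Bool) (R : Fin A → ℕ) :
    Does (drain (.inr j)) i o R i o (Function.update R j 0) (2 * R j + 1) := by
  have := runs_drain (.inr j) (List.replicate (R j) true) (contents i [] o R) rfl
  rwa [List.length_replicate, show ([] : List Bool) = List.replicate 0 true from rfl,
    show contents i (List.replicate 0 true) o R = contents i [] o R from rfl,
    update_contents_reg] at this

/-- Writes the contents of a register. -/
def putReg (j : Fin A) : Prog A :=
  (duplicate (.inr j) (.inl 1) (.inl 2) id id id).seq (transfer (.inl 1) (.inr j) id id)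

/-- Reading a register destroys it; the copy made on the auxiliary stack is moved back. -/
theorem does_putReg (j : Fin A) (i o : List Bool) (R : Fin A → ℕ) :
    Does (putReg j) i o R i (List.replicate (R j) true ++ o) R (2 * R j + 2) := by
  have h₁ := runs_duplicate (Γ := fun _ => Bool) (a := (.inr j : Fin 3 ⊕ Fin A)) (b := .inl 1)
    (c := .inl 2) (by simp) (by simp) (by simp) id id id () (List.replicate (R j) true)
    (contents i [] o R) rfl
  have h₂ := runs_transfer (Γ := fun _ => Bool) (a := (.inl 1 : Fin 3 ⊕ Fin A)) (b := .inr j)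
    (by simp) id id () (List.replicate (R j) true)
    (contents i (List.replicate (R j) true) (List.replicate (R j) true ++ o)
      (Function.update R j 0)) rfl
  have e₁ : Function.update (contents i [] o R) (.inr j) [] =
      contents i [] o (Function.update R j 0) := update_contents_reg _ _ _ _ _ 0
  have e₂ : contents i [] (List.replicate (R j) true ++ o) (Function.update R j 0) (.inr j) = [] := by
    simp [contents]
  have e₃ : contents i (List.replicate (R j) true) (List.replicate (R j) true ++ o)
    (Function.update R j 0) (.inr j) = [] := by
    simp [contents]
  simp only [e₁, e₃, update_contents_aux, update_contents_output, id_eq, List.map_id',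
    List.reverse_replicate, List.length_replicate, List.append_nil, update_contents_reg,
    Function.update_idem, Function.update_eq_self] at h₁ h₂
  have e₄ : contents i [] o R (.inl 1) = [] := rfl
  have e₅ : contents i [] o R (.inl 2) = o := rfl
  rw [e₄, e₅, List.append_nil] at h₁
  exact (h₁.seq h₂).mono (by omega)

theorem Does.seq {P P' : Prog A} {i o i' o' i'' o'' : List Bool} {R R' R'' : Fin A → ℕ}
    {t t' : ℕ} (h : Does P i o R i' o' R' t) (h' : Does P' i' o' R' i'' o'' R'' t') :
    Does (Machine.seq P P') i o R i'' o'' R'' (t + t') := Runs.seq h h'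

theorem Does.mono {P : Prog A} {i o i' o' : List Bool} {R R' : Fin A → ℕ}
    {t t' : ℕ} (h : Does P i o R i' o' R' t) (ht : t ≤ t') : Does P i o R i' o' R' t' :=
  Runs.mono h ht

theorem does_skip (i o : List Bool) (R : Fin A → ℕ) : Does skip i o R i o R 1 := runs_skip _ _

/-- Reads a unary number. -/
def read (j : Fin A) : Prog A :=
  (loop (· == some true) (.inl 0) ((drop (.inl 0)).seq (push (.inr j) true))).seq (drop (.inl 0))

theorem does_read (j : Fin A) (n : ℕ) (i o : List Bool) (R : Fin A → ℕ) :
    Does (read j) (unaryCode n ++ i) o R i o (Function.update R j (R j + n)) (3 * n + 2) := by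
  -- The loop only inspects the terminating `0`; the final `drop` removes it.
  have h : ∀ R : Fin A → ℕ, Does (loop (· == some true) (.inl 0)
      ((drop (.inl 0)).seq (push (.inr j) true))) (unaryCode n ++ i) o R (false :: i) o
      (Function.update R j (R j + n)) (3 * n + 1) := by
    induction n with
    | zero =>
      intro R
      rw [add_zero, Function.update_eq_self]
      exact runs_loop_stop _ rfl
    | succ n ih =>
      intro R
      have h := ih (Function.update R j (R j + 1))
      rw [Function.update_self, Function.update_idem, add_right_comm, add_assoc] at h
      exact Does.mono (runs_loop_step (t := 1 + 1) rfl ((does_drop true _ o R).seq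
        (does_inc j _ o R)) h) (by omega)
  exact ((h R).seq (does_drop false i o _)).mono (by omega)

/-! #### Writing -/

/-- The string described by a sequence of bits and registers. -/
def tokenString (R : Fin A → ℕ) (T : List (Bool ⊕ Fin A)) : List Bool :=
  T.flatMap (Sum.elim (fun b => [b]) fun j => List.replicate (R j) true)

/-- Writes a sequence of bits and registers. -/
def write : List (Bool ⊕ Fin A) → Prog A
  | [] => skip
  | .inl b :: T => (push (.inl 2) b).seq (write T)
  | .inr j :: T => (putReg j).seq (write T)

/-- Since the output is a stack, everything appears in reverse order; `PolyTime.reverse` corrects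
this once at the end. -/
theorem does_write (i : List Bool) {R : Fin A → ℕ} {N : ℕ} (hR : ∀ j, R j ≤ N)
    (T : List (Bool ⊕ Fin A)) : ∀ o : List Bool,
    Does (write T) i o R i ((tokenString R T).reverse ++ o) R (T.length * (2 * N + 2) + 1) := by
  induction T with
  | nil => exact fun o => (does_skip i o R).mono (by simp)
  | cons x T ih =>
    intro o
    rcases x with b | j
    · have := (does_putBit b i o R).seq (ih (b :: o))
      simp only [tokenString, List.flatMap_cons, Sum.elim_inl, List.reverse_append,
        List.append_assoc] at this ⊢
      refine this.mono ?_
      rw [List.length_cons, Nat.add_mul T.length 1]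
      omega
    · have := (does_putReg j i o R).seq (ih _)
      simp only [tokenString, List.flatMap_cons, Sum.elim_inr, List.reverse_append,
        List.append_assoc, List.reverse_replicate] at this ⊢
      refine this.mono ?_
      have := hR j
      rw [List.length_cons, Nat.add_mul T.length 1]
      omega

/-- Clears a list of registers. -/
def clearList : List (Fin A) → Prog A
  | [] => skip
  | j :: L => (drain (.inr j)).seq (clearList L)

theorem does_clearList (i o : List Bool) {N : ℕ} (L : List (Fin A)) : ∀ R : Fin A → ℕ,
    (∀ j, R j ≤ N) → Does (clearList L) i o R i o (fun j => if j ∈ L then 0 else R j)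
      (L.length * (2 * N + 1) + 1) := by
  induction L with
  | nil => exact fun R _ => (does_skip i o _).mono (by simp)
  | cons a L ih =>
    intro R hR
    have h := ih (Function.update R a 0) fun j => by
      by_cases hj : j = a
      · subst hj; simp
      · rw [Function.update_of_ne hj]; exact hR j
    have e : (fun j => if j ∈ L then 0 else Function.update R a 0 j) =
        fun j => if j ∈ a :: L then 0 else R j := by
      funext j
      by_cases hj : j = a
      · subst hj; simp
      · simp [hj]
    rw [e] at h
    refine ((does_clear a i o R).seq h).mono ?_
    have := hR a
    rw [List.length_cons, Nat.add_mul L.length 1]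
    omega

/-- Clears all registers. -/
def clearAll (A : ℕ) : Prog A := clearList (List.finRange A)

theorem does_clearAll (i o : List Bool) {N : ℕ} {R : Fin A → ℕ} (hR : ∀ j, R j ≤ N) :
    Does (clearAll A) i o R i o 0 (A * (2 * N + 1) + 1) := by
  have h := does_clearList i o (List.finRange A) R hR
  simp only [List.mem_finRange, if_true, List.length_finRange] at h
  exact h

/-- Reads unary numbers into a list of registers. -/
def readList : List (Fin A) → Prog A
  | [] => skip
  | j :: L => (read j).seq (readList L)

theorem does_readList (i o : List Bool) {N : ℕ} {V : Fin A → ℕ} (hV : ∀ j, V j ≤ N)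
    (L : List (Fin A)) (hL : L.Nodup) : ∀ R : Fin A → ℕ, (∀ j ∈ L, R j = 0) →
    Does (readList L) ((L.map fun j => unaryCode (V j)).flatten ++ i) o R i o
      (fun j => if j ∈ L then V j else R j) (L.length * (3 * N + 2) + 1) := by
  induction L with
  | nil => exact fun R _ => (does_skip i o _).mono (by simp)
  | cons a L ih =>
    intro R hR
    have ha : a ∉ L := (List.nodup_cons.1 hL).1
    have h := ih (List.nodup_cons.1 hL).2 (Function.update R a (R a + V a)) fun j hj => by
      rw [Function.update_of_ne (fun h : j = a => ha (h ▸ hj))]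
      exact hR j (List.mem_cons_of_mem _ hj)
    have e : (fun j => if j ∈ L then V j else Function.update R a (R a + V a) j) =
        fun j => if j ∈ a :: L then V j else R j := by
      funext j
      by_cases hj : j = a
      · subst hj; simp [hR j, ha]
      · simp [hj]
    rw [e] at h
    rw [List.map_cons, List.flatten_cons, List.append_assoc]
    refine ((does_read a (V a) _ o R).seq h).mono ?_
    have := hV a
    rw [List.length_cons, Nat.add_mul L.length 1]
    omega

/-- Reads a unary number and runs the program in that position of a list. -/
def select : List (Prog A) → Prog A
  | [] => skip
  | P :: L => cond (· == some true) (.inl 0) ((drop (.inl 0)).seq (select L))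
      ((drop (.inl 0)).seq P)

theorem does_select {i o i' o' : List Bool} {R R' : Fin A → ℕ} {t : ℕ} (L : List (Prog A)) :
    ∀ (n : ℕ) (h : n < L.length), Does L[n] i o R i' o' R' t →
    Does (select L) (unaryCode n ++ i) o R i' o' R' (t + 2 * n + 2) := by
  induction L with
  | nil => exact fun n h => absurd h (by simp)
  | cons P L ih =>
    rintro (_ | n) hn h
    · exact Does.mono (runs_cond_false (t := 1 + t) rfl ((does_drop false i o R).seq h))
        (by omega)
    · have h' := ih n (by simpa using hn) (by simpa using h)
      exact Does.mono (runs_cond_true (t := 1 + (t + 2 * n + 2)) rfl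
        ((does_drop true _ o R).seq h')) (by omega)

end Machine

/-! ### From programs to polynomial-time functions; reversal and constants -/

namespace Machine

theorem contents_input {A : ℕ} (l : List Bool) :
    contents l [] [] (0 : Fin A → ℕ) = only (Γ := fun _ => Bool) (.inl 0) l := by
  have h := update_contents_input [] [] [] l (0 : Fin A → ℕ)
  rw [← h, ← update_nil]
  congr 1
  funext k
  rcases k with k | k
  · fin_cases k <;> rfl
  · rfl

theorem contents_output {A : ℕ} (l : List Bool) :
    contents [] [] l (0 : Fin A → ℕ) = only (Γ := fun _ => Bool) (.inl 2) l := by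
  have h := update_contents_output [] [] [] l (0 : Fin A → ℕ)
  rw [← h, ← update_nil]
  congr 1
  funext k
  rcases k with k | k
  · fin_cases k <;> rfl
  · rfl

theorem polyTime_of_does {α : Type} {i o : α → List Bool} {A : ℕ} (P : Prog A) (p : Polynomial ℕ)
    (h : ∀ x, Does P (i x) [] 0 [] (o x) 0 (p.eval (i x).length)) : PolyTime i o := by
  refine polyTime_of_runs P ((), none) (.inl 0) (.inl 2) (Equiv.refl Bool) (Equiv.refl Bool) p
    fun x => Runs.of_eq (h x) ?_ ?_
  · rw [contents_input]
    exact congrArg (only _) (List.map_id _)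
  · rw [contents_output]
    exact congrArg (only _) (List.map_id _)

theorem tokenString_map {A B : ℕ} (R : Fin B → ℕ) (f : Fin A → Fin B) (T : List (Bool ⊕ Fin A)) :
    tokenString R (T.map (Sum.map id f)) = tokenString (R ∘ f) T := by
  induction T with
  | nil => rfl
  | cons x T ih =>
    simp only [tokenString, List.map_cons, List.flatMap_cons] at ih ⊢
    rw [ih]
    rcases x with b | j <;> rfl

theorem tokenString_append {A : ℕ} (R : Fin A → ℕ) (T T' : List (Bool ⊕ Fin A)) :
    tokenString R (T ++ T') = tokenString R T ++ tokenString R T' := List.flatMap_append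

theorem tokenString_flatMap {A : ℕ} {β : Type} (R : Fin A → ℕ) (L : List β)
    (f : β → List (Bool ⊕ Fin A)) :
    tokenString R (L.flatMap f) = L.flatMap fun x => tokenString R (f x) := List.flatMap_assoc

theorem tokenString_reverse {A : ℕ} (R : Fin A → ℕ) (T : List (Bool ⊕ Fin A)) :
    tokenString R T.reverse = (tokenString R T).reverse := by
  induction T with
  | nil => rfl
  | cons x T ih =>
    rw [List.reverse_cons, tokenString_append, ih]
    rcases x with b | j <;> simp [tokenString]

end Machine

open Machine

theorem PolyTime.reverse {α : Type} {i o : α → List Bool} (h : PolyTime i o) :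
    PolyTime i fun x => (o x).reverse := by
  refine h.comp (i' := fun l : List Bool => l) (o' := List.reverse) ?_ o fun _ => rfl
  refine polyTime_of_runs (K := Bool) (Γ := fun _ => Bool) (σ := Unit × Option Bool)
    (transfer false true id id) ((), none) false true (Equiv.refl Bool) (Equiv.refl Bool)
    (.X + 1) fun l => ?_
  have := runs_transfer (Γ := fun _ : Bool => Bool) (a := false) (b := true) (by simp) id id ()
    l (only false l) (only_self _ _)
  rw [update_only, only_nil, update_nil, only_of_ne (by simp), List.append_nil] at this
  refine (this.of_eq ?_ ?_).mono (by simp)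
  · exact congrArg (only _) (List.map_id _)
  · refine congrArg (only _) ?_
    simp

theorem polyTime_const {α : Type} (i : α → List Bool) (l : List Bool) :
    PolyTime i fun _ => l := by
  have h : PolyTime i fun _ => l.reverse := by
    refine polyTime_of_does (A := 0) ((drain (.inl 0)).seq (write (l.map .inl)))
      (2 * .X + 1 + .C (l.length * 2 + 1)) fun x => ?_
    have hl : tokenString (0 : Fin 0 → ℕ) (l.map .inl) = l := by
      simp [tokenString, List.flatMap_map]
    have := (does_clearInput (i x) [] 0).seq
      (does_write [] (R := (0 : Fin 0 → ℕ)) (N := 0) (fun _ => le_rfl) (l.map .inl) [])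
    rw [hl, List.append_nil] at this
    refine this.mono ?_
    simp
  simpa using h.reverse

/-! ### Processing the gates of a circuit -/

namespace Machine

/-- Skips a unary number. -/
def skipUnary (A : ℕ) : Prog A :=
  (loop (· == some true) (.inl 0) (drop (.inl 0))).seq (drop (.inl 0))

theorem does_skipUnary {A : ℕ} (n : ℕ) (i o : List Bool) (R : Fin A → ℕ) :
    Does (skipUnary A) (unaryCode n ++ i) o R i o R (2 * n + 2) := by
  have h : Does (loop (· == some true) (.inl 0) (drop (.inl 0))) (unaryCode n ++ i) o R
      (false :: i) o R (2 * n + 1) := by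
    induction n with
    | zero => exact runs_loop_stop _ rfl
    | succ n ih =>
      exact Does.mono (i := unaryCode (n + 1) ++ i)
        (runs_loop_step (t := 1) rfl (does_drop true _ o R) ih) (by omega)
  exact (h.seq (does_drop false i o _)).mono (by omega)

/-- Reads the wires of a gate, writes a string, and clears the registers. -/
def gateProg {A r : ℕ} (h : r ≤ A) (T : List (Bool ⊕ Fin r)) : Prog A :=
  (readList ((List.finRange r).map (Fin.castLE h))).seq
    ((write (T.map (Sum.map id (Fin.castLE h)))).seq (clearAll A))

theorem does_gateProg {A r N : ℕ} (h : r ≤ A) (T : List (Bool ⊕ Fin r)) (V : Fin r → ℕ)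
    (hV : ∀ j, V j ≤ N) (i o : List Bool) :
    Does (gateProg h T) ((List.ofFn fun j => unaryCode (V j)).flatten ++ i) o 0 i
      ((tokenString V T).reverse ++ o) 0 ((3 * r + 2 * T.length + 2 * A + 3) * (N + 1)) := by
  set W : Fin A → ℕ := fun j => if h : (j : ℕ) < r then V ⟨j, h⟩ else 0 with hW
  have hWN : ∀ j, W j ≤ N := by
    intro j
    simp only [hW]
    split_ifs
    · exact hV _
    · exact Nat.zero_le _
  have hWV : W ∘ Fin.castLE h = V := by
    funext j
    simp [hW]
  have h₁ := does_readList i o hWN ((List.finRange r).map (Fin.castLE h))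
    ((List.nodup_finRange r).map (Fin.castLE_injective h)) 0 fun _ _ => rfl
  have e₁ : (((List.finRange r).map (Fin.castLE h)).map fun j => unaryCode (W j)).flatten =
      (List.ofFn fun j => unaryCode (V j)).flatten := by
    rw [List.map_map, List.ofFn_eq_map, ← hWV]
    rfl
  have e₂ : (fun j => if j ∈ (List.finRange r).map (Fin.castLE h) then W j else
      (0 : Fin A → ℕ) j) = W := by
    funext j
    split_ifs with hj
    · rfl
    · have : ¬ (j : ℕ) < r := fun hr => hj (List.mem_map.2 ⟨⟨j, hr⟩, List.mem_finRange _, rfl⟩)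
      simp [hW, this]
  rw [e₁, e₂, List.length_map, List.length_finRange] at h₁
  have h₂ := does_write i hWN (T.map (Sum.map id (Fin.castLE h))) o
  rw [tokenString_map, hWV, List.length_map] at h₂
  refine (h₁.seq (h₂.seq (does_clearAll i _ hWN))).mono ?_
  nlinarith [Nat.zero_le r, Nat.zero_le N, Nat.zero_le A]

/-- Processes a sequence of gates. -/
def gatesProg (G : GateSet) {A : ℕ} (hA : ∀ g, (G.gate g).arity ≤ A)
    (T : ∀ g, List (Bool ⊕ Fin (G.gate g).arity)) : Prog A :=
  loop Option.isSome (.inl 0) (select (List.ofFn fun g => gateProg (hA g) (T g)))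

/-- Every placement has a nonempty code, so an empty input marks the end. The gate index selects one
of finitely many fixed programs, which reads the wires and writes its template; all registers are
zero again before the next gate. -/
theorem does_gatesProg (G : GateSet) {A w N : ℕ} (hN : w ≤ N) (hA : ∀ g, (G.gate g).arity ≤ A)
    (T : ∀ g, List (Bool ⊕ Fin (G.gate g).arity)) {c : ℕ} (hc : ∀ g : Fin G.size,
      3 * (G.gate g).arity + 2 * (T g).length + 2 * A + 3 ≤ c) (C : List (Instr G w)) :
    ∀ o, Does (gatesProg G hA T) (C.flatMap Instr.encode) o 0 []
      ((C.flatMap fun I => tokenString (fun j => (I.wires j : ℕ)) (T I.gate)).reverse ++ o) 0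
      (C.length * ((c + 2 * G.size + 3) * (N + 1)) + 1) := by
  induction C with
  | nil => exact fun o => Does.mono (runs_loop_stop _ rfl) (by simp)
  | cons I C ih =>
    intro o
    have h₁ := does_gateProg (N := N) (hA I.gate) (T I.gate) (fun j => (I.wires j : ℕ))
      (fun j => (I.wires j).2.le.trans hN) (C.flatMap Instr.encode) o
    have hg : (I.gate : ℕ) < (List.ofFn fun g => gateProg (hA g) (T g)).length := by simp
    have h₂ := does_select (List.ofFn fun g => gateProg (hA g) (T g)) I.gate hg
      (by rw [List.getElem_ofFn]; exact h₁)
    have h₃ := ih ((tokenString (fun j => (I.wires j : ℕ)) (T I.gate)).reverse ++ o)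
    have e : (I :: C).flatMap Instr.encode = unaryCode I.gate ++
        ((List.ofFn fun j => unaryCode (I.wires j)).flatten ++ C.flatMap Instr.encode) := by
      rw [List.flatMap_cons, Instr.encode, List.append_assoc]
    have hsome : ((I :: C).flatMap Instr.encode).head?.isSome = true := by
      rw [e]
      rcases (I.gate : ℕ) with _ | n <;> rfl
    rw [List.flatMap_cons (f := fun I : Instr G w => tokenString _ _), List.reverse_append,
      List.append_assoc]
    rw [← e] at h₂
    refine Does.mono (runs_loop_step (c := Option.isSome) hsome h₂ h₃) ?_
    have h4 := Nat.mul_le_mul_right (N + 1) (hc I.gate)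
    have h5 := I.gate.2
    have h6 : G.size ≤ G.size * (N + 1) := Nat.le_mul_of_pos_right _ (by omega)
    rw [List.length_cons, Nat.add_mul C.length 1, Nat.add_mul (c + 2 * G.size),
      Nat.add_mul c, Nat.mul_assoc 2]
    omega

end Machine

theorem Circuit.width_le_length_encode {G : GateSet} (Q : Circuit G) :
    Q.width ≤ Q.encode.length := by
  simp [Circuit.encode, unaryCode]

theorem Instr.length_gates_le {G : GateSet} {w : ℕ} (C : List (Instr G w)) :
    C.length ≤ (C.flatMap Instr.encode).length := by
  induction C with
  | nil => simp
  | cons I C ih =>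
    rw [List.flatMap_cons, List.length_append, List.length_cons]
    simp [Instr.encode, unaryCode] at ih ⊢
    omega

theorem Circuit.length_gates_le_length_encode {G : GateSet} (Q : Circuit G) :
    Q.gates.length ≤ Q.encode.length := by
  refine (Instr.length_gates_le Q.gates).trans ?_
  rw [Circuit.encode, List.length_append]
  omega

/-- This is the string the machine leaves on its output stack. It is kept as a separate statement
because inverse circuits list the gates in reverse order. -/
theorem polyTime_gates_reverse (G : GateSet) (T : ∀ g, List (Bool ⊕ Fin (G.gate g).arity)) :
    PolyTime (Circuit.encode (G := G)) fun Q =>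
      (Q.gates.flatMap fun I => tokenString (fun j => (I.wires j : ℕ)) (T I.gate)).reverse := by
  -- Sums over the finite gate set serve as uniform bounds, here for the number of registers and
  -- below for the cost of one gate.
  set A := ∑ g, (G.gate g).arity
  have hA : ∀ g, (G.gate g).arity ≤ A := fun g =>
    Finset.single_le_sum (f := fun g => (G.gate g).arity) (fun _ _ => Nat.zero_le _)
      (Finset.mem_univ g)
  set c := ∑ g, (3 * (G.gate g).arity + 2 * (T g).length + 2 * A + 3)
  have hc : ∀ g, 3 * (G.gate g).arity + 2 * (T g).length + 2 * A + 3 ≤ c := fun g =>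
    Finset.single_le_sum (f := fun g => 3 * (G.gate g).arity + 2 * (T g).length + 2 * A + 3)
      (fun _ _ => Nat.zero_le _) (Finset.mem_univ g)
  refine polyTime_of_does ((skipUnary A).seq ((skipUnary A).seq (gatesProg G hA T)))
    (4 * .X + 5 + .X * (.C (c + 2 * G.size + 3) * (.X + 1))) fun Q => ?_
  have hw := Q.width_le_length_encode
  have ho := Q.output.2
  have h := does_gatesProg G hw hA T hc Q.gates []
  rw [List.append_nil] at h
  have h' := (does_skipUnary Q.width _ [] 0).seq ((does_skipUnary Q.output _ [] 0).seq h)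
  rw [← List.append_assoc] at h'
  refine h'.mono ?_
  have h'' := Nat.mul_le_mul_right ((c + 2 * G.size + 3) * (Q.encode.length + 1))
    Q.length_gates_le_length_encode
  simp only [Polynomial.eval_add, Polynomial.eval_mul, Polynomial.eval_X, Polynomial.eval_C,
    Polynomial.eval_one, Polynomial.eval_ofNat]
  omega

theorem polyTime_gates (G : GateSet) (T : ∀ g, List (Bool ⊕ Fin (G.gate g).arity)) :
    PolyTime (Circuit.encode (G := G)) fun Q =>
      Q.gates.flatMap fun I => tokenString (fun j => (I.wires j : ℕ)) (T I.gate) := by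
  simpa using (polyTime_gates_reverse G T).reverse

namespace Machine

/-! ### Strings depending on the width and output qubit of a circuit -/

theorem update_vec_zero (a b c x : ℕ) : Function.update ![a, b, c] 0 x = ![x, b, c] := by
  funext j; fin_cases j <;> rfl

theorem update_vec_one (a b c x : ℕ) : Function.update ![a, b, c] 1 x = ![a, x, c] := by
  funext j; fin_cases j <;> rfl

theorem update_vec_two (a b c x : ℕ) : Function.update ![a, b, c] 2 x = ![a, b, x] := by
  funext j; fin_cases j <;> rfl

theorem vec_le {a b c N : ℕ} (ha : a ≤ N) (hb : b ≤ N) (hc : c ≤ N) (j : Fin 3) :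
    ![a, b, c] j ≤ N := by
  fin_cases j <;> assumption

/-- Moves the register `0` to the register `2`, and writes a string for each of its values. -/
def ascend (T : List (Bool ⊕ Fin 1)) : Prog 3 :=
  loop Option.isSome (.inr 0) ((drop (.inr 0)).seq
    ((write (T.map (Sum.map id fun _ => 2))).seq (push (.inr 2) true)))

/-- Register `2` runs upwards while register `0` counts down, so at the end the loop bound sits in
register `2`, ready for `descend`. -/
theorem does_ascend {N b : ℕ} (hb : b ≤ N) (T : List (Bool ⊕ Fin 1)) (i : List Bool) (a : ℕ) :
    ∀ (c : ℕ) (o : List Bool), a + c ≤ N →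
    Does (ascend T) i o ![a, b, c] i (((List.range' c a).flatMap fun j =>
      tokenString (fun _ => j) T).reverse ++ o) ![0, b, c + a]
      (a * (T.length * (2 * N + 2) + 4) + 1) := by
  induction a with
  | zero => exact fun c o _ => Does.mono (runs_loop_stop _ rfl) (by simp)
  | succ a ih =>
    intro c o h
    have h₁ := does_dec 0 i o ![a + 1, b, c]
    have h₂ := does_write i (R := ![a, b, c]) (vec_le (N := N) (by omega) hb (by omega))
      (T.map (Sum.map id fun _ => 2)) o
    have h₃ := fun o => does_inc 2 i o ![a, b, c]
    have e : (![a, b, c] ∘ fun _ : Fin 1 => (2 : Fin 3)) = fun _ => c := rfl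
    rw [update_vec_zero, show ![a + 1, b, c] 0 - 1 = a from rfl] at h₁
    rw [tokenString_map, e, List.length_map] at h₂
    simp only [update_vec_two, show ![a, b, c] 2 = c from rfl] at h₃
    have h₄ := ih (c + 1) ((tokenString (fun _ => c) T).reverse ++ o) (by omega)
    rw [List.range'_succ, List.flatMap_cons, List.reverse_append, List.append_assoc,
      show c + (a + 1) = c + 1 + a by omega]
    refine Does.mono (runs_loop_step (c := Option.isSome) rfl (h₁.seq (h₂.seq (h₃ _))) h₄) ?_
    rw [Nat.add_mul a 1]
    omega

/-- Decreases the register `2` to zero, and writes a string for each of its values. -/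
def descend (T : List (Bool ⊕ Fin 1)) : Prog 3 :=
  loop Option.isSome (.inr 2) ((drop (.inr 2)).seq (write (T.map (Sum.map id fun _ => 2))))

theorem does_descend {N a b : ℕ} (ha : a ≤ N) (hb : b ≤ N) (T : List (Bool ⊕ Fin 1))
    (i : List Bool) (c : ℕ) : ∀ o : List Bool, c ≤ N →
    Does (descend T) i o ![a, b, c] i (((List.range c).reverse.flatMap fun j =>
      tokenString (fun _ => j) T).reverse ++ o) ![a, b, 0]
      (c * (T.length * (2 * N + 2) + 3) + 1) := by
  induction c with
  | zero => exact fun o _ => Does.mono (runs_loop_stop _ rfl) (by simp)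
  | succ c ih =>
    intro o h
    have h₁ := does_dec 2 i o ![a, b, c + 1]
    have h₂ := does_write i (R := ![a, b, c]) (vec_le (N := N) ha hb (by omega))
      (T.map (Sum.map id fun _ => 2)) o
    have e : (![a, b, c] ∘ fun _ : Fin 1 => (2 : Fin 3)) = fun _ => c := rfl
    rw [update_vec_two, show ![a, b, c + 1] 2 - 1 = c from rfl] at h₁
    rw [tokenString_map, e, List.length_map] at h₂
    have h₄ := ih ((tokenString (fun _ => c) T).reverse ++ o) (by omega)
    rw [List.range_succ, List.reverse_append, List.reverse_singleton, List.singleton_append,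
      List.flatMap_cons, List.reverse_append, List.append_assoc]
    refine Does.mono (runs_loop_step (c := Option.isSome) rfl (h₁.seq h₂) h₄) ?_
    rw [Nat.add_mul c 1]
    omega

/-- Decreases the register `0`, if `d` is set. -/
def decIf (d : Bool) : Prog 3 := bif d then drop (.inr 0) else skip

theorem does_decIf (d : Bool) (a b c : ℕ) (i o : List Bool) :
    Does (decIf d) i o ![a, b, c] i o ![a - d.toNat, b, c] 1 := by
  rcases d with _ | _
  · exact does_skip i o _
  · have := does_dec 0 i o ![a, b, c]
    rwa [update_vec_zero] at this

end Machine

open Machine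

/-- The shape of a test: an ascending loop, a middle piece, and a descending loop. The middle piece
reads the loop bound from register `2`, where the ascending loop has put it. The switch `d` lowers
the bound by one, for the `w - 1` mixed qubits of a purification. -/
theorem polyTime_layout (G : GateSet) (d : Bool) (T₁ T₂ T₃ : List (Bool ⊕ Fin 3))
    (U V : List (Bool ⊕ Fin 1)) :
    PolyTime (Circuit.encode (G := G)) fun Q =>
      tokenString ![Q.width, Q.output, 0] T₁ ++
      ((List.range (Q.width - d.toNat)).flatMap fun j => tokenString (fun _ => j) U) ++
      tokenString ![0, Q.output, Q.width - d.toNat] T₂ ++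
      ((List.range (Q.width - d.toNat)).reverse.flatMap fun j => tokenString (fun _ => j) V) ++
      tokenString ![0, Q.output, 0] T₃ := by
  suffices h : PolyTime (Circuit.encode (G := G)) fun Q =>
      (tokenString ![Q.width, Q.output, 0] T₁ ++
      ((List.range (Q.width - d.toNat)).flatMap fun j => tokenString (fun _ => j) U) ++
      tokenString ![0, Q.output, Q.width - d.toNat] T₂ ++
      ((List.range (Q.width - d.toNat)).reverse.flatMap fun j => tokenString (fun _ => j) V) ++
      tokenString ![0, Q.output, 0] T₃).reverse by
    simpa only [List.reverse_reverse] using h.reverse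
  refine polyTime_of_does ((read 0).seq ((read 1).seq ((drain (.inl 0)).seq ((write T₁).seq
    ((decIf d).seq ((ascend U).seq ((write T₂).seq ((descend V).seq ((write T₃).seq
    (clearAll 3))))))))))
    ((3 * .X + 2) + ((3 * .X + 2) + ((2 * .X + 1) + ((.C T₁.length * (2 * .X + 2) + 1) +
      (1 + ((.X * (.C U.length * (2 * .X + 2) + 4) + 1) + ((.C T₂.length * (2 * .X + 2) + 1) +
      ((.X * (.C V.length * (2 * .X + 2) + 3) + 1) + ((.C T₃.length * (2 * .X + 2) + 1) +
      (3 * (2 * .X + 1) + 1)))))))))) fun Q => ?_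
  set N := Q.encode.length with hN
  have hw : Q.width ≤ N := Q.width_le_length_encode
  have ho : (Q.output : ℕ) ≤ N := Q.output.2.le.trans hw
  have hC : (Q.gates.flatMap Instr.encode).length ≤ N := by
    rw [hN, Circuit.encode, List.length_append]
    omega
  have hk : Q.width - d.toNat ≤ N := (Nat.sub_le _ _).trans hw
  have h0 : (0 : Fin 3 → ℕ) = ![0, 0, 0] := by funext j; fin_cases j <;> rfl
  have r₁ := does_read (0 : Fin 3) Q.width (unaryCode Q.output ++ Q.gates.flatMap Instr.encode)
    [] ![0, 0, 0]
  have r₂ := does_read (1 : Fin 3) Q.output (Q.gates.flatMap Instr.encode) [] ![Q.width, 0, 0]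
  have hz : (![0, 0, 0] : Fin 3 → ℕ) 0 + Q.width = Q.width := Nat.zero_add _
  have hz' : (![Q.width, 0, 0] : Fin 3 → ℕ) 1 + Q.output = Q.output := Nat.zero_add _
  rw [update_vec_zero, hz] at r₁
  rw [update_vec_one, hz'] at r₂
  have r₃ := does_clearInput (Q.gates.flatMap Instr.encode) [] ![Q.width, (Q.output : ℕ), 0]
  have w₁ := fun o => does_write [] (vec_le hw ho (Nat.zero_le N)) T₁ o
  have r₄ := fun o => does_decIf d Q.width Q.output 0 [] o
  have a₁ := fun o => does_ascend ho U [] (Q.width - d.toNat) 0 o (by omega)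
  rw [Nat.zero_add] at a₁
  have w₂ := fun o => does_write [] (vec_le (Nat.zero_le N) ho hk) T₂ o
  have a₂ := fun o => does_descend (Nat.zero_le N) ho V [] (Q.width - d.toNat) o hk
  have w₃ := fun o => does_write [] (vec_le (Nat.zero_le N) ho (Nat.zero_le N)) T₃ o
  have r₅ := fun o => does_clearAll [] o (vec_le (Nat.zero_le N) ho (Nat.zero_le N))
  have h := r₁.seq (r₂.seq (r₃.seq ((w₁ _).seq ((r₄ _).seq ((a₁ _).seq ((w₂ _).seq
    ((a₂ _).seq ((w₃ _).seq (r₅ _)))))))))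
  simp only [List.append_nil, ← List.reverse_append, ← List.append_assoc,
    ← List.range_eq_range'] at h
  rw [h0]
  rw [h0] at h
  refine h.mono ?_
  simp only [Polynomial.eval_add, Polynomial.eval_mul, Polynomial.eval_X, Polynomial.eval_C,
    Polynomial.eval_one, Polynomial.eval_ofNat]
  have h₁ := Nat.mul_le_mul_right (U.length * (2 * N + 2) + 4) hk
  have h₂ := Nat.mul_le_mul_right (V.length * (2 * N + 2) + 3) hk
  omega

/-! ### Codes of the constructed circuits as token strings -/

namespace Machine

variable {A : ℕ}

/-- Tokens for a fixed string. -/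
def literal (l : List Bool) : List (Bool ⊕ Fin A) := l.map .inl

/-- Tokens for the code of `m * n + r`, where `n` is the contents of the register `j`. -/
def affine (m r : ℕ) (j : Fin A) : List (Bool ⊕ Fin A) :=
  List.replicate m (.inr j) ++ literal (unaryCode r)

theorem tokenString_literal (R : Fin A → ℕ) (l : List Bool) :
    tokenString R (literal l) = l := by
  simp [tokenString, literal, List.flatMap_map]

theorem tokenString_affine (R : Fin A → ℕ) (m r : ℕ) (j : Fin A) :
    tokenString R (affine m r j) = unaryCode (m * R j + r) := by
  rw [affine, tokenString_append, tokenString_literal]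
  induction m with
  | zero => simp [tokenString]
  | succ m ih =>
    simp only [tokenString, List.replicate_succ, List.flatMap_cons, Sum.elim_inr,
      List.append_assoc] at ih ⊢
    rw [ih, show (m + 1) * R j + r = R j + (m * R j + r) by ring]
    simp only [unaryCode, List.replicate_add, List.append_assoc]

theorem tokenString_nil (R : Fin A → ℕ) : tokenString R [] = [] := rfl

end Machine

open Machine

/-- Tokens for a gate placement on affinely relabelled qubits. -/
def Instr.tokens {G : GateSet} {k : ℕ} (m r : ℕ) (I : Instr G k) : List (Bool ⊕ Fin k) :=
  literal (unaryCode I.gate) ++ (List.finRange _).flatMap fun j => affine m r (I.wires j)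

theorem Instr.tokenString_tokens {G : GateSet} {k w w' : ℕ} (m r : ℕ) (I : Instr G k)
    (e : Fin k ↪ Fin w) (f : Fin w ↪ Fin w') (hf : ∀ j, (f j : ℕ) = m * j + r) :
    tokenString (fun j => (e j : ℕ)) (I.tokens m r) = ((I.map e).map f).encode := by
  rw [Instr.tokens, tokenString_append, tokenString_literal, tokenString_flatMap, Instr.encode,
    List.ofFn_eq_map, List.flatMap_def]
  refine congrArg (unaryCode I.gate ++ ·) (congrArg List.flatten (List.map_congr_left ?_))
  intro j _
  rw [tokenString_affine]
  exact congrArg unaryCode (hf _).symm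

/-- A gate on its own qubits. -/
def Instr.self {G : GateSet} (g : Fin G.size) : Instr G (G.gate g).arity :=
  ⟨g, Function.Embedding.refl _⟩

theorem Instr.self_map {G : GateSet} {w : ℕ} (I : Instr G w) :
    (Instr.self I.gate).map I.wires = I := rfl

theorem List.flatMap_finRange {β : Type} (w : ℕ) (f : ℕ → List β) :
    (List.finRange w).flatMap (fun j : Fin w => f j) = (List.range w).flatMap f := by
  rw [← List.map_coe_finRange_eq_range, List.flatMap_map]

theorem List.flatMap_reverse_finRange {β : Type} (w : ℕ) (f : ℕ → List β) :
    (List.finRange w).reverse.flatMap (fun j : Fin w => f j) = (List.range w).reverse.flatMap f := by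
  rw [← List.map_coe_finRange_eq_range, ← List.map_reverse, List.flatMap_map]

namespace StdGates

variable {G : GateSet} (S : StdGates G) {A w : ℕ}

/-- Tokens for `StdGates.nor`. -/
def norTokens (a b t : List (Bool ⊕ Fin A)) : List (Bool ⊕ Fin A) :=
  let h := literal (unaryCode S.gH) ++ t
  let p := literal (unaryCode S.gT) ++ t
  let c := fun x => literal (unaryCode S.gC) ++ (x ++ t)
  h ++ (p ++ (c b ++ (p ++ (c a ++ (p ++ (c b ++ (p ++ (c a ++ h))))))))

theorem tokenString_norTokens (R : Fin A → ℕ) {a b t : Fin w} {hat : a ≠ t} {hbt : b ≠ t}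
    {a' b' t' : List (Bool ⊕ Fin A)} (ha : tokenString R a' = unaryCode a)
    (hb : tokenString R b' = unaryCode b) (ht : tokenString R t' = unaryCode t) :
    tokenString R (S.norTokens a' b' t') = (S.nor a b t hat hbt).flatMap Instr.encode := by
  simp only [norTokens, tokenString_append, tokenString_literal, ha, hb, ht, nor,
    List.flatMap_cons, List.flatMap_nil, encode_h, encode_t, encode_cn, List.append_nil]

/-- Tokens for `StdGates.checkLow`. -/
def lowTokens : List (Bool ⊕ Fin 1) := S.norTokens (affine 4 2 0) (affine 4 1 0) (affine 4 0 0)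

/-- Tokens for `StdGates.checkHigh`. -/
def highTokens : List (Bool ⊕ Fin 1) := S.norTokens (affine 4 4 0) (affine 4 3 0) (affine 4 2 0)

/-- Tokens for the test of the flag. -/
def flagTokens : List (Bool ⊕ Fin 3) :=
  literal (unaryCode S.gC) ++ (affine 4 1 2 ++ affine 4 0 2)

theorem tokenString_lowTokens (j : Fin w) :
    tokenString (fun _ => j) S.lowTokens = (S.checkLow j).flatMap Instr.encode :=
  S.tokenString_norTokens _ (tokenString_affine ..) (tokenString_affine ..)
    (tokenString_affine ..)

theorem tokenString_highTokens (j : Fin w) :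
    tokenString (fun _ => j) S.highTokens = (S.checkHigh j).flatMap Instr.encode :=
  S.tokenString_norTokens _ (tokenString_affine ..) (tokenString_affine ..)
    (tokenString_affine ..)

theorem tokenString_flagTokens (a b : ℕ) :
    tokenString ![a, b, w] S.flagTokens = (S.checkFlag w (G := G)).encode := by
  refine Eq.trans ?_ (S.encode_cn (flagWire w) (topWire w) _).symm
  simp only [flagTokens, tokenString_append, tokenString_literal, tokenString_affine]
  rfl

theorem encode_checkGates (a b w : ℕ) :
    (S.checkGates (List.finRange w)).flatMap Instr.encode =
      ((List.range w).flatMap fun j =>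
        tokenString (fun _ => j) (S.lowTokens ++ S.highTokens)) ++
      tokenString ![a, b, w] S.flagTokens ++
      ((List.range w).reverse.flatMap fun j =>
        tokenString (fun _ => j) (S.highTokens ++ S.lowTokens)) := by
  rw [← List.flatMap_finRange, ← List.flatMap_reverse_finRange]
  simp only [checkGates, List.flatMap_append, List.flatMap_assoc, tokenString_append,
    tokenString_lowTokens, tokenString_highTokens, tokenString_flagTokens, List.flatMap_singleton]

end StdGates

section

variable {G : GateSet} (inv : ∀ g : Fin G.size, List (Instr G (G.gate g).arity))

theorem polyTime_twoCopies :
    PolyTime (Circuit.encode (G := G)) fun Q => (twoCopies (copyWires Q.width 1 (by omega))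
      (copyWires Q.width 3 (by omega)) Q.gates).flatMap Instr.encode := by
  convert polyTime_gates G fun g => (Instr.self g).tokens 4 1 ++ (Instr.self g).tokens 4 3
    using 2 with Q
  rw [twoCopies, List.flatMap_assoc]
  congr 1
  funext I
  rw [tokenString_append, Instr.tokenString_tokens 4 1 _ _ (copyWires Q.width 1 (by omega))
    fun _ => rfl, Instr.tokenString_tokens 4 3 _ _ (copyWires Q.width 3 (by omega)) fun _ => rfl]
  simp [Instr.self_map]

/-- The templates are written backwards: reversing the whole output then reverses the order of the
gates, but leaves the block that inverts each gate in its proper order. -/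
theorem polyTime_twoCopies_invGates :
    PolyTime (Circuit.encode (G := G)) fun Q => (twoCopies (copyWires Q.width 1 (by omega))
      (copyWires Q.width 3 (by omega)) (invGates inv Q.gates)).flatMap Instr.encode := by
  convert polyTime_gates_reverse G fun g =>
    ((inv g).flatMap fun J => J.tokens 4 1 ++ J.tokens 4 3).reverse using 2 with Q
  simp only [tokenString_reverse]
  rw [List.reverse_flatMap]
  simp only [Function.comp_def, List.reverse_reverse, tokenString_flatMap, tokenString_append]
  rw [twoCopies, invGates, List.flatMap_assoc, List.flatMap_assoc]
  congr 1
  funext I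
  rw [List.flatMap_map]
  congr 1
  funext J
  rw [Instr.tokenString_tokens 4 1 _ _ (copyWires Q.width 1 (by omega)) fun _ => rfl,
    Instr.tokenString_tokens 4 3 _ _ (copyWires Q.width 3 (by omega)) fun _ => rfl]
  simp

/-- The code is cut into five pieces: header and first test, the two copies, the controlled flip of
the flag, the inverse copies, and second test with final flip. Each piece is computed from the code
of `Q` and the results are concatenated. -/
theorem polyTime_encode_oneClean (S : StdGates G) :
    PolyTime (Circuit.encode (G := G)) fun Q => (S.oneClean inv Q).encode := by
  have h₁ := polyTime_layout G false (affine 4 2 0 ++ literal (unaryCode 0)) S.flagTokens []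
    (S.lowTokens ++ S.highTokens) (S.highTokens ++ S.lowTokens)
  -- With empty loops only the first tokens matter; there register `0` holds the width and register
  -- `1` the output qubit.
  have h₂ := polyTime_layout G false (S.norTokens (affine 4 1 1) (affine 4 3 1) (affine 4 1 0))
    [] [] [] []
  have h₃ := polyTime_layout G false [] S.flagTokens
    (literal (((S.flip (0 : Fin 1)).flatMap Instr.encode)))
    (S.lowTokens ++ S.highTokens) (S.highTokens ++ S.lowTokens)
  have h := h₁.append ((polyTime_twoCopies (G := G)).append (h₂.append
    ((polyTime_twoCopies_invGates inv).append h₃)))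
  refine (congrArg (PolyTime _) (funext fun Q => ?_)).mp h
  -- The code of a gate on qubit `0` does not depend on the width, so the final flip is a fixed
  -- string.
  have hflip : (S.flip (0 : Fin (4 * Q.width + 2))).flatMap Instr.encode =
      (S.flip (0 : Fin 1)).flatMap Instr.encode := by
    simp [StdGates.flip, StdGates.encode_h, StdGates.encode_t]
  simp only [Circuit.encode, StdGates.oneClean, StdGates.coreGates, List.flatMap_append, hflip,
    S.encode_checkGates 0 Q.output Q.width, tokenString_append, tokenString_literal,
    tokenString_nil, Bool.toNat_false, Nat.sub_zero, List.append_nil, tokenString_affine]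
  have hnil : ∀ L : List ℕ, (L.flatMap fun _ => ([] : List Bool)) = [] := by simp
  have hnor := S.tokenString_norTokens ![Q.width, (Q.output : ℕ), 0]
    (a := wireAt 1 (by omega) Q.output) (b := wireAt 3 (by omega) Q.output)
    (t := flagWire Q.width)
    (hat := fun h => by have := congrArg Fin.val h; simp only [wireAt, flagWire] at this; omega)
    (hbt := fun h => by have := congrArg Fin.val h; simp only [wireAt, flagWire] at this; omega)
    (tokenString_affine _ 4 1 1) (tokenString_affine _ 4 3 1) (tokenString_affine _ 4 1 0)
  rw [hnor, hnil, hnil]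
  simp only [List.append_nil, List.nil_append, List.append_assoc]
  rfl

theorem polyTime_encode_purify (S : StdGates G) :
    PolyTime (Circuit.encode (G := G)) fun Q => (S.purify Q).encode := by
  have h₁ := polyTime_layout G true (affine 2 0 0 ++ affine 2 0 1) [] []
    (literal (unaryCode S.gH) ++ affine 2 2 0 ++ literal (unaryCode S.gC) ++ affine 2 2 0 ++
      affine 2 3 0) []
  have h₂ := polyTime_gates G fun g => (Instr.self g).tokens 2 0
  refine (congrArg (PolyTime _) (funext fun Q => ?_)).mp (h₁.append h₂)
  simp only [Circuit.encode, StdGates.purify, List.flatMap_append, tokenString_append,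
    tokenString_literal, tokenString_nil, Bool.toNat_true, List.append_nil, tokenString_affine]
  have hnil : ∀ L : List ℕ, (L.flatMap fun _ => ([] : List Bool)) = [] := by simp
  have hgates : (Q.gates.map (Instr.map (pairWires Q.width 0 (by omega)))).flatMap Instr.encode =
      Q.gates.flatMap fun I =>
        tokenString (fun j => (I.wires j : ℕ)) ((Instr.self I.gate).tokens 2 0) := by
    rw [List.flatMap_map]
    congr 1
    funext I
    rw [Instr.tokenString_tokens 2 0 _ _ (pairWires Q.width 0 (by omega)) fun _ => rfl]
    rfl
  have hmix : (S.mixGates Q.width (Q.width - 1) (by have := Q.output.2; omega)).flatMap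
      Instr.encode = (List.range (Q.width - 1)).flatMap fun j =>
        unaryCode S.gH ++ unaryCode (2 * j + 2) ++ unaryCode S.gC ++ unaryCode (2 * j + 2) ++
          unaryCode (2 * j + 3) := by
    rw [← List.flatMap_finRange, StdGates.mixGates, List.flatMap_assoc]
    congr 1
    funext j
    simp only [List.flatMap_cons, List.flatMap_nil, StdGates.encode_h, StdGates.encode_cn,
      List.append_nil, List.append_assoc]
  rw [hnil, hgates, hmix]
  simp only [List.append_nil, List.append_assoc]
  rfl

end

/-! ### Polynomially bounded functions and the four inclusions -/

theorem polyBounded_iff (f : ℕ → ℕ) : PolyBounded f ↔ (∀ n, 0 < f n) ∧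
    PolyTime (fun n => List.replicate n true) fun n => List.replicate (f n) true :=
  and_congr Iff.rfl (nonempty_tm2ComputableInPolyTime_iff _ _ _)

theorem PolyBounded.add {f g : ℕ → ℕ} (hf : PolyBounded f) (hg : PolyBounded g) :
    PolyBounded fun n => f n + g n := by
  rw [polyBounded_iff] at hf hg ⊢
  refine ⟨fun n => Nat.add_pos_left (hf.1 n) _, ?_⟩
  simpa only [List.replicate_append_replicate] using hf.2.append hg.2

theorem polyBounded_const {k : ℕ} (hk : 0 < k) : PolyBounded fun _ => k :=
  (polyBounded_iff _).2 ⟨fun _ => hk, polyTime_const _ _⟩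

theorem PolyTimeUniform.comp {G : GateSet} {Q : List Bool → Circuit G} (hQ : PolyTimeUniform Q)
    {f : Circuit G → Circuit G} (hf : PolyTime Circuit.encode fun C => (f C).encode) :
    PolyTimeUniform fun x => f (Q x) := by
  rw [PolyTimeUniform, nonempty_tm2ComputableInPolyTime_iff] at hQ ⊢
  exact hQ.comp hf Q fun _ => rfl

/-- Supplies the threshold `c(n)` of `NQ1P`, which need not be computable: finitely many positive
numbers, here for the yes-instances of length `n`, have a common positive lower bound. -/
theorem exists_pos_le_of_finite {α : Type} {s : Set α} (hs : s.Finite) (f : α → ℝ)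
    (hf : ∀ x ∈ s, 0 < f x) : ∃ ε : ℝ, (0 < ε ∧ ε ≤ 1) ∧ ∀ x ∈ s, ε ≤ f x := by
  induction s, hs using Set.Finite.induction_on with
  | empty => exact ⟨1, ⟨one_pos, le_rfl⟩, by simp⟩
  | @insert a s _ _ ih =>
    obtain ⟨ε, ⟨h0, h1⟩, h⟩ := ih fun x hx => hf x (Set.mem_insert_of_mem _ hx)
    refine ⟨min ε (f a), ⟨lt_min h0 (hf a (Set.mem_insert _ _)), (min_le_left _ _).trans h1⟩, ?_⟩
    rintro x (rfl | hx)
    · exact min_le_right _ _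
    · exact (min_le_left _ _).trans (h x hx)

theorem PolyBounded.four_mul_add_two {w : ℕ → ℕ} (hw : PolyBounded w) :
    PolyBounded fun n => 4 * w n + 2 := by
  have := (((hw.add hw).add (hw.add hw)).add (polyBounded_const two_pos))
  convert this using 2
  ring

theorem PolyBounded.two_mul {w : ℕ → ℕ} (hw : PolyBounded w) : PolyBounded fun n => 2 * w n := by
  convert hw.add hw using 2
  ring

theorem StdGates.nqp_subset {G : GateSet} (S : StdGates G)
    {inv : ∀ g : Fin G.size, List (Instr G (G.gate g).arity)}
    (hinv : ∀ g, gatesUnitary (inv g) = (G.gate g).matᴴ) : NQP G ⊆ NQ1P G := by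
  rintro A ⟨Q, w, hQ, hw, hQw, hyes, hno⟩
  have hpos : ∀ x ∈ A.yes, 0 < accProb (S.oneClean inv (Q x)) 1 := by
    intro x hx
    have h := hyes x hx
    rw [← hQw] at h
    have h1 := accProb_width_le_one (Q x)
    rw [S.accProb_oneClean inv hinv]
    have : accProb (Q x) (Q x).width ^ 2 ≤ 1 := pow_le_one₀ h.le h1
    have : 0 < 2 - accProb (Q x) (Q x).width ^ 2 := by linarith
    positivity
  have hc : ∀ n, ∃ ε : ℝ, (0 < ε ∧ ε ≤ 1) ∧ ∀ x ∈ {x | x ∈ A.yes ∧ x.length = n},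
      ε ≤ accProb (S.oneClean inv (Q x)) 1 := fun n =>
    exists_pos_le_of_finite ((List.finite_length_eq Bool n).subset fun x hx => hx.2) _
      fun x hx => hpos x hx.1
  choose c hc hcx using hc
  refine ⟨c, hc, fun x => S.oneClean inv (Q x), fun n => 4 * w n + 2,
    hQ.comp (polyTime_encode_oneClean inv S), hw.four_mul_add_two,
    fun n => (by omega : 1 ≤ 4 * w n + 2),
    fun x => congrArg (4 * · + 2) (hQw x), fun x hx => hcx _ x ⟨hx, rfl⟩, fun x hx => ?_⟩
  have h := hno x hx
  rw [← hQw] at h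
  rw [S.accProb_oneClean inv hinv, h]
  simp

theorem StdGates.nq1p_subset {G : GateSet} (S : StdGates G) : NQ1P G ⊆ NQP G := by
  rintro A ⟨c, hc, Q, w, hQ, hw, -, hQw, hyes, hno⟩
  have hacc : ∀ x, accProb (S.purify (Q x)) (2 * w x.length) = accProb (Q x) 1 := fun x => by
    rw [← hQw, S.accProb_purify]
  refine ⟨fun x => S.purify (Q x), fun n => 2 * w n, hQ.comp (polyTime_encode_purify S),
    hw.two_mul, fun x => congrArg (2 * ·) (hQw x), fun x hx => ?_, fun x hx => ?_⟩
  · rw [hacc]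
    exact (hc _).1.trans_le (hyes x hx)
  · rw [hacc]
    exact le_antisymm (hno x hx) (accProb_nonneg _ _)

theorem StdGates.sbqp_subset {G : GateSet} (S : StdGates G)
    {inv : ∀ g : Fin G.size, List (Instr G (G.gate g).arity)}
    (hinv : ∀ g, gatesUnitary (inv g) = (G.gate g).matᴴ) : SBQP G ⊆ SBQ1P G := by
  rintro A ⟨p, Q, w, hp, hQ, hw, hQw, hyes, hno⟩
  have hpow : ∀ a b : ℕ, (1 / 2 : ℝ) ^ (2 * (a + b)) = (1 / 4) ^ b * ((1 / 2) ^ a) ^ 2 := by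
    intro a b
    rw [show (1 / 4 : ℝ) = (1 / 2) ^ 2 by norm_num, ← pow_mul, ← pow_mul, ← pow_add]
    congr 1
    ring
  -- The new threshold `2^{-2(p+w)}` is the factor `4^{-w}` of `accProb_oneClean` times the square
  -- of the old threshold.
  refine ⟨fun n => 2 * (p n + w n), (hp.add hw).two_mul, fun x => S.oneClean inv (Q x),
    fun n => 4 * w n + 2, hQ.comp (polyTime_encode_oneClean inv S), hw.four_mul_add_two,
    fun n => (by omega : 1 ≤ 4 * w n + 2), fun x => congrArg (4 * · + 2) (hQw x), fun x hx => ?_, fun x hx => ?_⟩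
  · have h := hyes x hx
    rw [← hQw] at h
    have h1 := accProb_width_le_one (Q x)
    rw [S.accProb_oneClean inv hinv]
    simp only
    rw [hpow, ← hQw]
    refine mul_le_mul_of_nonneg_left ?_ (by positivity)
    have h2 : ((1 / 2 : ℝ) ^ p x.length) ^ 2 ≤ accProb (Q x) (Q x).width ^ 2 :=
      pow_le_pow_left₀ (by positivity) h 2
    have h3 : accProb (Q x) (Q x).width ^ 2 ≤ 1 := pow_le_one₀ (accProb_nonneg _ _) h1
    -- Here `2 - a² ≥ 1`, where `a` is the acceptance probability of `Q x`.
    nlinarith [sq_nonneg (accProb (Q x) (Q x).width)]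
  · have h := hno x hx
    rw [← hQw] at h
    rw [S.accProb_oneClean inv hinv]
    simp only
    rw [pow_succ (1 / 2 : ℝ), hpow, ← hQw, mul_assoc]
    refine mul_le_mul_of_nonneg_left ?_ (by positivity)
    have h2 : accProb (Q x) (Q x).width ^ 2 ≤ ((1 / 2 : ℝ) ^ (p x.length + 1)) ^ 2 :=
      pow_le_pow_left₀ (accProb_nonneg _ _) h 2
    rw [pow_succ (1 / 2 : ℝ), mul_pow] at h2
    -- Here `2 - a² ≤ 2`, and twice the square of `2^{-p-1}` is half the square of `2^{-p}`: exactly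
    -- the required gap.
    nlinarith [sq_nonneg (accProb (Q x) (Q x).width)]

theorem StdGates.sbq1p_subset {G : GateSet} (S : StdGates G) : SBQ1P G ⊆ SBQP G := by
  rintro A ⟨p, hp, Q, w, hQ, hw, -, hQw, hyes, hno⟩
  have hacc : ∀ x, accProb (S.purify (Q x)) (2 * w x.length) = accProb (Q x) 1 := fun x => by
    rw [← hQw, S.accProb_purify]
  refine ⟨p, fun x => S.purify (Q x), fun n => 2 * w n, hp, hQ.comp (polyTime_encode_purify S),
    hw.two_mul, fun x => congrArg (2 * ·) (hQw x), fun x hx => ?_, fun x hx => ?_⟩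
  · rw [hacc]
    exact hyes x hx
  · rw [hacc]
    exact hno x hx

theorem theorem7 (G : GateSet) (hG : G.ContainsHTCNOT) (hinv : G.InverseClosed) :
    NQP G = NQ1P G ∧ SBQP G = SBQ1P G := by
  obtain ⟨S⟩ := hG.nonempty_stdGates
  choose inv hinv using hinv
  exact ⟨(S.nqp_subset hinv).antisymm S.nq1p_subset, (S.sbqp_subset hinv).antisymm S.sbq1p_subset⟩
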